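/- Let $\mathbb{S}$ be a compact Polish space and $\mathbb{O}=\mathbb{R}^p$. Let $(X_t,Y_t)_{t\ge 0}$ be a time-homogeneous $\mathbb{S}\times\mathbb{O}$-valued Feller–Markov process with càdlàg paths, realized as the coordinate process on $\Omega=D([0,\infty);\mathbb{S})\times D([0,\infty);\mathbb{O})$, where path space carries the Borel $\sigma$-algebra of the Skorokhod topology (equivalently, the $\sigma$-algebra generated by the coordinates). Let $\mathbf{P}_{(x,y)}$ be its law when started at $(x,y)$ (a measurable function of $(x,y)$), and $\mathbf{P}_\rho=\int \mathbf{P}_{(x,y)}\,\rho(dx,dy)$ for $\rho\in\mathcal{P}(\mathbb{S}\times\mathbb{O})$. Put $\mathscr{F}^X=\sigma\{X_t:t\ge0\}$, $\mathscr{F}^Y=\sigma\{Y_t:t\ge 0\}$ and $\mathscr{G}^Y=\sigma\{Y_t-Y_0:t\ge0\}$. Assume that the signal is Markov in its own right and that the observations have conditionally independent increments given the signal, in the following sense: for every bounded $\mathscr{F}^X\vee\mathscr{G}^Y$-measurable random variable $\xi$, the map $(x,y)\mapsto\mathbf{E}_{(x,y)}(\xi)$ does not depend on $y$. For $\mu\in\mathcal{P}(\mathbb{S})$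 write $\mathbf{P}^\mu=\mathbf{P}_{\mu\times\delta_{0}}$ (so $X_0\sim\mu$ and $Y_0=0$) and $\mathbf{E}^\mu$ for the corresponding expectation. Let $\mathscr{F}^Y_t$ be the usual augmentation (completion and right-continuous version) of the filtration $\sigma\{Y_s:s\le t\}$ with respect to the family $\{\mathbf{P}_\rho:\rho\in\mathcal{P}(\mathbb{S}\times\mathbb{O})\}$. Define the space of observable functions $$\mathcal{O}=\Big\{f\in C_b(\mathbb{S}):\ \int f\,d\mu_1=\int f\,d\mu_2\ \text{ for all } \mu_1,\mu_2\in\mathcal{P}(\mathbb{S}) \text{ with } \mathbf{P}^{\mu_1}|_{\mathscr{F}^Y}=\mathbf{P}^{\mu_2}|_{\mathscr{F}^Y}\Big\}.$$ Theorem. Let $\mu,\nu\in\mathcal{P}(\mathbb{S})$ with $\mu\ll\nu$, and let $f\in\mathcal{O}$. Then the processes $t\mapsto\mathbf{E}^\mu(f(X_t)|\mathscr{F}^Y_t)$ and $t\mapsto\mathbf{E}^\nu(f(X_t)|\mathscr{F}^Y_t)$ have càdlàg versions (under $\mathbf{P}^\mu$ and $\mathbf{P}^\nu$, respectively), and for any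 choice of such versions $$\big|\mathbf{E}^\mu(f(X_t)|\mathscr{F}^Y_t)-\mathbf{E}^\nu(f(X_t)|\mathscr{F}^Y_t)\big|\longrightarrow 0\quad\text{as } t\to\infty,\qquad \mathbf{P}^\mu\text{-a.s.}$$ -/

import Mathlib

open MeasureTheory ProbabilityTheory Filter Topology
open scoped NNReal ZeroAtInfty BoundedContinuousFunction

namespace HiddenMarkov

/-- A path `[0, ∞) → E` is càdlàg: right-continuous with left limits. -/
def IsCadlag {E : Type*} [TopologicalSpace E] (x : ℝ≥0 → E) : Prop :=
  ∀ t, ContinuousWithinAt x (Set.Ici t) t ∧ ∃ l, Tendsto x (𝓝[<] t) (𝓝 l)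

/-- The càdlàg path space `D([0, ∞); E)`. It carries the σ-algebra generated by the evaluations
`x ↦ x t`, which for Polish `E` is the Borel σ-algebra of the Skorokhod topology. -/
abbrev CadlagPath (E : Type*) [TopologicalSpace E] : Type _ := {x : ℝ≥0 → E // IsCadlag x}

/-- The observation state space `ℝᵖ`. -/
abbrev Obs (p : ℕ) : Type := EuclideanSpace ℝ (Fin p)

/-- The canonical space `Ω = D([0, ∞); S) × D([0, ∞); ℝᵖ)`. -/
abbrev Path (S : Type*) [TopologicalSpace S] (p : ℕ) : Type _ :=
  CadlagPath S × CadlagPath (Obs p)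

section Canonical

variable {S : Type*} [TopologicalSpace S] {p : ℕ}

/-- The canonical signal process. -/
def X (t : ℝ≥0) (ω : Path S p) : S := ω.1.1 t

/-- The canonical observation process. -/
def Y (t : ℝ≥0) (ω : Path S p) : Obs p := ω.2.1 t

/-- The signal-observation process. -/
def Z (t : ℝ≥0) (ω : Path S p) : S × Obs p := (X t ω, Y t ω)

variable [MeasurableSpace S]

variable (S p) in
/-- `ℱ_t = σ{(X_s, Y_s) : s ≤ t}`. -/
@[reducible] def jointSigma (t : ℝ≥0) : MeasurableSpace (Path S p) :=
  ⨆ s ≤ t, MeasurableSpace.comap (Z s) inferInstance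

variable (S p) in
/-- `ℱ_t^Y = σ{Y_s : s ≤ t}`. -/
@[reducible] def obsSigma (t : ℝ≥0) : MeasurableSpace (Path S p) :=
  ⨆ s ≤ t, MeasurableSpace.comap (Y s) inferInstance

variable (S p) in
/-- `ℱ^Y = σ{Y_t : t ≥ 0}`. -/
@[reducible] def obsSigmaTop : MeasurableSpace (Path S p) := ⨆ t, obsSigma S p t

variable (S p) in
/-- `ℱ^X = σ{X_t : t ≥ 0}`. -/
@[reducible] def signalSigmaTop : MeasurableSpace (Path S p) :=
  ⨆ t, MeasurableSpace.comap (X t) inferInstance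

variable (S p) in
/-- `𝒢^Y = σ{Y_t - Y_0 : t ≥ 0}`. -/
@[reducible] def incrSigmaTop : MeasurableSpace (Path S p) :=
  ⨆ t, MeasurableSpace.comap (fun ω : Path S p => Y t ω - Y 0 ω) inferInstance

lemma measurable_X (t : ℝ≥0) : Measurable (X t : Path S p → S) :=
  (measurable_pi_apply t).comp (measurable_subtype_coe.comp measurable_fst)

lemma measurable_Y (t : ℝ≥0) : Measurable (Y t : Path S p → Obs p) :=
  (measurable_pi_apply t).comp (measurable_subtype_coe.comp measurable_snd)

lemma obsSigma_le (t : ℝ≥0) : obsSigma S p t ≤ (inferInstance : MeasurableSpace (Path S p)) :=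
  iSup₂_le fun s _ => (measurable_Y s).comap_le

end Canonical

/-- A family of transition kernels on `E` is a (conservative) Feller semigroup: it consists of
Markov kernels, satisfies the Chapman-Kolmogorov equations, and `T_t f(z) = ∫ f dP_t(z, ·)` maps
`C₀(E)` to itself and is strongly continuous at `t = 0`. -/
structure IsFellerSemigroup {E : Type*} [TopologicalSpace E] [MeasurableSpace E]
    (P : ℝ≥0 → Kernel E E) : Prop where
  markov : ∀ t, IsMarkovKernel (P t)
  zero : P 0 = Kernel.id
  add : ∀ s t, P (s + t) = (P t).comp (P s)
  feller : ∀ (t : ℝ≥0) (f : C₀(E, ℝ)), ∃ g : C₀(E, ℝ), ∀ z, g z = ∫ w, f w ∂(P t z)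
  continuous_zero : ∀ f : C₀(E, ℝ),
    TendstoUniformly (fun (t : ℝ≥0) z => ∫ w, f w ∂(P t z)) (fun z => f z) (𝓝 0)

/-- A signal-observation model on the canonical path space: a time-homogeneous Feller-Markov process
`(X_t, Y_t)` with càdlàg paths in `S × ℝᵖ`, given by its transition kernels and its laws `P_(x,y)`,
such that the signal is Markov in its own right and the observations have conditionally independent
increments given the signal. -/
structure Model (S : Type*) [TopologicalSpace S] [MeasurableSpace S] (p : ℕ) where
  /-- The transition probabilities `P_t((x, y), ·)` of `(X_t, Y_t)`. -/
  trans : ℝ≥0 → Kernel (S × Obs p) (S × Obs p)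
  /-- The law `P_(x,y)` on path space of the process started at `(x, y)`. -/
  law : Kernel (S × Obs p) (Path S p)
  feller : IsFellerSemigroup trans
  law_prob : IsMarkovKernel law
  law_init : ∀ z, (law z).map (Z 0) = Measure.dirac z
  /-- The Markov property of `(X_t, Y_t)` with respect to `ℱ_t`, under every `P_(x,y)`. -/
  law_markov : ∀ (z : S × Obs p) (s t : ℝ≥0) (A : Set (S × Obs p)), MeasurableSet A →
    (law z)[(Z (s + t) ⁻¹' A).indicator (fun _ => (1 : ℝ)) | jointSigma S p s]
      =ᵐ[law z] fun ω => (trans t (Z s ω)).real A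
  /-- `E_(x,y)(ξ)` does not depend on `y`, for bounded `ℱ^X ∨ 𝒢^Y`-measurable `ξ`. This one
  condition expresses both that the signal is a (Feller-)Markov process in its own right and that
  the observations have conditionally independent increments given the signal. -/
  cond_indep_increments : ∀ ξ : Path S p → ℝ,
    Measurable[signalSigmaTop S p ⊔ incrSigmaTop S p] ξ → (∃ C, ∀ ω, |ξ ω| ≤ C) →
    ∀ (x : S) (y y' : Obs p), ∫ ω, ξ ω ∂(law (x, y)) = ∫ ω, ξ ω ∂(law (x, y'))

namespace Model

variable {S : Type*} [TopologicalSpace S] [MeasurableSpace S] {p : ℕ} (M : Model S p)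

/-- `P_ρ = ∫ P_(x,y) ρ(dx, dy)`, for an initial law `ρ` on `S × ℝᵖ`. -/
noncomputable def lawFrom (ρ : Measure (S × Obs p)) : Measure (Path S p) := ρ.bind M.law

/-- `P^μ = P_{μ × δ₀}`: the law under which `X_0 ∼ μ` and `Y_0 = 0`. -/
noncomputable def P (μ : Measure S) : Measure (Path S p) :=
  M.lawFrom (μ.prod (Measure.dirac 0))

/-- `μ₁ ∽ μ₂`: the laws `P^μ₁` and `P^μ₂` agree on `ℱ^Y`. -/
def ObsEquiv (μ₁ μ₂ : Measure S) : Prop :=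
  ∀ A, MeasurableSet[obsSigmaTop S p] A → M.P μ₁ A = M.P μ₂ A

/-- The space `𝒪` of observable functions. -/
def observableFunctions : Set (S →ᵇ ℝ) :=
  {f | ∀ μ₁ μ₂ : Measure S, IsProbabilityMeasure μ₁ → IsProbabilityMeasure μ₂ →
    M.ObsEquiv μ₁ μ₂ → ∫ x, f x ∂μ₁ = ∫ x, f x ∂μ₂}

/-- The completion of a σ-algebra `m` on path space with respect to the family of all laws `P_ρ`:
`A` belongs to it iff for every initial law `ρ` there is `B ∈ m` such that `A` and `B` differ by a
`P_ρ`-null set. -/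
@[reducible] noncomputable def complete (m : MeasurableSpace (Path S p)) : MeasurableSpace (Path S p) :=
  ⨅ ρ : ProbabilityMeasure (S × Obs p),
    eventuallyMeasurableSpace m (ae (M.lawFrom (ρ : Measure (S × Obs p))))

/-- The completed σ-algebra `ℱ` of the path space. -/
@[reducible] noncomputable def fullSigma : MeasurableSpace (Path S p) := M.complete inferInstance

lemma fullSigma_le_caratheodory (ρ : ProbabilityMeasure (S × Obs p)) :
    M.fullSigma ≤ (M.lawFrom (ρ : Measure (S × Obs p))).toOuterMeasure.caratheodory := by
  intro A hA
  have hA' : NullMeasurableSet A (M.lawFrom (ρ : Measure (S × Obs p))) :=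
    iInf_le (fun ρ : ProbabilityMeasure (S × Obs p) =>
      eventuallyMeasurableSpace inferInstance (ae (M.lawFrom (ρ : Measure (S × Obs p))))) ρ A hA
  exact fun B => (measure_inter_add_diff₀ B hA').symm

/-- The extension of `P_ρ` to the completed σ-algebra. -/
noncomputable def lawBar (ρ : ProbabilityMeasure (S × Obs p)) : @Measure (Path S p) M.fullSigma :=
  @OuterMeasure.toMeasure _ M.fullSigma (M.lawFrom (ρ : Measure (S × Obs p))).toOuterMeasure
    (M.fullSigma_le_caratheodory ρ)

lemma complete_mono {m m' : MeasurableSpace (Path S p)} (h : m ≤ m') :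
    M.complete m ≤ M.complete m' := by
  refine iInf_mono fun ρ => ?_
  rintro A ⟨B, hB, hAB⟩
  exact ⟨B, h _ hB, hAB⟩

/-- The usual augmentation (completed and right-continuous) of the observation filtration
`ℱ_t^Y`, with respect to the family of all laws `P_ρ`. -/
noncomputable def obsFiltration : @Filtration (Path S p) ℝ≥0 _ M.fullSigma :=
  @Filtration.mk _ _ _ M.fullSigma (fun t => ⨅ s > t, M.complete (obsSigma S p s))
    (fun _ t h => le_iInf₂ fun r (hr : t < r) => iInf₂_le r (lt_of_le_of_lt h hr))
    (fun t => (iInf₂_le (t + 1) (lt_add_of_pos_right t one_pos)).trans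
      (M.complete_mono (obsSigma_le _)))

/-- The initial law `μ × δ₀` as a probability measure. -/
noncomputable def initLaw (p : ℕ) (μ : Measure S) [IsProbabilityMeasure μ] :
    ProbabilityMeasure (S × Obs p) :=
  ⟨μ.prod (Measure.dirac 0), inferInstance⟩

/-- The process `π` is a càdlàg version of the filter `t ↦ E^μ(f(X_t) | ℱ_t^Y)`. -/
def IsFilter (μ : Measure S) [IsProbabilityMeasure μ] (f : S → ℝ) (π : ℝ≥0 → Path S p → ℝ) :
    Prop :=
  (∀ᵐ ω ∂(M.P μ), IsCadlag fun t => π t ω) ∧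
  ∀ t, π t =ᵐ[M.P μ] condExp (m₀ := M.fullSigma) (M.obsFiltration t)
    (M.lawBar (initLaw p μ)) (fun ω => f (X t ω))

end Model

end HiddenMarkov

/-! The filters of an observable function merge because, up to uniform approximation, filtering it
amounts to predicting future observation increments, and such predictions under equivalent models
merge in the manner of Blackwell and Dubins.

Call `h` a test function if `h x` is the expectation, started at `x`, of a product `∏ v_t(Y_t -
Y_0)` with nonnegative `v_t` vanishing at infinity. The Feller property makes such expectations
continuous in `x`. By Hahn-Banach and Riesz, a function outside the closed span of test functions
would be separated from it by a difference of two finite measures of equal mass. After normalization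
these give the same observation law, so the function would not be observable
(`mem_closure_span_of_mem_observableFunctions`).

By the Markov property, filtering `h(X_t)` is the same as predicting `∏ v_r(Y_{t+r} - Y_t)` from the
observations up to `t` (`condExp_comp_X_ae_eq`). If `P ≤ c • Q` with density `Λ` on the σ-algebra
generated by the filtration, Bayes' formula writes the difference of the two predictions as a
conditional covariance with `Λ`, divided by `Q[Λ | G t]`. It is controlled by the conditional
variance of `Λ`, which tends to zero by Lévy's theorem (`ae_tendsto_condExp_sub_condExp`). For `μ ≪
ν`, both laws are compared with their midpoint, which dominates each up to the factor 2.

Càdlàg versions are built by hand. A time average of `f(X_t)` is Lipschitz in time, so adding a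
linear drift makes it increasing, and its optional projection becomes a submartingale that Doob's
upcrossing inequality regularizes. The averaging error is uniformly small because the signal
semigroup is uniformly continuous at zero (`exists_cadlag_condExp_of_small_increments`). Hence
merging along a countable dense set of times extends to all times. -/

namespace HiddenMarkov

/-! ### Upcrossings along a set of times. -/

section Upcrossings

/-- `Upcross x F a b m r t`: between the times `r` and `t`, the path `x` makes at least `m`
upcrossings of `[a, b]` along the set of times `F`. -/
def Upcross (x : ℝ≥0 → ℝ) (F : Set ℝ≥0) (a b : ℝ) : ℕ → ℝ≥0 → ℝ≥0 → Prop
  | 0, r, t => r ≤ t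
  | m + 1, r, t => ∃ s ∈ F, ∃ s' ∈ F, s < s' ∧ s' ≤ t ∧ x s ≤ a ∧ b ≤ x s' ∧
      Upcross x F a b m r s

variable {x : ℝ≥0 → ℝ} {F F' : Set ℝ≥0} {a b : ℝ} {m : ℕ} {r r' s s' t t' : ℝ≥0}

lemma Upcross.mono_right (h : Upcross x F a b m r t) (htt : t ≤ t') : Upcross x F a b m r t' := by
  cases m with
  | zero => exact le_trans h htt
  | succ m =>
    obtain ⟨s, hs, s', hs', h1, h2, h3⟩ := h
    exact ⟨s, hs, s', hs', h1, h2.trans htt, h3⟩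

lemma Upcross.mono_set (h : Upcross x F a b m r t) (hF : F ⊆ F') : Upcross x F' a b m r t := by
  induction m generalizing t with
  | zero => exact h
  | succ m ih =>
    obtain ⟨s, hs, s', hs', h1, h2, h3, h4, h5⟩ := h
    exact ⟨s, hF hs, s', hF hs', h1, h2, h3, h4, ih h5⟩

/-- The recursion in `Upcross` peels off the last upcrossing. Right limits approach a time from
above and meet upcrossings in reverse order, so they need to add one at the front. -/
lemma Upcross.prepend (h : Upcross x F a b m r' t) (hs : s ∈ F) (hs' : s' ∈ F) (hrs : r ≤ s)
    (hss : s < s') (hr : s' ≤ r') (ha : x s ≤ a) (hb : b ≤ x s') :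
    Upcross x F a b (m + 1) r t := by
  induction m generalizing t with
  | zero => exact ⟨s, hs, s', hs', hss, hr.trans h, ha, hb, hrs⟩
  | succ m ih =>
    obtain ⟨u, hu, u', hu', h1, h2, h3, h4, h5⟩ := h
    exact ⟨u, hu, u', hu', h1, h2, h3, h4, ih h5⟩

lemma Upcross.exists_of_iUnion {F : ℕ → Set ℝ≥0} (hF : Monotone F)
    (h : Upcross x (⋃ n, F n) a b m r t) : ∃ n, Upcross x (F n) a b m r t := by
  induction m generalizing t with
  | zero => exact ⟨0, h⟩
  | succ m ih =>
    obtain ⟨s, hs, s', hs', h1, h2, h3, h4, h5⟩ := h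
    obtain ⟨n, hn⟩ := ih h5
    obtain ⟨i, hi⟩ := Set.mem_iUnion.1 hs
    obtain ⟨j, hj⟩ := Set.mem_iUnion.1 hs'
    refine ⟨max n (max i j), s, hF ?_ hi, s', hF ?_ hj, h1, h2, h3, h4, hn.mono_set (hF ?_)⟩ <;>
      simp

/-- The greedy crossing times are the earliest possible, so any family of upcrossings completed by
`g i` forces the greedy one to be completed by index `i`. -/
lemma Upcross.upperCrossingTime_le {Ω : Type*} {f : ℕ → Ω → ℝ} {ω : Ω} {g : ℕ → ℝ≥0} {N : ℕ}
    (hg : Monotone g) (hFg : F ⊆ g '' Set.Iio N) (hf : ∀ k, f k ω = x (g k)) {i : ℕ} (hi : i < N)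
    (h : Upcross x F a b m r t) (hti : t ≤ g i) : upperCrossingTime a b f N m ω ≤ i := by
  induction m generalizing t i with
  | zero => simp
  | succ m ih =>
    obtain ⟨s, hs, s', hs', h1, h2, h3, h4, h5⟩ := h
    obtain ⟨k, hk, rfl⟩ := hFg hs
    obtain ⟨l, hl, rfl⟩ := hFg hs'
    simp only [Set.mem_Iio] at hk hl
    have h6 := ih hk h5 le_rfl
    have h7 : lowerCrossingTime a b f N m ω ≤ k :=
      hittingBtwn_le_of_mem h6 hk.le (by simpa [hf] using h3)
    rw [upperCrossingTime_succ_eq]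
    -- `g` need not be injective: `l` may exceed `i` although `g l ≤ g i`. Then the two times
    -- coincide and `i` serves in place of `l`.
    rcases le_or_gt l i with hli | hli
    · refine (hittingBtwn_le_of_mem (h7.trans (hg.reflect_lt h1).le) hl.le ?_).trans hli
      simpa [hf] using h4
    · have h8 : g i = g l := le_antisymm (hg hli.le) (h2.trans hti)
      rw [← h8] at h1 h4
      exact hittingBtwn_le_of_mem (h7.trans (hg.reflect_lt h1).le) hi.le (by simpa [hf] using h4)

lemma exists_monotone_range_eq (F : Finset ℝ≥0) (hF : F.Nonempty) :
    ∃ g : ℕ → ℝ≥0, Monotone g ∧ (∀ k, g k ∈ F) ∧ (F : Set ℝ≥0) ⊆ g '' Set.Iio F.card := by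
  have hc : 0 < F.card := hF.card_pos
  refine ⟨fun k => F.orderEmbOfFin rfl ⟨min k (F.card - 1), by omega⟩, fun i j hij => ?_,
    fun k => F.orderEmbOfFin_mem rfl _, fun y hy => ?_⟩
  · refine (F.orderEmbOfFin rfl).monotone ?_
    simp only [Fin.mk_le_mk]
    omega
  · have : y ∈ Set.range (F.orderEmbOfFin rfl) := by rw [Finset.range_orderEmbOfFin]; exact hy
    obtain ⟨⟨k, hk⟩, rfl⟩ := this
    refine ⟨k, hk, ?_⟩
    have : min k (F.card - 1) = k := by omega
    simp only [this]

end Upcrossings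

/-! ### Doob's upcrossing inequality in continuous time. -/

section Submartingale

variable {Ω : Type*} {m0 : MeasurableSpace Ω} {P : Measure Ω}
  {G : Filtration ℝ≥0 m0} {N : ℝ≥0 → Ω → ℝ}

/-- The filtration sampled along a monotone sequence of times. -/
def sampledFiltration (G : Filtration ℝ≥0 m0) (g : ℕ → ℝ≥0) (hg : Monotone g) :
    Filtration ℕ m0 where
  seq n := G (g n)
  mono' _ _ h := G.mono (hg h)
  le' n := G.le (g n)

lemma submartingale_sampled (hN : Submartingale N G P) {g : ℕ → ℝ≥0} (hg : Monotone g) :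
    Submartingale (fun n => N (g n)) (sampledFiltration G g hg) P :=
  ⟨fun n => hN.1 (g n), fun _ _ h => hN.2.1 _ _ (hg h), fun n => hN.2.2 (g n)⟩

/-- Doob's inequality followed by Markov's. The bound does not depend on `F`, so it survives the
passage to countable sets of times. -/
lemma measure_upcross_finset_le [IsProbabilityMeasure P] (hN : Submartingale N G P) {F : Finset ℝ≥0} {C a b : ℝ}
    (hab : a < b) (hC : ∀ t ∈ F, ∀ᵐ ω ∂P, |N t ω| ≤ C) (m : ℕ) :
    P {ω | ∃ r t, Upcross (fun s => N s ω) F a b (m + 1) r t} ≤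
      ENNReal.ofReal ((C + |a|) / (b - a) / (m + 1)) := by
  rcases F.eq_empty_or_nonempty with rfl | hF
  · have : {ω | ∃ r t, Upcross (fun s => N s ω) (∅ : Finset ℝ≥0) a b (m + 1) r t} = ∅ := by
      ext ω; simp [Upcross]
    rw [this]; simp
  obtain ⟨g, hg, hgF, hFg⟩ := exists_monotone_range_eq F hF
  have hsub := submartingale_sampled hN hg
  set K := F.card
  have hsubset : {ω | ∃ r t, Upcross (fun s => N s ω) F a b (m + 1) r t} ⊆
      {ω | ((m : ℝ) + 1) ≤ (upcrossingsBefore a b (fun n => N (g n)) K ω : ℝ)} := by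
    rintro ω ⟨r, t, s, hs, s', hs', h1, -, h3, h4, h5⟩
    obtain ⟨i, hi, rfl⟩ := hFg hs'
    have h6 : upperCrossingTime a b (fun n => N (g n)) K (m + 1) ω ≤ i :=
      Upcross.upperCrossingTime_le (x := fun s => N s ω) hg hFg (fun _ => rfl) hi
        (⟨s, hs, g i, hs', h1, le_rfl, h3, h4, h5⟩ : Upcross _ _ a b (m + 1) r (g i)) le_rfl
    have h7 : m + 1 ≤ upcrossingsBefore a b (fun n => N (g n)) K ω :=
      le_csSup (upperCrossingTime_lt_bddAbove hab) (lt_of_le_of_lt h6 hi)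
    simp only [Set.mem_ofPred_eq]
    exact_mod_cast h7
  refine (measure_mono hsubset).trans ?_
  have hint : Integrable (fun ω => (upcrossingsBefore a b (fun n => N (g n)) K ω : ℝ)) P :=
    hsub.1.integrable_upcrossingsBefore hab
  have hmarkov := mul_meas_ge_le_integral_of_nonneg
    (ae_of_all P fun ω => Nat.cast_nonneg (upcrossingsBefore a b (fun n => N (g n)) K ω)) hint
    ((m : ℝ) + 1)
  have hdoob := hsub.mul_integral_upcrossingsBefore_le_integral_pos_part a b K
  have hle : P[fun ω => (N (g K) ω - a)⁺] ≤ C + |a| := by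
    have h1 : ∀ᵐ ω ∂P, (N (g K) ω - a)⁺ ≤ C + |a| := by
      filter_upwards [hC _ (hgF K)] with ω hω
      rw [posPart_def]
      refine sup_le ?_ ?_
      · have := le_abs_self (N (g K) ω)
        have := neg_abs_le a
        linarith
      · have := abs_nonneg (N (g K) ω)
        have := abs_nonneg a
        linarith
    calc P[fun ω => (N (g K) ω - a)⁺] ≤ ∫ _, (C + |a|) ∂P :=
          integral_mono_of_nonneg (ae_of_all _ fun _ => posPart_nonneg _)
            (integrable_const _) h1
      _ = C + |a| := by simp
  have hba : 0 < b - a := sub_pos.2 hab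
  rw [← ENNReal.ofReal_toReal (measure_ne_top P _)]
  refine ENNReal.ofReal_le_ofReal ?_
  rw [le_div_iff₀ (by positivity), le_div_iff₀ hba]
  simp only [measureReal_def] at hmarkov
  nlinarith

/-- Exhaust `D` by finite sets: a given upcrossing family uses finitely many times, so the finite
bound passes to `D`, and it vanishes as `m` grows. -/
lemma ae_not_upcross [IsProbabilityMeasure P] (hN : Submartingale N G P) {D : Set ℝ≥0} (hD : D.Countable) {C : ℝ}
    (hC : ∀ t ∈ D, ∀ᵐ ω ∂P, |N t ω| ≤ C) :
    ∀ᵐ ω ∂P, ∀ a b : ℚ, a < b → ∃ m, ∀ r t, ¬ Upcross (fun s => N s ω) D a b m r t := by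
  rw [ae_all_iff]; intro a
  rw [ae_all_iff]; intro b
  by_cases hab : a < b
  swap; · exact ae_of_all _ fun ω h => absurd h hab
  have hab' : (a : ℝ) < b := by exact_mod_cast hab
  obtain ⟨F, hFm, hFD⟩ : ∃ F : ℕ → Finset ℝ≥0, Monotone F ∧ (⋃ n, (F n : Set ℝ≥0)) = D := by
    classical
    rcases D.eq_empty_or_nonempty with rfl | hne
    · exact ⟨fun _ => ∅, monotone_const, by simp⟩
    obtain ⟨e, rfl⟩ := hD.exists_eq_range hne
    refine ⟨fun n => (Finset.range n).image e, fun i j hij => Finset.image_mono e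
      (Finset.range_mono hij), ?_⟩
    ext y
    simp only [Set.mem_iUnion, Finset.mem_coe, Finset.mem_image, Finset.mem_range, Set.mem_range]
    exact ⟨fun ⟨_, k, _, h⟩ => ⟨k, h⟩, fun ⟨k, h⟩ => ⟨k + 1, k, by omega, h⟩⟩
  have hFm' : Monotone fun n => (F n : Set ℝ≥0) := fun i j hij => by
    simpa using hFm hij
  have hbound : ∀ m : ℕ, P {ω | ∃ r t, Upcross (fun s => N s ω) D a b (m + 1) r t} ≤
      ENNReal.ofReal ((C + |(a : ℝ)|) / (b - a) / (m + 1)) := by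
    intro m
    have hsub : {ω | ∃ r t, Upcross (fun s => N s ω) D a b (m + 1) r t} ⊆
        ⋃ n, {ω | ∃ r t, Upcross (fun s => N s ω) (F n) a b (m + 1) r t} := by
      rintro ω ⟨r, t, h⟩
      rw [← hFD] at h
      obtain ⟨n, hn⟩ := h.exists_of_iUnion hFm'
      exact Set.mem_iUnion.2 ⟨n, r, t, hn⟩
    refine (measure_mono hsub).trans ?_
    have hmono : Monotone fun n =>
        {ω | ∃ r t, Upcross (fun s => N s ω) (F n) (a : ℝ) b (m + 1) r t} :=
      fun i j hij ω ⟨r, t, h⟩ => ⟨r, t, h.mono_set (hFm' hij)⟩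
    rw [hmono.measure_iUnion]
    refine iSup_le fun n => measure_upcross_finset_le hN hab' (fun t ht => hC t ?_) m
    rw [← hFD]
    exact Set.mem_iUnion.2 ⟨n, ht⟩
  have hlim : Tendsto (fun m : ℕ => ENNReal.ofReal ((C + |(a : ℝ)|) / (b - a) / (m + 1))) atTop
      (𝓝 0) := by
    rw [← ENNReal.ofReal_zero]
    refine ENNReal.tendsto_ofReal ?_
    have := (tendsto_one_div_add_atTop_nhds_zero_nat (𝕜 := ℝ)).const_mul
      ((C + |(a : ℝ)|) / (b - a))
    simpa [div_eq_mul_inv] using this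
  have hzero : P {ω | ∀ m, ∃ r t, Upcross (fun s => N s ω) D a b (m + 1) r t} = 0 := by
    refine le_antisymm (ge_of_tendsto' hlim fun m => ?_) zero_le
    exact (measure_mono fun ω (h : ω ∈ {ω | ∀ m, ∃ r t, Upcross (fun s => N s ω) D a b (m + 1) r t}) =>
      Set.mem_ofPred.1 h m).trans (hbound m)
  have : ∀ᵐ ω ∂P, ¬ ∀ m, ∃ r t, Upcross (fun s => N s ω) D a b (m + 1) r t := by
    rw [ae_iff]; simpa using hzero
  filter_upwards [this] with ω hω _
  push Not at hω
  obtain ⟨m, hm⟩ := hω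
  exact ⟨m + 1, hm⟩

end Submartingale

/-! ### Limits of paths with finitely many upcrossings. -/

section Limits

variable {x : ℝ≥0 → ℝ} {D : Set ℝ≥0} {l : Filter ℝ≥0} {C : ℝ}

/-- The condition `hl` says that the filter moves strictly to the right. It covers left limits and
limits at infinity at once; the decreasing counterpart handles right limits. -/
lemma upcross_of_frequently_increasing {a b : ℝ} (hD : ∀ᶠ r in l, r ∈ D)
    (hl : ∀ᶠ r in l, ∀ᶠ r' in l, r < r') (ha : ∃ᶠ r in l, x r < a) (hb : ∃ᶠ r in l, b < x r)
    (m : ℕ) : ∃ r t, Upcross x D a b m r t ∧ ∀ᶠ r' in l, t < r' := by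
  induction m with
  | zero =>
    obtain ⟨r, -, hr⟩ := (ha.and_eventually hl).exists
    exact ⟨r, r, le_refl r, hr⟩
  | succ m ih =>
    obtain ⟨r, t, h, ht⟩ := ih
    obtain ⟨s, hs, hsD, hts, hsl⟩ := (ha.and_eventually (hD.and (ht.and hl))).exists
    obtain ⟨s', hs', hsD', hts', hsl'⟩ := (hb.and_eventually (hD.and (hsl.and hl))).exists
    exact ⟨r, s', ⟨s, hsD, s', hsD', hts', le_rfl, hs.le, hs'.le, h.mono_right hts.le⟩, hsl'⟩

lemma upcross_of_frequently_decreasing {a b : ℝ} (hD : ∀ᶠ r in l, r ∈ D)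
    (hl : ∀ᶠ r in l, ∀ᶠ r' in l, r' < r) (ha : ∃ᶠ r in l, x r < a) (hb : ∃ᶠ r in l, b < x r)
    (m : ℕ) : ∃ r t, Upcross x D a b m r t ∧ ∀ᶠ r' in l, r' < r := by
  induction m with
  | zero =>
    obtain ⟨r, -, hr⟩ := (ha.and_eventually hl).exists
    exact ⟨r, r, le_refl r, hr⟩
  | succ m ih =>
    obtain ⟨r, t, h, ht⟩ := ih
    obtain ⟨s', hs', hsD', hts', hsl'⟩ := (hb.and_eventually (hD.and (ht.and hl))).exists
    obtain ⟨s, hs, hsD, hts, hsl⟩ := (ha.and_eventually (hD.and (hsl'.and hl))).exists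
    exact ⟨s, t, h.prepend hsD hsD' le_rfl hts hts'.le hs.le hs'.le, hsl⟩

lemma exists_tendsto_of_not_upcross (hD : ∀ᶠ r in l, r ∈ D)
    (hl : (∀ᶠ r in l, ∀ᶠ r' in l, r < r') ∨ (∀ᶠ r in l, ∀ᶠ r' in l, r' < r))
    (hC : ∀ᶠ r in l, |x r| ≤ C)
    (hU : ∀ a b : ℚ, a < b → ∃ m, ∀ r t, ¬ Upcross x D a b m r t) :
    ∃ c, Tendsto x l (𝓝 c) := by
  refine tendsto_of_no_upcrossings (s := Set.range ((↑) : ℚ → ℝ)) Rat.denseRange_cast ?_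
    ⟨C, eventually_map.2 (hC.mono fun r h => (abs_le.1 h).2)⟩
    ⟨-C, eventually_map.2 (hC.mono fun r h => (abs_le.1 h).1)⟩
  rintro _ ⟨a, rfl⟩ _ ⟨b, rfl⟩ hab ⟨ha, hb⟩
  obtain ⟨m, hm⟩ := hU a b (by exact_mod_cast hab)
  rcases hl with hl | hl
  · obtain ⟨r, t, h, -⟩ := upcross_of_frequently_increasing hD hl ha hb m
    exact hm r t h
  · obtain ⟨r, t, h, -⟩ := upcross_of_frequently_decreasing hD hl ha hb m
    exact hm r t h

lemma eventually_nhdsWithin_Ioi_lt (D : Set ℝ≥0) (t : ℝ≥0) :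
    ∀ᶠ r in 𝓝[D ∩ Set.Ioi t] t, ∀ᶠ r' in 𝓝[D ∩ Set.Ioi t] t, r' < r := by
  filter_upwards [self_mem_nhdsWithin] with r hr
  exact nhdsWithin_le_nhds (Iio_mem_nhds hr.2)

lemma eventually_nhdsWithin_Iio_lt (D : Set ℝ≥0) (t : ℝ≥0) :
    ∀ᶠ r in 𝓝[D ∩ Set.Iio t] t, ∀ᶠ r' in 𝓝[D ∩ Set.Iio t] t, r < r' := by
  filter_upwards [self_mem_nhdsWithin] with r hr
  exact nhdsWithin_le_nhds (Ioi_mem_nhds hr.2)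

lemma nhdsWithin_dense_Ioi_neBot (hD : Dense D) (t : ℝ≥0) : (𝓝[D ∩ Set.Ioi t] t).NeBot := by
  rw [Set.inter_comm, ← mem_closure_iff_nhdsWithin_neBot]
  refine closure_minimal (hD.open_subset_closure_inter isOpen_Ioi) isClosed_closure ?_
  rw [closure_Ioi]
  exact Set.self_mem_Ici

/-- The right limits along a dense set of times of a function with left and right limits along that
set form a càdlàg function. -/
lemma isCadlag_of_tendsto (hD : Dense D) {y : ℝ≥0 → ℝ}
    (hr : ∀ t, Tendsto x (𝓝[D ∩ Set.Ioi t] t) (𝓝 (y t)))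
    (hl : ∀ t, ∃ c, Tendsto x (𝓝[D ∩ Set.Iio t] t) (𝓝 c)) : IsCadlag y := by
  -- Closed constraints satisfied by `x` on `U ∩ D` are inherited by the right limits on `U`. Closed
  -- neighbourhoods then give both one-sided properties of `y`.
  have key : ∀ (U : Set ℝ≥0), IsOpen U → ∀ V : Set ℝ, IsClosed V → (∀ r ∈ U, r ∈ D → x r ∈ V) →
      ∀ s ∈ U, y s ∈ V := by
    intro U hU V hV h s hs
    have := nhdsWithin_dense_Ioi_neBot hD s
    refine hV.mem_of_tendsto (hr s) ?_
    filter_upwards [self_mem_nhdsWithin, nhdsWithin_le_nhds (hU.mem_nhds hs)] with r h1 h2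
    exact h r h2 h1.1
  intro t
  constructor
  · rw [← continuousWithinAt_Ioi_iff_Ici]
    refine (closed_nhds_basis (y t)).tendsto_right_iff.2 ?_
    rintro V ⟨hV, hVc⟩
    obtain ⟨U, hU, htU, hUV⟩ := mem_nhdsWithin.1 (hr t hV)
    filter_upwards [self_mem_nhdsWithin, nhdsWithin_le_nhds (hU.mem_nhds htU)] with s hs hsU
    exact key (U ∩ Set.Ioi t) (hU.inter isOpen_Ioi) V hVc
      (fun r hr hrD => hUV ⟨hr.1, hrD, hr.2⟩) s ⟨hsU, hs⟩
  · obtain ⟨c, hc⟩ := hl t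
    refine ⟨c, (closed_nhds_basis c).tendsto_right_iff.2 ?_⟩
    rintro V ⟨hV, hVc⟩
    obtain ⟨U, hU, htU, hUV⟩ := mem_nhdsWithin.1 (hc hV)
    filter_upwards [self_mem_nhdsWithin, nhdsWithin_le_nhds (hU.mem_nhds htU)] with s hs hsU
    exact key (U ∩ Set.Iio t) (hU.inter isOpen_Iio) V hVc
      (fun r hr hrD => hUV ⟨hr.1, hrD, hr.2⟩) s ⟨hsU, hs⟩

end Limits

/-! ### Regularization of conditional expectations of increasing processes. -/

section Regularization

variable {Ω : Type*} {m0 : MeasurableSpace Ω} {P : Measure Ω}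
  {G : Filtration ℝ≥0 m0} {B : ℝ≥0 → Ω → ℝ}

lemma integrable_of_forall_abs_le [IsProbabilityMeasure P] {ξ : Ω → ℝ} (hξ : Measurable ξ) {C : ℝ} (hC : ∀ ω, |ξ ω| ≤ C) :
    Integrable ξ P :=
  Integrable.of_bound hξ.aestronglyMeasurable C (ae_of_all _ hC)

lemma ae_abs_condExp_le {m : MeasurableSpace Ω} {ξ : Ω → ℝ} {C : ℝ}
    (hC : ∀ᵐ ω ∂P, |ξ ω| ≤ C) : ∀ᵐ ω ∂P, |P[ξ | m] ω| ≤ C :=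
  ae_bdd_abs_condExp_of_ae_bdd_abs hC

/-- Monotonicity in time and the tower property; `B` itself need not be adapted. -/
lemma submartingale_condExp_of_monotone [IsProbabilityMeasure P] (hBm : ∀ t, Measurable (B t)) {C : ℝ≥0 → ℝ}
    (hBC : ∀ t ω, |B t ω| ≤ C t) (hmono : ∀ ω, Monotone fun t => B t ω) :
    Submartingale (fun t => P[B t | G t]) G P := by
  refine ⟨fun t => stronglyMeasurable_condExp, fun s t hst => ?_, fun t => integrable_condExp⟩
  have h1 : P[B s | G s] ≤ᵐ[P] P[B t | G s] :=
    condExp_mono (integrable_of_forall_abs_le (hBm s) (hBC s))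
      (integrable_of_forall_abs_le (hBm t) (hBC t)) (ae_of_all _ fun ω => hmono ω hst)
  exact h1.trans (condExp_condExp_of_le (G.mono hst) (G.le t)).symm.le

lemma exists_seq_tendsto_nhdsWithin_Ioi {D : Set ℝ≥0} (hD : Dense D) (t : ℝ≥0) :
    ∃ q : ℕ → ℝ≥0, (∀ n, q n ∈ D ∧ t < q n) ∧ Antitone q ∧ Tendsto q atTop (𝓝[D ∩ Set.Ioi t] t) := by
  obtain ⟨u, hu, hut, hlim⟩ := hD.exists_seq_strictAnti_tendsto t
  exact ⟨u, fun n => ⟨(hut n).2, (hut n).1⟩, hu.antitone, tendsto_nhdsWithin_iff.2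
    ⟨hlim, .of_forall fun n => ⟨(hut n).2, (hut n).1⟩⟩⟩

/-- The optional projection of a bounded right-continuous increasing process has a càdlàg version,
given by its right limits along a countable dense set of times. -/
theorem exists_cadlag_condExp_of_monotone [IsProbabilityMeasure P]
    (hG : ∀ t, ⨅ s > t, (G s : MeasurableSpace Ω) ≤ G t) (hBm : ∀ t, Measurable (B t))
    {C : ℝ≥0 → ℝ} (hCm : Monotone C) (hBC : ∀ t ω, |B t ω| ≤ C t)
    (hmono : ∀ ω, Monotone fun t => B t ω)
    (hright : ∀ ω t, ContinuousWithinAt (fun t => B t ω) (Set.Ioi t) t) :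
    ∃ π : ℝ≥0 → Ω → ℝ, (∀ᵐ ω ∂P, IsCadlag fun t => π t ω) ∧ ∀ t, π t =ᵐ[P] P[B t | G t] := by
  obtain ⟨D, hDc, hD⟩ := TopologicalSpace.exists_countable_dense ℝ≥0
  set N : ℝ≥0 → Ω → ℝ := fun t => P[B t | G t] with hN
  have hsub : Submartingale N G P := submartingale_condExp_of_monotone hBm hBC hmono
  have hbd : ∀ t, ∀ᵐ ω ∂P, |N t ω| ≤ C t := fun t => ae_abs_condExp_le (ae_of_all _ (hBC t))
  have hbd' : ∀ᵐ ω ∂P, ∀ t ∈ D, |N t ω| ≤ C t := (ae_ball_iff hDc).2 fun t _ => hbd t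
  -- The bound `C` may grow with time, so upcrossings are controlled only below each integer horizon
  -- `T`.
  have hup : ∀ᵐ ω ∂P, ∀ T : ℕ, ∀ a b : ℚ, a < b → ∃ m, ∀ r t,
      ¬ Upcross (fun s => N s ω) (D ∩ Set.Iio (T : ℝ≥0)) a b m r t := by
    rw [ae_all_iff]
    refine fun T => ae_not_upcross hsub (hDc.mono Set.inter_subset_left) (C := C T) fun t ht => ?_
    filter_upwards [hbd t] with ω hω
    exact hω.trans (hCm ht.2.le)
  have hlim : ∀ᵐ ω ∂P, ∀ t, (∃ c, Tendsto (fun s => N s ω) (𝓝[D ∩ Set.Ioi t] t) (𝓝 c)) ∧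
      ∃ c, Tendsto (fun s => N s ω) (𝓝[D ∩ Set.Iio t] t) (𝓝 c) := by
    filter_upwards [hbd', hup] with ω h1 h2 t
    obtain ⟨T, hT⟩ := exists_nat_gt t
    have hlt : ∀ s : Set ℝ≥0, ∀ᶠ r in 𝓝[s] t, r < (T : ℝ≥0) := fun s =>
      nhdsWithin_le_nhds (Iio_mem_nhds hT)
    constructor
    · refine exists_tendsto_of_not_upcross (C := C T) ?_
        (Or.inr (eventually_nhdsWithin_Ioi_lt D t)) ?_ (h2 T)
      · filter_upwards [hlt _, self_mem_nhdsWithin] with r hr hr'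
        exact ⟨hr'.1, hr⟩
      · filter_upwards [hlt _, self_mem_nhdsWithin] with r hr hr'
        exact (h1 r hr'.1).trans (hCm hr.le)
    · refine exists_tendsto_of_not_upcross (C := C T) ?_
        (Or.inl (eventually_nhdsWithin_Iio_lt D t)) ?_ (h2 T)
      · filter_upwards [hlt _, self_mem_nhdsWithin] with r hr hr'
        exact ⟨hr'.1, hr⟩
      · filter_upwards [hlt _, self_mem_nhdsWithin] with r hr hr'
        exact (h1 r hr'.1).trans (hCm hr.le)
  refine ⟨fun t ω => limUnder (𝓝[D ∩ Set.Ioi t] t) fun s => N s ω, ?_, fun t => ?_⟩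
  · filter_upwards [hlim] with ω hω
    exact isCadlag_of_tendsto hD (fun t => tendsto_nhds_limUnder (hω t).1) fun t => (hω t).2
  set L : Ω → ℝ := fun ω => limUnder (𝓝[D ∩ Set.Ioi t] t) fun s => N s ω with hL
  obtain ⟨q, hq, hqa, hqt⟩ := exists_seq_tendsto_nhdsWithin_Ioi hD t
  have hqt' : Tendsto q atTop (𝓝[>] t) :=
    hqt.mono_right (nhdsWithin_mono _ Set.inter_subset_right)
  have hNL : ∀ᵐ ω ∂P, Tendsto (fun n => N (q n) ω) atTop (𝓝 (L ω)) := by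
    filter_upwards [hlim] with ω hω
    exact (tendsto_nhds_limUnder (hω t).1).comp hqt
  set L' : Ω → ℝ := fun ω => limsup (fun n => N (q n) ω) atTop with hL'
  have hLL' : L =ᵐ[P] L' := by
    filter_upwards [hNL] with ω hω
    exact hω.limsup_eq.symm
  have hL'm : Measurable[G t] L' := by
    -- The limsup ignores its first `k` terms, so it is measurable for every `G (q k)`; right
    -- continuity of `G` then gives measurability at time `t`.
    have h1 : ∀ k, Measurable[G (q k)] L' := by
      intro k
      have h2 : L' = fun ω => limsup (fun n => N (q (n + k)) ω) atTop := by
        ext ω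
        exact (limsup_nat_add (fun n => N (q n) ω) k).symm
      rw [h2]
      refine Measurable.limsup (mδ := G (q k)) fun n => ?_
      exact (stronglyMeasurable_condExp.measurable).mono (G.mono (hqa (Nat.le_add_left k n))) le_rfl
    intro A hA
    refine hG t _ ?_
    simp only [MeasurableSpace.measurableSet_iInf]
    intro s hs
    obtain ⟨k, hk⟩ := ((tendsto_nhds_of_tendsto_nhdsWithin hqt').eventually
      (Iio_mem_nhds hs)).exists
    exact G.mono (le_of_lt hk) _ (h1 k hA)
  have hqC : ∀ n, C (q n) ≤ C (q 0) := fun n => hCm (hqa (Nat.zero_le n))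
  -- The identity holds at each `q n`. Dominated convergence passes it to the limit, using right
  -- continuity of `B` on one side and the definition of `L` on the other.
  have hset : ∀ A, MeasurableSet[G t] A → ∫ ω in A, L ω ∂P = ∫ ω in A, B t ω ∂P := by
    intro A hA
    have h1 : Tendsto (fun n => ∫ ω in A, N (q n) ω ∂P) atTop (𝓝 (∫ ω in A, L ω ∂P)) := by
      refine tendsto_integral_of_dominated_convergence (fun _ => C (q 0))
        (fun n => integrable_condExp.aestronglyMeasurable.restrict) (integrable_const _)
        (fun n => ae_restrict_of_ae ?_) (ae_restrict_of_ae hNL)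
      filter_upwards [hbd (q n)] with ω hω
      exact hω.trans (hqC n)
    have h2 : Tendsto (fun n => ∫ ω in A, B (q n) ω ∂P) atTop (𝓝 (∫ ω in A, B t ω ∂P)) := by
      refine tendsto_integral_of_dominated_convergence (fun _ => C (q 0))
        (fun n => (hBm _).aestronglyMeasurable) (integrable_const _)
        (fun n => ae_of_all _ fun ω => (hBC _ ω).trans (hqC n)) (ae_of_all _ fun ω => ?_)
      exact (hright ω t).tendsto.comp hqt'
    refine tendsto_nhds_unique h1 (h2.congr fun n => ?_)
    exact (setIntegral_condExp (G.le _) (integrable_of_forall_abs_le (hBm _) (hBC _))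
      (G.mono (hq n).2.le _ hA)).symm
  have hLint : Integrable L P := by
    refine Integrable.of_bound ((hL'm.mono (G.le t) le_rfl).aestronglyMeasurable.congr hLL'.symm)
      (C (q 0)) ?_
    filter_upwards [hNL, ae_all_iff.2 fun n => hbd (q n)] with ω h1 h2
    exact le_of_tendsto h1.abs (.of_forall fun n => (h2 n).trans (hqC n))
  refine ae_eq_condExp_of_forall_setIntegral_eq (G.le t)
    (integrable_of_forall_abs_le (hBm t) (hBC t)) (fun _ _ _ => hLint.integrableOn)
    (fun A hA _ => hset A hA) ⟨L', hL'm.stronglyMeasurable, hLL'⟩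

end Regularization

/-! ### Uniform limits of càdlàg processes. -/

section CadlagLimits

lemma IsCadlag.abs_sub_le_of_dense {x y : ℝ≥0 → ℝ} (hx : IsCadlag x) (hy : IsCadlag y)
    {D : Set ℝ≥0} (hD : Dense D) {δ : ℝ} (h : ∀ q ∈ D, |x q - y q| ≤ δ) (t : ℝ≥0) :
    |x t - y t| ≤ δ := by
  have := nhdsWithin_dense_Ioi_neBot hD t
  have h1 : Tendsto (fun s => |x s - y s|) (𝓝[D ∩ Set.Ioi t] t) (𝓝 |x t - y t|) :=
    (((hx t).1.sub (hy t).1).abs).tendsto.mono_left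
      (nhdsWithin_mono _ fun s hs => (show t ≤ s from le_of_lt hs.2))
  exact le_of_tendsto h1 (by filter_upwards [self_mem_nhdsWithin] with s hs using h s hs.1)

lemma isCadlag_of_forall_exists_abs_sub_le {y : ℝ≥0 → ℝ}
    (h : ∀ δ > 0, ∃ x : ℝ≥0 → ℝ, IsCadlag x ∧ ∀ t, |x t - y t| ≤ δ) : IsCadlag y := by
  intro t
  constructor
  · refine Metric.tendsto_nhds.2 fun ε hε => ?_
    obtain ⟨x, hx, hxy⟩ := h (ε / 3) (by positivity)
    filter_upwards [Metric.tendsto_nhds.1 (hx t).1 (ε / 3) (by positivity)] with s hs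
    have h1 := abs_le.1 (hxy s)
    have h2 := abs_le.1 (hxy t)
    rw [Real.dist_eq, abs_lt] at hs ⊢
    constructor <;> linarith [hs.1, hs.2, h1.1, h1.2, h2.1, h2.2]
  -- At time zero there is nothing to the left and any limit will do. Otherwise the left limit comes
  -- from completeness.
  · rcases eq_or_neBot (𝓝[<] t) with hbot | hbot
    · exact ⟨0, by rw [hbot]; exact tendsto_bot⟩
    · have hcauchy : Cauchy (map y (𝓝[<] t)) := by
        refine Metric.cauchy_iff.2 ⟨inferInstance, fun ε hε => ?_⟩
        obtain ⟨x, hx, hxy⟩ := h (ε / 4) (by positivity)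
        obtain ⟨l, hl⟩ := (hx t).2
        have h3 := Metric.tendsto_nhds.1 hl (ε / 4) (by positivity)
        refine ⟨_, image_mem_map h3, ?_⟩
        rintro _ ⟨s, hs, rfl⟩ _ ⟨u, hu, rfl⟩
        have hs' : dist (x s) l < ε / 4 := hs
        have hu' : dist (x u) l < ε / 4 := hu
        have h1 := abs_le.1 (hxy s)
        have h2 := abs_le.1 (hxy u)
        rw [Real.dist_eq, abs_lt] at hs' hu' ⊢
        constructor <;> linarith [hs'.1, hs'.2, hu'.1, hu'.2, h1.1, h1.2, h2.1, h2.2]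
      exact cauchy_map_iff_exists_tendsto.1 hcauchy

variable {Ω : Type*} {m0 : MeasurableSpace Ω} {P : Measure Ω}

/-- A process with càdlàg modifications up to arbitrarily small uniform errors has a càdlàg
modification. -/
lemma exists_cadlag_of_forall_approx {W : ℝ≥0 → Ω → ℝ}
    (h : ∀ δ > 0, ∃ π : ℝ≥0 → Ω → ℝ, (∀ᵐ ω ∂P, IsCadlag fun t => π t ω) ∧
      ∀ t, ∀ᵐ ω ∂P, |π t ω - W t ω| ≤ δ) :
    ∃ π : ℝ≥0 → Ω → ℝ, (∀ᵐ ω ∂P, IsCadlag fun t => π t ω) ∧ ∀ t, π t =ᵐ[P] W t := by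
  obtain ⟨D, hDc, hD⟩ := TopologicalSpace.exists_countable_dense ℝ≥0
  have hpos : ∀ n : ℕ, (0 : ℝ) < 1 / (n + 1) := fun n => by positivity
  choose ρ hρ hρW using fun n : ℕ => h (1 / (n + 1)) (hpos n)
  have hlim0 : Tendsto (fun n : ℕ => (1 : ℝ) / (n + 1)) atTop (𝓝 0) :=
    tendsto_one_div_add_atTop_nhds_zero_nat
  -- Comparison through `W` is possible only at the countably many times of `D`. The càdlàg property
  -- extends it to all times outside a single null set.
  have hall : ∀ᵐ ω ∂P, ∀ n m : ℕ, ∀ t,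
      |ρ n t ω - ρ m t ω| ≤ 1 / ((n : ℝ) + 1) + 1 / (m + 1) := by
    have h1 : ∀ᵐ ω ∂P, ∀ n : ℕ, ∀ q ∈ D, |ρ n q ω - W q ω| ≤ 1 / (n + 1) :=
      ae_all_iff.2 fun n => (ae_ball_iff hDc).2 fun q _ => hρW n q
    filter_upwards [h1, ae_all_iff.2 hρ] with ω h1 h2 n m
    refine (h2 n).abs_sub_le_of_dense (h2 m) hD fun q hq => ?_
    have h3 := abs_le.1 (h1 n q hq)
    have h4 := abs_le.1 (h1 m q hq)
    rw [abs_le]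
    constructor <;> linarith [h3.1, h3.2, h4.1, h4.2]
  have htends : ∀ᵐ ω ∂P, ∀ t, Tendsto (fun n => ρ n t ω) atTop
      (𝓝 (limUnder atTop fun n => ρ n t ω)) := by
    filter_upwards [hall] with ω hω t
    refine CauchySeq.tendsto_limUnder (cauchySeq_of_le_tendsto_0 (fun n : ℕ => 2 * (1 / ((n : ℝ) + 1)))
      (fun n m N hn hm => ?_) (by simpa using hlim0.const_mul 2))
    rw [Real.dist_eq]
    refine (hω n m t).trans ?_
    have h1 : 1 / ((n : ℝ) + 1) ≤ 1 / (N + 1) := by gcongr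
    have h2 : 1 / ((m : ℝ) + 1) ≤ 1 / (N + 1) := by gcongr
    linarith
  refine ⟨fun t ω => limUnder atTop fun n => ρ n t ω, ?_, fun t => ?_⟩
  · filter_upwards [hall, htends, ae_all_iff.2 hρ] with ω h1 h2 h3
    refine isCadlag_of_forall_exists_abs_sub_le fun δ hδ => ?_
    obtain ⟨n, hn⟩ := (hlim0.eventually (gt_mem_nhds (show 0 < δ from hδ))).exists
    refine ⟨fun t => ρ n t ω, h3 n, fun t => ?_⟩
    have h4 : Tendsto (fun m : ℕ => 1 / ((n : ℝ) + 1) + 1 / ((m : ℝ) + 1)) atTop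
        (𝓝 (1 / ((n : ℝ) + 1) + 0)) := hlim0.const_add _
    have h5 := le_of_tendsto_of_tendsto' ((h2 t).const_sub (ρ n t ω)).abs h4 fun m => h1 n m t
    linarith
  · filter_upwards [htends, ae_all_iff.2 fun n => hρW n t] with ω h1 h2
    refine tendsto_nhds_unique (h1 t) ?_
    rw [tendsto_iff_dist_tendsto_zero]
    exact squeeze_zero (fun _ => dist_nonneg) h2 hlim0

end CadlagLimits

/-! ### Bounds on conditional expectations and joint measurability. -/

section Averaging

variable {Ω : Type*} {m0 : MeasurableSpace Ω} {P : Measure Ω} [IsProbabilityMeasure P]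

lemma ae_abs_condExp_le_of_forall_setIntegral {m : MeasurableSpace Ω} (hm : m ≤ m0) {ξ : Ω → ℝ}
    (hξ : Integrable ξ P) {δ : ℝ}
    (h : ∀ A, MeasurableSet[m] A → |∫ ω in A, ξ ω ∂P| ≤ δ * P.real A) :
    ∀ᵐ ω ∂P, |P[ξ | m] ω| ≤ δ := by
  have hint : Integrable (P[ξ | m]) (P.trim hm) :=
    integrable_condExp.trim hm stronglyMeasurable_condExp
  have hset : ∀ A, MeasurableSet[m] A →
      ∫ ω in A, (P[ξ | m]) ω ∂(P.trim hm) = ∫ ω in A, ξ ω ∂P := fun A hA => by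
    rw [← setIntegral_trim hm stronglyMeasurable_condExp hA, setIntegral_condExp hm hξ hA]
  have hconst : ∀ (c : ℝ) A, MeasurableSet[m] A →
      ∫ _ in A, c ∂(P.trim hm) = c * P.real A := fun c A hA => by
    rw [← setIntegral_trim hm stronglyMeasurable_const hA, setIntegral_const, smul_eq_mul, mul_comm]
  have h1 : P[ξ | m] ≤ᵐ[P.trim hm] fun _ => δ :=
    ae_le_of_forall_setIntegral_le hint (integrable_const _) fun A hA _ => by
      rw [hset A hA, hconst δ A hA]
      exact (abs_le.1 (h A hA)).2
  have h2 : (fun _ => -δ) ≤ᵐ[P.trim hm] P[ξ | m] :=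
    ae_le_of_forall_setIntegral_le (integrable_const _) hint fun A hA _ => by
      rw [hset A hA, hconst (-δ) A hA]
      linarith [(abs_le.1 (h A hA)).1]
  filter_upwards [ae_of_ae_trim hm h1, ae_of_ae_trim hm h2] with ω h3 h4
  exact abs_le.2 ⟨h4, h3⟩

lemma exists_discretization_from_right : ∃ (k : ℕ → ℝ≥0 → ℕ) (c : ℕ → ℕ → ℝ≥0),
    (∀ n, Measurable (k n)) ∧ ∀ t, Tendsto (fun n => c n (k n t)) atTop (𝓝[>] t) := by
  refine ⟨fun n t => ⌊((n : ℝ≥0) + 1) * t⌋₊, fun n k => ((k : ℝ≥0) + 1) / (n + 1),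
    fun n => Nat.measurable_floor.comp (measurable_id.const_mul _), fun t => ?_⟩
  have hgt : ∀ n : ℕ, t < ((⌊((n : ℝ≥0) + 1) * t⌋₊ : ℝ≥0) + 1) / (n + 1) := fun n => by
    rw [lt_div_iff₀ (by positivity), mul_comm]
    exact Nat.lt_floor_add_one _
  have hle : ∀ n : ℕ, ((⌊((n : ℝ≥0) + 1) * t⌋₊ : ℝ≥0) + 1) / (n + 1) ≤
      t + 1 / ((n : ℝ≥0) + 1) := fun n => by
    rw [add_div]
    gcongr
    rw [div_le_iff₀ (by positivity), mul_comm t]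
    exact Nat.floor_le (by positivity)
  refine tendsto_nhdsWithin_iff.2 ⟨?_, .of_forall fun n => hgt n⟩
  refine tendsto_of_tendsto_of_tendsto_of_le_of_le tendsto_const_nhds (?_ : Tendsto
    (fun n : ℕ => t + 1 / ((n : ℝ≥0) + 1)) atTop (𝓝 t)) (fun n => (hgt n).le) hle
  simpa using (tendsto_one_div_add_atTop_nhds_zero_nat (𝕜 := ℝ≥0)).const_add t

/-- Evaluating at discretized times strictly to the right gives jointly measurable processes, which
converge pointwise by right continuity. -/
lemma measurable_uncurry_of_continuousWithinAt_Ioi {Z : ℝ≥0 → Ω → ℝ} (hZ : ∀ t, Measurable (Z t))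
    (hright : ∀ ω t, ContinuousWithinAt (fun t => Z t ω) (Set.Ioi t) t) :
    Measurable (Function.uncurry Z) := by
  obtain ⟨k, c, hk, hlim⟩ := exists_discretization_from_right
  refine measurable_of_tendsto_metrizable (f := fun n (z : ℝ≥0 × Ω) => Z (c n (k n z.1)) z.2)
    (fun n => ?_) (tendsto_pi_nhds.2 fun z => (hright z.2 z.1).tendsto.comp (hlim z.1))
  have h1 : Measurable fun z : ℕ × Ω => Z (c n z.1) z.2 :=
    measurable_from_prod_countable_right fun j => hZ (c n j)
  exact h1.comp (((hk n).comp measurable_fst).prodMk measurable_snd)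

end Averaging

/-! ### Smoothing in time and the existence of càdlàg projections. -/

section Smoothing

variable {Ω : Type*} {m0 : MeasurableSpace Ω}

/-- The integral of a path over the time interval `[t, t + ε]`. -/
noncomputable def windowIntegral (ε : ℝ≥0) (x : ℝ≥0 → ℝ) (t : ℝ≥0) : ℝ :=
  ∫ r in (0 : ℝ)..ε, x (t + r.toNNReal)

lemma abs_intervalIntegral_le {y : ℝ → ℝ} {a b C : ℝ} (h : ∀ r ∈ Set.uIoc a b, |y r| ≤ C) :
    |∫ r in a..b, y r| ≤ C * |b - a| := by
  have := intervalIntegral.norm_integral_le_of_norm_le_const (f := y) (a := a) (b := b) (C := C) h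
  rwa [Real.norm_eq_abs] at this

/-- The difference of two window integrals is a difference of integrals over two intervals of length
`|t - s|`, one at each end of the windows. -/
lemma abs_windowIntegral_sub_le {x : ℝ≥0 → ℝ} (hx : Measurable x) {C : ℝ} (hC : ∀ t, |x t| ≤ C)
    (ε s t : ℝ≥0) : |windowIntegral ε x t - windowIntegral ε x s| ≤ 2 * C * |(t : ℝ) - s| := by
  set y : ℝ → ℝ := fun r => x r.toNNReal with hy
  have hym : Measurable y := hx.comp measurable_real_toNNReal
  have hint : ∀ a b, IntervalIntegrable y volume a b := fun a b =>
    (intervalIntegrable_const (c := C)).mono_fun hym.aestronglyMeasurable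
      (ae_of_all _ fun r => by
        simp only [Real.norm_eq_abs]
        exact (hC _).trans (le_abs_self C))
  have hw : ∀ t : ℝ≥0, windowIntegral ε x t = ∫ r in (t : ℝ)..(t + ε), y r := fun t => by
    have h1 : windowIntegral ε x t = ∫ r in (0 : ℝ)..ε, y (t + r) := by
      refine intervalIntegral.integral_congr fun r hr => ?_
      rw [Set.uIcc_of_le ε.coe_nonneg] at hr
      simp only [hy]
      rw [Real.toNNReal_add t.coe_nonneg hr.1, Real.toNNReal_coe]
    rw [h1, intervalIntegral.integral_comp_add_left, add_zero]
  have hbd : ∀ a b, |∫ r in a..b, y r| ≤ C * |b - a| := fun a b =>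
    abs_intervalIntegral_le fun r _ => hC _
  rw [hw, hw, intervalIntegral.integral_interval_sub_interval_comm' (hint _ _) (hint _ _)
    (hint _ _)]
  have h1 := hbd ((s : ℝ) + ε) (t + ε)
  have h2 := hbd (s : ℝ) t
  have h3 : (t : ℝ) + ε - (s + ε) = t - s := by ring
  rw [h3] at h1
  refine (abs_sub _ _).trans ?_
  linarith

variable {P : Measure Ω} [IsProbabilityMeasure P] {G : Filtration ℝ≥0 m0} {Z : ℝ≥0 → Ω → ℝ}

/-- The optional projection of a bounded right-continuous process whose conditional increments over
short time intervals are uniformly small has a càdlàg version. -/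
theorem exists_cadlag_condExp_of_small_increments
    (hG : ∀ t, ⨅ s > t, (G s : MeasurableSpace Ω) ≤ G t) (hZm : ∀ t, Measurable (Z t))
    {C : ℝ} (hC : ∀ t ω, |Z t ω| ≤ C)
    (hright : ∀ ω t, ContinuousWithinAt (fun t => Z t ω) (Set.Ioi t) t)
    (hslow : ∀ δ > 0, ∃ ε : ℝ≥0, 0 < ε ∧ ∀ t A, MeasurableSet[G t] A → ∀ r ≤ ε,
      |∫ ω in A, Z (t + r) ω ∂P - ∫ ω in A, Z t ω ∂P| ≤ δ * P.real A) :
    ∃ π : ℝ≥0 → Ω → ℝ, (∀ᵐ ω ∂P, IsCadlag fun t => π t ω) ∧ ∀ t, π t =ᵐ[P] P[Z t | G t] := by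
  have hjoint := measurable_uncurry_of_continuousWithinAt_Ioi hZm hright
  refine exists_cadlag_of_forall_approx fun δ hδ => ?_
  obtain ⟨ε, hε, hslow⟩ := hslow δ hδ
  have hε' : (0 : ℝ) < ε := by exact_mod_cast hε
  have hC0 : 0 ≤ C := by
    obtain ⟨ω⟩ : Nonempty Ω := P.nonempty_of_neZero
    exact (abs_nonneg _).trans (hC 0 ω)
  set A : ℝ≥0 → Ω → ℝ := fun t ω => (ε : ℝ)⁻¹ * windowIntegral ε (fun s => Z s ω) t with hA
  have hshift : ∀ t : ℝ≥0, Measurable fun z : Ω × ℝ => Z (t + z.2.toNNReal) z.1 := fun t =>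
    hjoint.comp ((measurable_const.add (measurable_real_toNNReal.comp measurable_snd)).prodMk
      measurable_fst)
  have hAm : ∀ t, Measurable (A t) := fun t => by
    refine Measurable.const_mul ?_ _
    simp only [windowIntegral, intervalIntegral.integral_of_le ε.coe_nonneg]
    exact ((hshift t).stronglyMeasurable.integral_prod_right
      (ν := volume.restrict (Set.Ioc (0 : ℝ) ε))).measurable
  have hpath : ∀ ω, Measurable fun s => Z s ω := fun ω => hjoint.of_uncurry_right
  set L : ℝ := (ε : ℝ)⁻¹ * (2 * C) with hL
  have hL0 : 0 ≤ L := by positivity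
  have hlip : ∀ ω s t, |A t ω - A s ω| ≤ L * |(t : ℝ) - s| := fun ω s t => by
    rw [hA]
    simp only
    rw [← mul_sub, abs_mul, abs_of_pos (inv_pos.2 hε'), hL, mul_assoc]
    exact mul_le_mul_of_nonneg_left (abs_windowIntegral_sub_le (hpath ω) (fun t => hC t ω) ε s t)
      (inv_pos.2 hε').le
  have hAC : ∀ t ω, |A t ω| ≤ C := fun t ω => by
    have h1 : |windowIntegral ε (fun s => Z s ω) t| ≤ C * |(ε : ℝ) - 0| :=
      abs_intervalIntegral_le fun r _ => hC _ ω
    rw [hA]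
    simp only
    rw [sub_zero, abs_of_pos hε'] at h1
    rw [abs_mul, abs_of_pos (inv_pos.2 hε'), inv_mul_le_iff₀ hε', mul_comm (ε : ℝ)]
    exact h1
  have hAcont : ∀ ω, Continuous fun t => A t ω := fun ω => by
    refine (LipschitzWith.of_dist_le_mul (K := ⟨L, hL0⟩) fun t s => ?_).continuous
    exact hlip ω s t
  -- The average `A` is `L`-Lipschitz in time, so the drift `L * t` makes it increasing. The drift
  -- is deterministic and is subtracted again afterwards.
  obtain ⟨π, hπ, hπB⟩ := exists_cadlag_condExp_of_monotone (P := P) (G := G)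
    (B := fun t ω => A t ω + L * t) (C := fun t => C + L * t) hG
    (fun t => (hAm t).add_const _)
    (fun s t hst => by
      have : (s : ℝ) ≤ t := by exact_mod_cast hst
      simp only
      gcongr)
    (fun t ω => (abs_add_le _ _).trans (add_le_add (hAC t ω) (abs_of_nonneg (by positivity)).le))
    (fun ω s t hst => by
      have h1 : (s : ℝ) ≤ t := by exact_mod_cast hst
      have h2 := (abs_le.1 (hlip ω s t)).1
      rw [abs_of_nonneg (sub_nonneg.2 h1)] at h2
      simp only
      linarith)
    (fun ω t => ((hAcont ω).add (continuous_const.mul NNReal.continuous_coe)).continuousWithinAt)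
  refine ⟨fun t ω => π t ω - L * t, ?_, fun t => ?_⟩
  · filter_upwards [hπ] with ω hω t
    have hc : Continuous fun t : ℝ≥0 => L * (t : ℝ) := continuous_const.mul NNReal.continuous_coe
    obtain ⟨h1, l, h2⟩ := hω t
    exact ⟨h1.sub hc.continuousWithinAt, _, h2.sub (hc.tendsto t |>.mono_left nhdsWithin_le_nhds)⟩
  have hAint : ∀ t, Integrable (A t) P := fun t => integrable_of_forall_abs_le (hAm t) (hAC t)
  have hZint : ∀ t, Integrable (Z t) P := fun t => integrable_of_forall_abs_le (hZm t) (hC t)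
  have h1 : P[fun ω => A t ω + L * t | G t] =ᵐ[P] P[A t | G t] + fun _ => L * t := by
    refine (condExp_add (hAint t) (integrable_const _) _).trans ?_
    rw [condExp_const (G.le t)]
  have h2 : P[A t - Z t | G t] =ᵐ[P] P[A t | G t] - P[Z t | G t] :=
    condExp_sub (hAint t) (hZint t) _
  -- By Fubini, the integral of `A t - Z t` over an event is an average of integrated increments
  -- over times at most `ε`, each of which `hslow` bounds.
  have h3 : ∀ᵐ ω ∂P, |P[A t - Z t | G t] ω| ≤ δ := by
    refine ae_abs_condExp_le_of_forall_setIntegral (G.le t) ((hAint t).sub (hZint t))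
      fun E hE => ?_
    have hswap : ∫ ω in E, windowIntegral ε (fun s => Z s ω) t ∂P =
        ∫ r in (0 : ℝ)..ε, ∫ ω in E, Z (t + r.toNNReal) ω ∂P := by
      refine (intervalIntegral_integral_swap ?_).symm
      have : IsFiniteMeasure (volume.restrict (Set.uIoc (0 : ℝ) ε)) :=
        ⟨by rw [Set.uIoc_of_le hε'.le]; simp⟩
      refine Integrable.of_bound ?_ C (ae_of_all _ fun z => hC _ _)
      exact ((hshift t).comp measurable_swap).aestronglyMeasurable
    have hii : IntervalIntegrable (fun r : ℝ => ∫ ω in E, Z (t + r.toNNReal) ω ∂P) volume 0 ε := by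
      refine (intervalIntegrable_const (c := C)).mono_fun ?_ (ae_of_all _ fun r => ?_)
      · exact (((hshift t).comp measurable_swap).stronglyMeasurable.integral_prod_right'
          (ν := P.restrict E)).aestronglyMeasurable
      · refine (norm_integral_le_of_norm_le_const (C := C) (ae_of_all _ fun ω => hC _ ω)).trans ?_
        rw [Real.norm_of_nonneg hC0]
        refine mul_le_of_le_one_right hC0 ?_
        exact (measureReal_restrict_apply_univ E).trans_le measureReal_le_one
    have heq : ∫ ω in E, (A t - Z t) ω ∂P = (ε : ℝ)⁻¹ * ∫ r in (0 : ℝ)..ε,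
        (∫ ω in E, Z (t + r.toNNReal) ω ∂P - ∫ ω in E, Z t ω ∂P) := by
      rw [intervalIntegral.integral_sub hii intervalIntegrable_const, ← hswap,
        intervalIntegral.integral_const, mul_sub, ← integral_const_mul]
      simp only [Pi.sub_apply]
      rw [integral_sub (hAint t).integrableOn (hZint t).integrableOn, sub_zero, smul_eq_mul,
        inv_mul_cancel_left₀ hε'.ne']
    have hle : |∫ r in (0 : ℝ)..ε, (∫ ω in E, Z (t + r.toNNReal) ω ∂P - ∫ ω in E, Z t ω ∂P)| ≤
        δ * P.real E * |(ε : ℝ) - 0| := by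
      refine abs_intervalIntegral_le fun r hr => ?_
      rw [Set.uIoc_of_le hε'.le] at hr
      exact hslow t E hE _ (Real.toNNReal_le_iff_le_coe.2 hr.2)
    rw [heq, abs_mul, abs_of_pos (inv_pos.2 hε'), inv_mul_le_iff₀ hε', mul_comm (ε : ℝ)]
    rwa [sub_zero, abs_of_pos hε'] at hle
  filter_upwards [hπB t, h1, h2, h3] with ω h4 h5 h6 h7
  rw [h6] at h7
  rw [h4, h5]
  simp only [Pi.add_apply, Pi.sub_apply] at h7 ⊢
  rwa [add_sub_cancel_right]

end Smoothing

/-! ### Merging of predictions. -/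

section Merging

variable {Ω : Type*} {m0 : MeasurableSpace Ω} {P Q : Measure Ω} {G : Filtration ℝ≥0 m0}

/-- Lévy's upward theorem for a bounded random variable, along a countable set of times. -/
lemma ae_tendsto_condExp_of_countable [IsProbabilityMeasure Q] {D : Set ℝ≥0} (hD : D.Countable)
    {ξ : Ω → ℝ} (hξ : StronglyMeasurable[⨆ t, G t] ξ) {C : ℝ} (hC : ∀ ω, |ξ ω| ≤ C) :
    ∀ᵐ ω ∂Q, Tendsto (fun q => Q[ξ | G q] ω) (atTop ⊓ 𝓟 D) (𝓝 (ξ ω)) := by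
  -- Finitely many upcrossings give a limit along `D'`. The integers are included so that the
  -- discrete-time Lévy theorem identifies this limit as `ξ`.
  set D' : Set ℝ≥0 := D ∪ Set.range ((↑) : ℕ → ℝ≥0) with hD'
  have hD'c : D'.Countable := hD.union (Set.countable_range _)
  have hle : (⨆ t, (G t : MeasurableSpace Ω)) ≤ m0 := iSup_le G.le
  have hint : Integrable ξ Q := integrable_of_forall_abs_le (hξ.mono hle).measurable hC
  have hbd : ∀ t, ∀ᵐ ω ∂Q, |Q[ξ | G t] ω| ≤ C := fun t => ae_abs_condExp_le (ae_of_all _ hC)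
  have hup := ae_not_upcross (martingale_condExp ξ G Q).submartingale hD'c fun t _ => hbd t
  have hmono : Monotone ((↑) : ℕ → ℝ≥0) := Nat.mono_cast
  have hsup : (⨆ n, (sampledFiltration G _ hmono n : MeasurableSpace Ω)) = ⨆ t, G t := by
    refine le_antisymm (iSup_le fun n => le_iSup (fun t => (G t : MeasurableSpace Ω)) (n : ℝ≥0))
      (iSup_le fun t => ?_)
    obtain ⟨n, hn⟩ := exists_nat_ge t
    exact (G.mono hn).trans
      (le_iSup (fun n => (sampledFiltration G _ hmono n : MeasurableSpace Ω)) n)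
  have hlevy := tendsto_ae_condExp (μ := Q) (ℱ := sampledFiltration G _ hmono) ξ
  rw [hsup, condExp_of_stronglyMeasurable hle hξ hint] at hlevy
  filter_upwards [hup, hlevy, (ae_ball_iff hD'c).2 fun t _ => hbd t] with ω h1 h2 h3
  have hmem : ∀ᶠ r in atTop ⊓ 𝓟 D', r ∈ D' := mem_inf_of_right (mem_principal_self _)
  obtain ⟨c, hc⟩ := exists_tendsto_of_not_upcross (x := fun q => Q[ξ | G q] ω)
    (l := atTop ⊓ 𝓟 D') (C := C) hmem
    (Or.inl (.of_forall fun r => (eventually_gt_atTop r).filter_mono inf_le_left))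
    (hmem.mono h3) h1
  have hnat : Tendsto ((↑) : ℕ → ℝ≥0) atTop (atTop ⊓ 𝓟 D') :=
    tendsto_inf.2 ⟨tendsto_natCast_atTop_atTop,
      tendsto_principal.2 (.of_forall fun n => Or.inr ⟨n, rfl⟩)⟩
  have hcξ : c = ξ ω := tendsto_nhds_unique (hc.comp hnat) h2
  rw [← hcξ]
  exact hc.mono_left (inf_le_inf_left _ (principal_mono.2 Set.subset_union_left))

/-- A measure dominated by a multiple of another has a bounded density on every sub-σ-algebra. -/
lemma exists_bounded_density [IsFiniteMeasure P] [IsFiniteMeasure Q] {c : ℝ≥0} (hPQ : P ≤ c • Q)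
    {m : MeasurableSpace Ω} (hm : m ≤ m0) :
    ∃ Λ : Ω → ℝ, Measurable[m] Λ ∧ (∀ ω, 0 ≤ Λ ω ∧ Λ ω ≤ c) ∧
      (∀ ξ : Ω → ℝ, Measurable[m] ξ → ∫ ω, ξ ω ∂P = ∫ ω, Λ ω * ξ ω ∂Q) ∧
      ∀ᵐ ω ∂P, 0 < Λ ω := by
  have hle : P.trim hm ≤ c • Q.trim hm := by
    refine Measure.le_iff.2 fun A hA => ?_
    rw [Measure.smul_apply, trim_measurableSet_eq hm hA, trim_measurableSet_eq hm hA]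
    exact Measure.le_iff.1 hPQ A (hm A hA)
  have hac : P.trim hm ≪ Q.trim hm :=
    (Measure.absolutelyContinuous_of_le hle).trans (Measure.smul_absolutelyContinuous)
  set Λ0 := (P.trim hm).rnDeriv (Q.trim hm) with hΛ0
  have hΛ0m : Measurable[m] Λ0 := Measure.measurable_rnDeriv _ _
  have hΛ0le : ∀ᵐ ω ∂(Q.trim hm), Λ0 ω ≤ c := by
    refine ae_le_of_forall_setLIntegral_le_of_sigmaFinite hΛ0m fun A hA _ => ?_
    refine (Measure.setLIntegral_rnDeriv_le A).trans ((hle A).trans ?_)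
    rw [setLIntegral_const, Measure.smul_apply, ENNReal.smul_def, smul_eq_mul]
  -- Truncation turns the almost sure bound into a pointwise one without changing any integral.
  set Λ : Ω → ℝ := fun ω => min (Λ0 ω).toReal c with hΛ
  have hΛm : Measurable[m] Λ := hΛ0m.ennreal_toReal.min measurable_const
  have hint : ∀ ξ : Ω → ℝ, Measurable[m] ξ → ∫ ω, ξ ω ∂P = ∫ ω, Λ ω * ξ ω ∂Q := by
    intro ξ hξ
    rw [integral_trim hm hξ.stronglyMeasurable,
      integral_trim hm (f := fun ω => Λ ω * ξ ω) (hΛm.mul hξ).stronglyMeasurable, ← integral_rnDeriv_smul hac]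
    refine integral_congr_ae ?_
    filter_upwards [hΛ0le] with ω hω
    have : (Λ0 ω).toReal ≤ c := ENNReal.toReal_le_coe_of_le_coe hω
    show (Λ0 ω).toReal * ξ ω = min (Λ0 ω).toReal c * ξ ω
    rw [min_eq_left this]
  refine ⟨Λ, hΛm, fun ω => ⟨le_min ENNReal.toReal_nonneg c.coe_nonneg, min_le_right _ _⟩, hint, ?_⟩
  -- Positivity under `P`: the `P`-mass of the zero set of `Λ` is the `Q`-integral of `Λ` over that
  -- set.
  have hset : MeasurableSet[m] {ω | Λ ω ≤ 0} := measurableSet_le hΛm measurable_const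
  have h1 := hint ({ω | Λ ω ≤ 0}.indicator fun _ => (1 : ℝ)) (measurable_const.indicator hset)
  have h2 : ∀ ω, Λ ω * ({ω | Λ ω ≤ 0}.indicator (fun _ => (1 : ℝ)) ω) = 0 := fun ω => by
    by_cases h : Λ ω ≤ 0
    · have : Λ ω = 0 := le_antisymm h (le_min ENNReal.toReal_nonneg c.coe_nonneg)
      rw [this, zero_mul]
    · simp [h]
  simp only [h2, integral_zero] at h1
  rw [integral_indicator (hm _ hset), setIntegral_const, smul_eq_mul, mul_one,
    measureReal_eq_zero_iff] at h1
  rw [ae_iff]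
  simpa using h1

/-- Bayes' formula for conditional expectations. -/
lemma condExp_density_mul_ae_eq [IsProbabilityMeasure P] [IsProbabilityMeasure Q]
    {m m' : MeasurableSpace Ω} (hmm' : m ≤ m') (hm' : m' ≤ m0) (hac : P ≪ Q)
    {Λ : Ω → ℝ} {c : ℝ} (hΛm : Measurable[m'] Λ) (hΛc : ∀ ω, |Λ ω| ≤ c)
    (hΛ : ∀ ξ : Ω → ℝ, Measurable[m'] ξ → ∫ ω, ξ ω ∂P = ∫ ω, Λ ω * ξ ω ∂Q)
    {ξ : Ω → ℝ} (hξ : Measurable[m'] ξ) {C : ℝ} (hC : ∀ ω, |ξ ω| ≤ C) :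
    ∀ᵐ ω ∂P, P[ξ | m] ω * Q[Λ | m] ω = Q[ξ * Λ | m] ω := by
  have hm := hmm'.trans hm'
  obtain ⟨ω0⟩ : Nonempty Ω := P.nonempty_of_neZero
  have hC0 : 0 ≤ C := (abs_nonneg _).trans (hC ω0)
  -- The conditional expectation under `P` is bounded only `P`-almost surely, but it must be
  -- integrated under `Q`, which may charge `P`-null sets. Clipping gives an everywhere bounded
  -- version.
  set η : Ω → ℝ := fun ω => max (-C) (min C (P[ξ | m] ω)) with hη
  have hηm : Measurable[m] η :=
    measurable_const.max (measurable_const.min stronglyMeasurable_condExp.measurable)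
  have hηC : ∀ ω, |η ω| ≤ C := fun ω =>
    abs_le.2 ⟨le_max_left _ _, max_le (by linarith) (min_le_left _ _)⟩
  have hηP : ∀ᵐ ω ∂P, η ω = P[ξ | m] ω := by
    filter_upwards [ae_abs_condExp_le (m := m) (ae_of_all P hC)] with ω hω
    have := abs_le.1 hω
    simp only [hη, min_eq_right this.2, max_eq_right this.1]
  have hΛint : Integrable Λ Q := integrable_of_forall_abs_le (hΛm.mono hm' le_rfl) hΛc
  have hmulint : ∀ ζ : Ω → ℝ, Measurable[m'] ζ → (∀ ω, |ζ ω| ≤ C) → Integrable (ζ * Λ) Q :=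
    fun ζ hζ hζC => integrable_of_forall_abs_le ((hζ.mul hΛm).mono hm' le_rfl) (C := C * c)
      fun ω => by
        rw [Pi.mul_apply, abs_mul]
        exact mul_le_mul (hζC ω) (hΛc ω) (abs_nonneg _) hC0
  have hη' := hηm.mono hmm' le_rfl
  have hset : ∀ ζ : Ω → ℝ, Measurable[m'] ζ → ∀ A, MeasurableSet[m] A →
      ∫ ω in A, (ζ * Λ) ω ∂Q = ∫ ω in A, ζ ω ∂P := by
    intro ζ hζ A hA
    rw [← integral_indicator (hm A hA), ← integral_indicator (hm A hA),
      hΛ _ (hζ.indicator (hmm' A hA))]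
    refine integral_congr_ae (ae_of_all _ fun ω => ?_)
    by_cases h : ω ∈ A <;> simp [h, mul_comm]
  have heq : Q[η * Λ | m] =ᵐ[Q] Q[ξ * Λ | m] := by
    refine ae_eq_condExp_of_forall_setIntegral_eq hm (hmulint ξ hξ hC)
      (fun _ _ _ => integrable_condExp.integrableOn) (fun A hA _ => ?_)
      stronglyMeasurable_condExp.aestronglyMeasurable
    rw [setIntegral_condExp hm (hmulint η hη' hηC) hA, hset η hη' A hA, hset ξ hξ A hA,
      ← setIntegral_condExp hm (integrable_of_forall_abs_le (hξ.mono hm' le_rfl) hC) hA]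
    exact integral_congr_ae (ae_restrict_of_ae hηP)
  have hpull : Q[η * Λ | m] =ᵐ[Q] η * Q[Λ | m] :=
    condExp_mul_of_stronglyMeasurable_left hηm.stronglyMeasurable (hmulint η hη' hηC) hΛint
  filter_upwards [hηP, hac.ae_le heq, hac.ae_le hpull] with ω h1 h2 h3
  rw [← h2, h3, Pi.mul_apply, h1]

/-- The left side is a conditional covariance, hence at most `C` times the conditional mean of `|Λ -
Q[Λ | m]|`. The inequality `|u| ≤ η / 2 + u ^ 2 / (2 * η)` replaces conditional Cauchy-Schwarz. The
bound depends on `ξ` only through `C`, so `ξ` may vary with time. -/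
lemma abs_condExp_mul_sub_le [IsProbabilityMeasure Q] {m : MeasurableSpace Ω} (hm : m ≤ m0)
    {Λ : Ω → ℝ} {c : ℝ} (hΛm : Measurable[m0] Λ) (hΛc : ∀ ω, |Λ ω| ≤ c)
    {ξ : Ω → ℝ} (hξ : Measurable[m0] ξ) {C : ℝ} (hC : ∀ ω, |ξ ω| ≤ C) {η : ℝ} (hη : 0 < η) :
    ∀ᵐ ω ∂Q, |Q[ξ * Λ | m] ω - Q[Λ | m] ω * Q[ξ | m] ω| ≤
      C * (η / 2 + (Q[Λ ^ 2 | m] ω - Q[Λ | m] ω ^ 2) / (2 * η)) := by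
  obtain ⟨ω0⟩ : Nonempty Ω := Q.nonempty_of_neZero
  have hC0 : 0 ≤ C := (abs_nonneg _).trans (hC ω0)
  have hc0 : 0 ≤ c := (abs_nonneg _).trans (hΛc ω0)
  set Λq := Q[Λ | m] with hΛq
  have hsm : StronglyMeasurable[m] Λq := stronglyMeasurable_condExp
  have hsm0 : AEStronglyMeasurable[m0] Λq Q := (hsm.mono hm).aestronglyMeasurable
  have hqc : ∀ᵐ ω ∂Q, |Λq ω| ≤ c := ae_abs_condExp_le (ae_of_all _ hΛc)
  have hξint : Integrable ξ Q := integrable_of_forall_abs_le hξ hC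
  have hΛint : Integrable Λ Q := integrable_of_forall_abs_le hΛm hΛc
  have hΛqint : Integrable Λq Q := integrable_condExp
  have hbdd : ∀ {f g : Ω → ℝ} {a b : ℝ}, AEStronglyMeasurable[m0] f Q → AEStronglyMeasurable[m0] g Q →
      (∀ᵐ ω ∂Q, |f ω| ≤ a) → (∀ᵐ ω ∂Q, |g ω| ≤ b) → Integrable (f * g) Q := by
    intro f g a b hf hg hfa hgb
    refine Integrable.of_bound (hf.mul hg) (a * b) ?_
    filter_upwards [hfa, hgb] with ω h1 h2
    rw [Pi.mul_apply, norm_mul]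
    exact mul_le_mul h1 h2 (norm_nonneg _) ((abs_nonneg _).trans h1)
  have hξΛ : Integrable (ξ * Λ) Q := hbdd hξ.aestronglyMeasurable hΛm.aestronglyMeasurable
    (ae_of_all _ hC) (ae_of_all _ hΛc)
  have hΛqξ : Integrable (Λq * ξ) Q := hbdd hsm0 hξ.aestronglyMeasurable hqc (ae_of_all _ hC)
  have hΛqΛ : Integrable (Λq * Λ) Q := hbdd hsm0 hΛm.aestronglyMeasurable hqc (ae_of_all _ hΛc)
  have hΛΛ : Integrable (Λ ^ 2) Q := by
    rw [pow_two]
    exact hbdd hΛm.aestronglyMeasurable hΛm.aestronglyMeasurable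
      (ae_of_all _ hΛc) (ae_of_all _ hΛc)
  have hqq : Integrable (Λq ^ 2) Q := by
    rw [pow_two]
    exact hbdd hsm0 hsm0 hqc hqc
  set T : Ω → ℝ := fun ω => C * η / 2 + C / (2 * η) * (Λq ^ 2) ω with hT
  have hTint : Integrable T Q := (integrable_const _).add (hqq.const_mul _)
  have hTm : StronglyMeasurable[m] T :=
    stronglyMeasurable_const.add ((hsm.pow 2).const_mul _)
  -- This is `C * (η / 2 + (Λ - Λq) ^ 2 / (2 * η))`, expanded so that the `m`-measurable factors can
  -- be pulled out.
  set U : Ω → ℝ := (C / (2 * η)) • (Λ ^ 2) - (C / η) • (Λq * Λ) + T with hU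
  have hUint : Integrable U Q := ((hΛΛ.smul _).sub (hΛqΛ.smul _)).add hTint
  have hpw : ∀ ω, |(ξ * Λ - Λq * ξ) ω| ≤ U ω := by
    intro ω
    simp only [hU, hT, Pi.sub_apply, Pi.mul_apply, Pi.add_apply, Pi.smul_apply, Pi.pow_apply,
      smul_eq_mul]
    have h1 : ξ ω * Λ ω - Λq ω * ξ ω = ξ ω * (Λ ω - Λq ω) := by ring
    rw [h1, abs_mul]
    have h2 : |Λ ω - Λq ω| ≤ η / 2 + (Λ ω - Λq ω) ^ 2 / (2 * η) := by
      have h3 : 0 ≤ (η - |Λ ω - Λq ω|) ^ 2 / (2 * η) := by positivity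
      have h4 : (η - |Λ ω - Λq ω|) ^ 2 / (2 * η) =
          η / 2 + (Λ ω - Λq ω) ^ 2 / (2 * η) - |Λ ω - Λq ω| := by
        rw [sub_sq, sq_abs]; field_simp; ring
      linarith
    calc |ξ ω| * |Λ ω - Λq ω| ≤ C * (η / 2 + (Λ ω - Λq ω) ^ 2 / (2 * η)) :=
          mul_le_mul (hC ω) h2 (abs_nonneg _) hC0
      _ = _ := by field_simp; ring
  have hup : Q[ξ * Λ - Λq * ξ | m] ≤ᵐ[Q] Q[U | m] :=
    condExp_mono (hξΛ.sub hΛqξ) hUint (ae_of_all _ fun ω => (abs_le.1 (hpw ω)).2)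
  have hlow : Q[-U | m] ≤ᵐ[Q] Q[ξ * Λ - Λq * ξ | m] :=
    condExp_mono hUint.neg (hξΛ.sub hΛqξ) (ae_of_all _ fun ω => (abs_le.1 (hpw ω)).1)
  have e1 : Q[ξ * Λ - Λq * ξ | m] =ᵐ[Q] Q[ξ * Λ | m] - Q[Λq * ξ | m] := condExp_sub hξΛ hΛqξ m
  have e2 : Q[Λq * ξ | m] =ᵐ[Q] Λq * Q[ξ | m] :=
    condExp_mul_of_stronglyMeasurable_left hsm hΛqξ hξint
  have e3 : Q[Λq * Λ | m] =ᵐ[Q] Λq * Λq :=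
    condExp_mul_of_stronglyMeasurable_left hsm hΛqΛ hΛint
  have e4 : Q[U | m] =ᵐ[Q] Q[(C / (2 * η)) • (Λ ^ 2) - (C / η) • (Λq * Λ) | m] + Q[T | m] :=
    condExp_add ((hΛΛ.smul _).sub (hΛqΛ.smul _)) hTint m
  have e5 : Q[(C / (2 * η)) • (Λ ^ 2) - (C / η) • (Λq * Λ) | m] =ᵐ[Q]
      Q[(C / (2 * η)) • (Λ ^ 2) | m] - Q[(C / η) • (Λq * Λ) | m] :=
    condExp_sub (hΛΛ.smul _) (hΛqΛ.smul _) m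
  have e6 : Q[(C / (2 * η)) • (Λ ^ 2) | m] =ᵐ[Q] (C / (2 * η)) • Q[Λ ^ 2 | m] := condExp_smul _ _ m
  have e7 : Q[(C / η) • (Λq * Λ) | m] =ᵐ[Q] (C / η) • Q[Λq * Λ | m] := condExp_smul _ _ m
  have e8 : Q[T | m] = T := condExp_of_stronglyMeasurable hm hTm hTint
  have e9 : Q[-U | m] =ᵐ[Q] -Q[U | m] := condExp_neg U m
  filter_upwards [hup, hlow, e1, e2, e3, e4, e5, e6, e7, e9] with ω hup hlow e1 e2 e3 e4 e5 e6 e7 e9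
  simp only [Pi.sub_apply, Pi.mul_apply, Pi.add_apply, Pi.smul_apply, Pi.neg_apply,
    smul_eq_mul] at hup hlow e1 e2 e3 e4 e5 e6 e7 e9
  rw [e9] at hlow
  have hval : Q[U | m] ω = C * (η / 2 + (Q[Λ ^ 2 | m] ω - Λq ω ^ 2) / (2 * η)) := by
    rw [e4, e5, e6, e7, e3, e8]
    simp only [hT, Pi.pow_apply]
    field_simp
    ring
  rw [← hval, ← e2, ← e1, abs_le]
  exact ⟨hlow, hup⟩

/-- Merging of conditional expectations: if `P` is dominated by a multiple of `Q`, then the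
conditional expectations under `P` and `Q` of uniformly bounded variables merge, `P`-almost surely,
along every countable set of times. -/
theorem ae_tendsto_condExp_sub_condExp [IsProbabilityMeasure P] [IsProbabilityMeasure Q] {c : ℝ≥0}
    (hPQ : P ≤ c • Q) {D : Set ℝ≥0} (hD : D.Countable) {ξ : ℝ≥0 → Ω → ℝ}
    (hξ : ∀ t, Measurable[⨆ t, G t] (ξ t)) {C : ℝ} (hC : ∀ t ω, |ξ t ω| ≤ C) :
    ∀ᵐ ω ∂P, Tendsto (fun q => P[ξ q | G q] ω - Q[ξ q | G q] ω) (atTop ⊓ 𝓟 D) (𝓝 0) := by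
  have hle : (⨆ t, (G t : MeasurableSpace Ω)) ≤ m0 := iSup_le G.le
  have hac : P ≪ Q :=
    (Measure.absolutelyContinuous_of_le hPQ).trans Measure.smul_absolutelyContinuous
  obtain ⟨Λ, hΛm, hΛc, hΛ, hpos⟩ := exists_bounded_density hPQ hle
  have hΛc' : ∀ ω, |Λ ω| ≤ c := fun ω => by rw [abs_of_nonneg (hΛc ω).1]; exact (hΛc ω).2
  have hΛ2 : ∀ ω, |(Λ ^ 2) ω| ≤ (c : ℝ) ^ 2 := fun ω => by
    rw [Pi.pow_apply, abs_pow]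
    exact pow_le_pow_left₀ (abs_nonneg _) (hΛc' ω) 2
  have hG : ∀ q, (G q : MeasurableSpace Ω) ≤ ⨆ t, G t := le_iSup fun t => (G t : MeasurableSpace Ω)
  have h1 := hac.ae_le (ae_tendsto_condExp_of_countable (Q := Q) hD hΛm.stronglyMeasurable hΛc')
  have h2 := hac.ae_le
    (ae_tendsto_condExp_of_countable (Q := Q) hD (ξ := Λ ^ 2) (hΛm.pow_const 2).stronglyMeasurable
      hΛ2)
  have h3 : ∀ᵐ ω ∂P, ∀ q ∈ D, P[ξ q | G q] ω * Q[Λ | G q] ω = Q[ξ q * Λ | G q] ω :=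
    (ae_ball_iff hD).2 fun q _ =>
      condExp_density_mul_ae_eq (hG q) hle hac hΛm hΛc' hΛ (hξ q) (hC q)
  have h4 : ∀ᵐ ω ∂P, ∀ q ∈ D, ∀ n : ℕ,
      |Q[ξ q * Λ | G q] ω - Q[Λ | G q] ω * Q[ξ q | G q] ω| ≤ C * (1 / ((n : ℝ) + 1) / 2 +
        (Q[Λ ^ 2 | G q] ω - Q[Λ | G q] ω ^ 2) / (2 * (1 / ((n : ℝ) + 1)))) :=
    hac.ae_le ((ae_ball_iff hD).2 fun q _ => ae_all_iff.2 fun n =>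
      abs_condExp_mul_sub_le (G.le q) (hΛm.mono hle le_rfl) hΛc' ((hξ q).mono hle le_rfl) (hC q)
        (by positivity))
  filter_upwards [h1, h2, h3, h4, hpos] with ω h1 h2 h3 h4 hpos
  -- The conditional variance of `Λ` vanishes in the limit, by Lévy's theorem for `Λ` and for `Λ ^
  -- 2`.
  have hV : Tendsto (fun q => Q[Λ ^ 2 | G q] ω - Q[Λ | G q] ω ^ 2) (atTop ⊓ 𝓟 D) (𝓝 0) := by
    have := h2.sub (h1.pow 2)
    rwa [Pi.pow_apply, sub_self] at this
  have hprod : Tendsto (fun q => Q[ξ q * Λ | G q] ω - Q[Λ | G q] ω * Q[ξ q | G q] ω)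
      (atTop ⊓ 𝓟 D) (𝓝 0) := by
    rw [Metric.tendsto_nhds]
    intro ε hε
    have hn0 : Tendsto (fun n : ℕ => C * (1 / ((n : ℝ) + 1) / 2)) atTop (𝓝 0) := by
      simpa using ((tendsto_one_div_add_atTop_nhds_zero_nat (𝕜 := ℝ)).div_const 2).const_mul C
    obtain ⟨n, hn⟩ := (hn0.eventually (gt_mem_nhds hε)).exists
    have hlim : Tendsto (fun q => C * (1 / ((n : ℝ) + 1) / 2 +
        (Q[Λ ^ 2 | G q] ω - Q[Λ | G q] ω ^ 2) / (2 * (1 / ((n : ℝ) + 1))))) (atTop ⊓ 𝓟 D)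
        (𝓝 (C * (1 / ((n : ℝ) + 1) / 2))) := by
      simpa using ((hV.div_const (2 * (1 / ((n : ℝ) + 1)))).const_add
        (1 / ((n : ℝ) + 1) / 2)).const_mul C
    filter_upwards [hlim.eventually (gt_mem_nhds hn), mem_inf_of_right (mem_principal_self D)]
      with q hq hqD
    rw [Real.dist_eq, sub_zero]
    exact (h4 q hqD n).trans_lt hq
  -- By Bayes' formula the numerator is `Q[Λ | G q]` times the difference of predictions, and `Q[Λ |
  -- G q]` has the positive limit `Λ`.
  have hdiv := hprod.div h1 hpos.ne'
  rw [zero_div] at hdiv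
  refine hdiv.congr' ?_
  filter_upwards [h1.eventually (lt_mem_nhds hpos), mem_inf_of_right (mem_principal_self D)]
    with q hq hqD
  rw [Pi.div_apply, ← h3 q hqD, mul_comm, ← mul_sub, mul_div_cancel_left₀ _ hq.ne']

end Merging

/-! ### Shifts and σ-algebras on path space. -/

section Shift

lemma IsCadlag.shift {E : Type*} [TopologicalSpace E] {x : ℝ≥0 → E} (hx : IsCadlag x) (s : ℝ≥0) :
    IsCadlag fun t => x (s + t) := by
  intro t
  have hc : Continuous fun t : ℝ≥0 => s + t := by fun_prop
  obtain ⟨h1, l, h2⟩ := hx (s + t)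
  refine ⟨h1.comp hc.continuousWithinAt fun u hu => ?_, l, h2.comp ?_⟩
  · exact add_le_add_right (Set.mem_Ici.1 hu) s
  · refine tendsto_nhdsWithin_iff.2 ⟨(hc.tendsto t).mono_left nhdsWithin_le_nhds, ?_⟩
    filter_upwards [self_mem_nhdsWithin] with u hu
    exact add_lt_add_right (Set.mem_Iio.1 hu) s

variable {S : Type*} [TopologicalSpace S] {p : ℕ}

/-- The shift of paths by the time `s`. -/
def shift (s : ℝ≥0) (ω : Path S p) : Path S p :=
  (⟨fun t => ω.1.1 (s + t), ω.1.2.shift s⟩, ⟨fun t => ω.2.1 (s + t), ω.2.2.shift s⟩)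

lemma Z_shift (s t : ℝ≥0) (ω : Path S p) : Z t (shift s ω) = Z (s + t) ω := rfl

lemma measurable_Y_obsSigma {s t : ℝ≥0} (h : s ≤ t) :
    Measurable[obsSigma S p t] (Y s : Path S p → Obs p) :=
  (comap_measurable (Y s : Path S p → Obs p)).mono (le_iSup₂_of_le s h le_rfl) le_rfl

variable [MeasurableSpace S]

lemma measurable_Z (t : ℝ≥0) : Measurable (Z t : Path S p → S × Obs p) :=
  (measurable_X t).prodMk (measurable_Y t)

lemma measurable_path_of_measurable_Z {α : Type*} [MeasurableSpace α] {g : α → Path S p}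
    (hg : ∀ t, Measurable fun a => Z t (g a)) : Measurable g := by
  have h1 : Measurable fun a => (g a).1 :=
    Measurable.subtype_mk (f := fun a => (g a).1.1) (measurable_pi_iff.2 fun t => (hg t).fst)
  have h2 : Measurable fun a => (g a).2 :=
    Measurable.subtype_mk (f := fun a => (g a).2.1) (measurable_pi_iff.2 fun t => (hg t).snd)
  exact h1.prodMk h2

lemma measurable_shift (s : ℝ≥0) : Measurable (shift s : Path S p → Path S p) :=
  measurable_path_of_measurable_Z fun t => measurable_Z (s + t)

lemma measurableSpace_path_eq_iSup_comap :
    (inferInstance : MeasurableSpace (Path S p)) =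
      ⨆ t, MeasurableSpace.comap (Z t : Path S p → S × Obs p) inferInstance := by
  refine le_antisymm ?_ (iSup_le fun t => (measurable_Z t).comap_le)
  have h : Measurable[⨆ t, MeasurableSpace.comap (Z t : Path S p → S × Obs p) inferInstance]
      (id : Path S p → Path S p) :=
    @measurable_path_of_measurable_Z _ _ _ _ _ (_) _ fun t =>
      (comap_measurable (Z t : Path S p → S × Obs p)).mono
        (le_iSup (fun t => MeasurableSpace.comap (Z t : Path S p → S × Obs p) inferInstance) t)
        le_rfl
  intro A hA
  exact h hA

lemma jointSigma_le (t : ℝ≥0) : jointSigma S p t ≤ (inferInstance : MeasurableSpace (Path S p)) :=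
  iSup₂_le fun s _ => (measurable_Z s).comap_le

lemma jointSigma_mono {s t : ℝ≥0} (h : s ≤ t) : jointSigma S p s ≤ jointSigma S p t :=
  iSup₂_le fun r hr => le_iSup₂_of_le r (hr.trans h) le_rfl

lemma measurable_Z_jointSigma {s t : ℝ≥0} (h : s ≤ t) :
    Measurable[jointSigma S p t] (Z s : Path S p → S × Obs p) :=
  (comap_measurable (Z s : Path S p → S × Obs p)).mono (le_iSup₂_of_le s h le_rfl) le_rfl

lemma obsSigma_le_jointSigma (t : ℝ≥0) : obsSigma S p t ≤ jointSigma S p t :=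
  iSup₂_le fun s hs => by
    have h : Measurable[jointSigma S p t] (Y s : Path S p → Obs p) :=
      measurable_snd.comp (measurable_Z_jointSigma hs)
    exact h.comap_le

end Shift

/-! ### A class of functions stable under products and Feller semigroups. -/

section NonnegC0

variable {S : Type*} [TopologicalSpace S] {p : ℕ}

/-- Nonnegative functions vanishing at infinity, with values in `[0, ∞]`. -/
def IsNonnegC0 (φ : S × Obs p → ENNReal) : Prop :=
  ∃ u : C₀(S × Obs p, ℝ), (∀ z, 0 ≤ u z) ∧ ∀ z, φ z = ENNReal.ofReal (u z)

lemma IsNonnegC0.mul {φ φ' : S × Obs p → ENNReal} (h : IsNonnegC0 φ) (h' : IsNonnegC0 φ') :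
    IsNonnegC0 fun z => φ z * φ' z := by
  obtain ⟨u, hu, hφ⟩ := h
  obtain ⟨u', hu', hφ'⟩ := h'
  refine ⟨u * u', fun z => mul_nonneg (hu z) (hu' z), fun z => ?_⟩
  simp only [hφ, hφ']
  rw [ZeroAtInftyContinuousMap.mul_apply, ENNReal.ofReal_mul (hu z)]

end NonnegC0

section LIntegral

lemma lintegral_mul_eq_of_forall_setLIntegral_eq {Ω : Type*} {m m0 : MeasurableSpace Ω}
    (hm : m ≤ m0) {P : Measure[m0] Ω} {g₁ g₂ : Ω → ENNReal} (h₁ : Measurable[m0] g₁)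
    (h₂ : Measurable[m0] g₂)
    (h : ∀ B, MeasurableSet[m] B → ∫⁻ ω in B, g₁ ω ∂P = ∫⁻ ω in B, g₂ ω ∂P) {ψ : Ω → ENNReal}
    (hψ : Measurable[m] ψ) : ∫⁻ ω, ψ ω * g₁ ω ∂P = ∫⁻ ω, ψ ω * g₂ ω ∂P := by
  have key : ∀ g : Ω → ENNReal, Measurable[m0] g →
      ∫⁻ ω, ψ ω * g ω ∂P = ∫⁻ ω, ψ ω ∂((P.withDensity g).trim hm) := fun g hg => by
    rw [lintegral_trim hm hψ, lintegral_withDensity_eq_lintegral_mul _ hg (hψ.mono hm le_rfl)]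
    simp only [Pi.mul_apply, mul_comm]
  have heq : (P.withDensity g₁).trim hm = (P.withDensity g₂).trim hm := by
    refine @Measure.ext _ m _ _ fun B hB => ?_
    rw [trim_measurableSet_eq hm hB, trim_measurableSet_eq hm hB, withDensity_apply _ (hm B hB),
      withDensity_apply _ (hm B hB), h B hB]
  rw [key g₁ h₁, key g₂ h₂, heq]

end LIntegral

/-! ### The Markov property on path space. -/

namespace Model

variable {S : Type*} [TopologicalSpace S] [MeasurableSpace S] {p : ℕ} (M : Model S p)

instance (z : S × Obs p) : IsProbabilityMeasure (M.law z) := by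
  have := M.law_prob
  infer_instance

instance (t : ℝ≥0) : IsMarkovKernel (M.trans t) := M.feller.markov t

lemma lintegral_comp_Z_zero (z : S × Obs p) {φ : S × Obs p → ENNReal} (hφ : Measurable φ) :
    ∫⁻ ω, φ (Z 0 ω) ∂(M.law z) = φ z := by
  rw [← lintegral_map hφ (measurable_Z 0), M.law_init, lintegral_dirac' _ hφ]

lemma measure_inter_preimage_Z (z : S × Obs p) (s r : ℝ≥0) {B : Set (Path S p)}
    (hB : MeasurableSet[jointSigma S p s] B) {A : Set (S × Obs p)} (hA : MeasurableSet A) :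
    M.law z (B ∩ Z (s + r) ⁻¹' A) = ∫⁻ ω in B, M.trans r (Z s ω) A ∂(M.law z) := by
  have hB0 := jointSigma_le s B hB
  have hpre : MeasurableSet (Z (s + r) ⁻¹' A : Set (Path S p)) := measurable_Z _ hA
  have h1 : ∫ ω in B, (Z (s + r) ⁻¹' A).indicator (fun _ => (1 : ℝ)) ω ∂(M.law z) =
      ∫ ω in B, (M.trans r (Z s ω)).real A ∂(M.law z) := by
    rw [← setIntegral_condExp (jointSigma_le s)
      ((integrable_const (1 : ℝ)).indicator hpre) hB]
    exact integral_congr_ae (ae_restrict_of_ae (M.law_markov z s r A hA))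
  have hmeas : Measurable fun ω : Path S p => M.trans r (Z s ω) A :=
    (Kernel.measurable_coe _ hA).comp (measurable_Z s)
  have h2 : ∫ ω in B, (M.trans r (Z s ω)).real A ∂(M.law z) =
      (∫⁻ ω in B, M.trans r (Z s ω) A ∂(M.law z)).toReal :=
    integral_toReal hmeas.aemeasurable (ae_of_all _ fun ω => measure_lt_top _ _)
  rw [h2, integral_indicator hpre, setIntegral_const, smul_eq_mul, mul_one, measureReal_def,
    Measure.restrict_apply hpre, ENNReal.toReal_eq_toReal_iff' (measure_ne_top _ _)] at h1
  · rw [← h1, Set.inter_comm]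
  · refine ne_of_lt ?_
    calc ∫⁻ ω in B, M.trans r (Z s ω) A ∂(M.law z) ≤ ∫⁻ _ in B, 1 ∂(M.law z) :=
          lintegral_mono fun ω => prob_le_one
      _ < ⊤ := by simp

lemma lintegral_mul_comp_Z (z : S × Obs p) (s r : ℝ≥0) {φ : S × Obs p → ENNReal}
    (hφ : Measurable φ) {ψ : Path S p → ENNReal} (hψ : Measurable[jointSigma S p s] ψ) :
    ∫⁻ ω, ψ ω * φ (Z (s + r) ω) ∂(M.law z) =
      ∫⁻ ω, ψ ω * (∫⁻ w, φ w ∂(M.trans r (Z s ω))) ∂(M.law z) := by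
  refine lintegral_mul_eq_of_forall_setLIntegral_eq (jointSigma_le s)
    (hφ.comp (measurable_Z _)) (hφ.lintegral_kernel.comp (measurable_Z s)) (fun B hB => ?_) hψ
  have h : ((M.law z).restrict B).map (Z (s + r)) =
      (((M.law z).restrict B).map (Z s)).bind (M.trans r) := by
    refine Measure.ext fun A hA => ?_
    rw [Measure.map_apply (measurable_Z _) hA, Measure.restrict_apply (measurable_Z _ hA),
      Measure.bind_apply hA (Kernel.aemeasurable _),
      lintegral_map (Kernel.measurable_coe _ hA) (measurable_Z s), Set.inter_comm,
      M.measure_inter_preimage_Z z s r hB hA]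
  simp only [Function.comp_apply]
  rw [← lintegral_map hφ (measurable_Z _), h,
    Measure.lintegral_bind (Kernel.aemeasurable _) hφ.aemeasurable,
    lintegral_map hφ.lintegral_kernel (measurable_Z s)]

variable [OpensMeasurableSpace (S × Obs p)]

lemma integrable_zeroAtInfty (u : C₀(S × Obs p, ℝ)) (ν : Measure (S × Obs p)) [IsFiniteMeasure ν] :
    Integrable u ν := by
  refine Integrable.of_bound u.continuous.measurable.aestronglyMeasurable
    ‖u.toBCF‖ (ae_of_all _ fun z => u.toBCF.norm_coe_le_norm z)

lemma isNonnegC0_lintegral_trans {φ : S × Obs p → ENNReal} (h : IsNonnegC0 φ) (r : ℝ≥0) :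
    IsNonnegC0 fun z => ∫⁻ w, φ w ∂(M.trans r z) := by
  obtain ⟨u, hu, hφ⟩ := h
  obtain ⟨g, hg⟩ := M.feller.feller r u
  refine ⟨g, fun z => ?_, fun z => ?_⟩
  · rw [hg]
    exact integral_nonneg hu
  · rw [hg, ofReal_integral_eq_lintegral_ofReal (integrable_zeroAtInfty u _) (ae_of_all _ hu)]
    simp only [hφ]

end Model

namespace Model

variable {S : Type*} [TopologicalSpace S] [MeasurableSpace S] {p : ℕ} (M : Model S p)
  [OpensMeasurableSpace (S × Obs p)]

/-- The Markov property for products of functions of the state at finitely many times. -/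
lemma exists_finiteDim_kernel {φ : ℝ≥0 → S × Obs p → ENNReal} (hφ : ∀ t, Measurable (φ t))
    (I : Finset ℝ≥0) : ∀ s, (∀ t ∈ I, s ≤ t) → ∃ H : S × Obs p → ENNReal, Measurable H ∧
      (I = ∅ → H = fun _ => 1) ∧ ((∀ t, IsNonnegC0 (φ t)) → I.Nonempty → IsNonnegC0 H) ∧
      ∀ (c : ℝ≥0) (z : S × Obs p) (ψ : Path S p → ENNReal), Measurable[jointSigma S p (c + s)] ψ →
        ∫⁻ ω, ψ ω * ∏ t ∈ I, φ t (Z (c + t) ω) ∂(M.law z) =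
          ∫⁻ ω, ψ ω * H (Z (c + s) ω) ∂(M.law z) := by
  induction I using Finset.induction_on_min with
  | empty => exact fun s _ => ⟨fun _ => 1, measurable_const, fun _ => rfl, fun _ h => absurd h (by simp),
      fun c z ψ _ => by simp⟩
  | insert a I ha ih =>
    intro s hs
    obtain ⟨H, hH, hH1, hH0, hHI⟩ := ih a fun t ht => (ha t ht).le
    have hsa : s ≤ a := hs a (Finset.mem_insert_self a I)
    have hmeas : Measurable fun w => φ a w * H w := (hφ a).mul hH
    -- Backward recursion: `H` carries the times after `a`. Multiply by `φ a` and apply the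
    -- transition kernel from `s` to `a`.
    refine ⟨fun z => ∫⁻ w, φ a w * H w ∂(M.trans (a - s) z), hmeas.lintegral_kernel,
      fun h => absurd h (Finset.insert_ne_empty a I), fun h0 _ => ?_, fun c z ψ hψ => ?_⟩
    · refine M.isNonnegC0_lintegral_trans ?_ _
      -- For an empty remainder `H` is the constant 1, which need not vanish at infinity, so `φ a`
      -- alone must supply the decay.
      rcases I.eq_empty_or_nonempty with hI | hI
      · rw [hH1 hI]
        simpa using h0 a
      · exact (h0 a).mul (hH0 h0 hI)
    · have hna : a ∉ I := fun h => lt_irrefl a (ha a h)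
      have h1 : c + a = c + s + (a - s) := by rw [add_assoc, add_tsub_cancel_of_le hsa]
      have h2 := hHI c z (fun ω => ψ ω * φ a (Z (c + a) ω))
        ((hψ.mono (jointSigma_mono (by gcongr)) le_rfl).mul
          ((hφ a).comp (measurable_Z_jointSigma le_rfl)))
      have h3 := M.lintegral_mul_comp_Z z (c + s) (a - s) hmeas hψ
      rw [← h3, ← h1]
      simp only [Finset.prod_insert hna, ← mul_assoc]
      rw [h2]

lemma lintegral_mul_prod_comp_Z {φ : ℝ≥0 → S × Obs p → ENNReal} (hφ : ∀ t, Measurable (φ t))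
    (I : Finset ℝ≥0) (s : ℝ≥0) (z : S × Obs p) {ψ : Path S p → ENNReal}
    (hψ : Measurable[jointSigma S p s] ψ) :
    ∫⁻ ω, ψ ω * ∏ t ∈ I, φ t (Z (s + t) ω) ∂(M.law z) =
      ∫⁻ ω, ψ ω * (∫⁻ ω', ∏ t ∈ I, φ t (Z t ω') ∂(M.law (Z s ω))) ∂(M.law z) := by
  obtain ⟨H, hH, -, -, hHI⟩ := M.exists_finiteDim_kernel hφ I 0 fun t _ => zero_le
  have h1 : ∀ z, ∫⁻ ω', ∏ t ∈ I, φ t (Z t ω') ∂(M.law z) = H z := fun z => by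
    have := hHI 0 z (fun _ => 1) measurable_const
    simp only [one_mul, zero_add] at this
    rw [this, M.lintegral_comp_Z_zero z hH]
  have h2 := hHI s z ψ (by rwa [add_zero])
  simp only [add_zero] at h2
  rw [h2]
  simp only [h1]

lemma isNonnegC0_lintegral_prod {φ : ℝ≥0 → S × Obs p → ENNReal} (hφ : ∀ t, IsNonnegC0 (φ t))
    {I : Finset ℝ≥0} (hI : I.Nonempty) :
    IsNonnegC0 fun z => ∫⁻ ω, ∏ t ∈ I, φ t (Z t ω) ∂(M.law z) := by
  have hφm : ∀ t, Measurable (φ t) := fun t => by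
    obtain ⟨u, -, hu⟩ := hφ t
    rw [funext hu]
    exact u.continuous.measurable.ennreal_ofReal
  obtain ⟨H, hH, -, hH0, hHI⟩ := M.exists_finiteDim_kernel hφm I 0 fun t _ => zero_le
  have h1 : (fun z => ∫⁻ ω, ∏ t ∈ I, φ t (Z t ω) ∂(M.law z)) = H := funext fun z => by
    have := hHI 0 z (fun _ => 1) measurable_const
    simp only [one_mul, zero_add] at this
    rw [this, M.lintegral_comp_Z_zero z hH]
  rw [h1]
  exact hH0 hφ hI

/-- The Markov property at time `s`, under the law `P_z`. -/
theorem measure_inter_preimage_shift (z : S × Obs p) (s : ℝ≥0) {B : Set (Path S p)}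
    (hB : MeasurableSet[jointSigma S p s] B) {A : Set (Path S p)} (hA : MeasurableSet A) :
    M.law z (B ∩ shift s ⁻¹' A) = ∫⁻ ω in B, M.law (Z s ω) A ∂(M.law z) := by
  have hB0 := jointSigma_le s B hB
  -- Both sides are finite measures, so agreement on finite-dimensional cylinders suffices.
  have h : ((M.law z).restrict B).map (shift s) =
      (((M.law z).restrict B).map (Z s)).bind M.law := by
    have happ : ∀ A, MeasurableSet A → (((M.law z).restrict B).map (Z s)).bind M.law A =
        ∫⁻ ω in B, M.law (Z s ω) A ∂(M.law z) := fun A hA => by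
      rw [Measure.bind_apply hA (Kernel.aemeasurable _),
        lintegral_map (Kernel.measurable_coe _ hA) (measurable_Z s)]
    have happ' : ∀ A, MeasurableSet A → ((M.law z).restrict B).map (shift s) A =
        M.law z (shift s ⁻¹' A ∩ B) := fun A hA => by
      rw [Measure.map_apply (measurable_shift s) hA,
        Measure.restrict_apply (measurable_shift s hA)]
    have hgen : (inferInstance : MeasurableSpace (Path S p)) = MeasurableSpace.generateFrom
        (piiUnionInter (fun t => {A | MeasurableSet[MeasurableSpace.comap
          (Z t : Path S p → S × Obs p) inferInstance] A}) Set.univ) := by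
      rw [measurableSpace_path_eq_iSup_comap]
      refine Eq.trans ?_ (generateFrom_piiUnionInter_measurableSet _ _).symm
      simp
    refine ext_of_generate_finite _ hgen (isPiSystem_piiUnionInter _
      (fun t => @MeasurableSpace.isPiSystem_measurableSet _ (_)) _) ?_ ?_
    · rintro _ ⟨I, -, E, hE, rfl⟩
      have : ∀ t, ∃ F : Set (S × Obs p), MeasurableSet F ∧ (t ∈ I → Z t ⁻¹' F = E t) := fun t => by
        by_cases ht : t ∈ I
        · obtain ⟨F, hF, h⟩ := hE t ht
          exact ⟨F, hF, fun _ => h⟩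
        · exact ⟨∅, .empty, fun h => absurd h ht⟩
      choose F hF hFE using this
      have hcyl : (⋂ t ∈ I, E t) = ⋂ t ∈ I, (Z t ⁻¹' F t : Set (Path S p)) :=
        Set.iInter₂_congr fun t ht => (hFE t ht).symm
      have hcm : MeasurableSet (⋂ t ∈ I, (Z t ⁻¹' F t : Set (Path S p))) :=
        I.measurableSet_biInter fun t _ => measurable_Z t (hF t)
      have hprod : ∀ ω : Path S p, ∏ t ∈ I, (F t).indicator (1 : S × Obs p → ENNReal) (Z t ω) =
          (⋂ t ∈ I, (Z t ⁻¹' F t : Set (Path S p))).indicator 1 ω := fun ω => by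
        by_cases hω : ω ∈ ⋂ t ∈ I, (Z t ⁻¹' F t : Set (Path S p))
        · rw [Set.indicator_of_mem hω]
          refine Finset.prod_eq_one fun t ht => ?_
          exact Set.indicator_of_mem (s := F t) (Set.mem_iInter₂.1 hω t ht) _
        · rw [Set.indicator_of_notMem hω]
          simp only [Set.mem_iInter, not_forall] at hω
          obtain ⟨t, ht, h⟩ := hω
          exact Finset.prod_eq_zero ht (Set.indicator_of_notMem (s := F t) h _)
      rw [hcyl, happ _ hcm, happ' _ hcm]
      have key := M.lintegral_mul_prod_comp_Z
        (φ := fun t => (F t).indicator 1) (fun t => measurable_one.indicator (hF t)) I s z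
        (ψ := B.indicator 1) (@Measurable.indicator _ _ (_) _ _ _ _ (@measurable_const _ _ _ (_) 1) hB)
      simp only [hprod, lintegral_indicator_one hcm] at key
      have hl : ∀ ω, B.indicator (1 : Path S p → ENNReal) ω *
          ∏ t ∈ I, (F t).indicator 1 (Z (s + t) ω) =
          (shift s ⁻¹' (⋂ t ∈ I, (Z t ⁻¹' F t : Set (Path S p))) ∩ B).indicator 1 ω := fun ω => by
        have := hprod (shift s ω)
        simp only [Z_shift] at this
        rw [this, Set.inter_indicator_one, mul_comm]
        rfl
      have hr : ∀ ω, B.indicator (1 : Path S p → ENNReal) ω *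
          M.law (Z s ω) (⋂ t ∈ I, (Z t ⁻¹' F t : Set (Path S p))) =
          B.indicator (fun ω => M.law (Z s ω) (⋂ t ∈ I, (Z t ⁻¹' F t : Set (Path S p)))) ω :=
        fun ω => by by_cases h : ω ∈ B <;> simp [h]
      simp only [hl, hr] at key
      rwa [lintegral_indicator_one ((measurable_shift s hcm).inter hB0),
        lintegral_indicator hB0] at key
    · rw [happ _ .univ, happ' _ .univ]
      simp
  have := congrArg (fun ν => ν A) h
  rw [Measure.map_apply (measurable_shift s) hA, Measure.restrict_apply (measurable_shift s hA),
    Measure.bind_apply hA (Kernel.aemeasurable _),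
    lintegral_map (Kernel.measurable_coe _ hA) (measurable_Z s)] at this
  rw [Set.inter_comm, this]

end Model

lemma integral_bind_kernel {α β : Type*} [MeasurableSpace α] [MeasurableSpace β] {μ : Measure α}
    [IsFiniteMeasure μ] {κ : Kernel α β} [IsMarkovKernel κ] {ξ : β → ℝ} (hξ : Measurable ξ)
    {C : ℝ} (hC : ∀ b, |ξ b| ≤ C) : ∫ b, ξ b ∂(μ.bind κ) = ∫ a, ∫ b, ξ b ∂(κ a) ∂μ := by
  rw [← Measure.snd_compProd, Measure.snd, integral_map measurable_snd.aemeasurable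
    hξ.aestronglyMeasurable, Measure.integral_compProd]
  exact Integrable.of_bound (hξ.comp measurable_snd).aestronglyMeasurable C
    (ae_of_all _ fun z => hC z.2)

namespace Model

variable {S : Type*} [TopologicalSpace S] [MeasurableSpace S] {p : ℕ} (M : Model S p)

instance : IsMarkovKernel M.law := M.law_prob

instance (ρ : Measure (S × Obs p)) [IsProbabilityMeasure ρ] :
    IsProbabilityMeasure (M.lawFrom ρ) := by
  unfold lawFrom
  infer_instance

instance (μ : Measure S) [IsProbabilityMeasure μ] : IsProbabilityMeasure (M.P μ) := by
  unfold P
  infer_instance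

section Markov

variable [OpensMeasurableSpace (S × Obs p)] {ρ : Measure (S × Obs p)}

lemma lawFrom_inter_preimage_shift (s : ℝ≥0) {B : Set (Path S p)}
    (hB : MeasurableSet[jointSigma S p s] B) {A : Set (Path S p)} (hA : MeasurableSet A) :
    M.lawFrom ρ (B ∩ shift s ⁻¹' A) = ∫⁻ ω in B, M.law (Z s ω) A ∂(M.lawFrom ρ) := by
  have hB0 := jointSigma_le s B hB
  have hm : Measurable fun ω : Path S p => M.law (Z s ω) A :=
    (Kernel.measurable_coe _ hA).comp (measurable_Z s)
  rw [lawFrom, Measure.bind_apply (hB0.inter (measurable_shift s hA)) (Kernel.aemeasurable _),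
    ← lintegral_indicator hB0, Measure.lintegral_bind (Kernel.aemeasurable _)
      (hm.indicator hB0).aemeasurable]
  refine lintegral_congr fun z => ?_
  rw [lintegral_indicator hB0, M.measure_inter_preimage_shift z s hB hA]

/-- The Markov property at time `s`, under the law `P_ρ`. -/
theorem setIntegral_comp_shift [IsProbabilityMeasure ρ] (s : ℝ≥0) {B : Set (Path S p)}
    (hB : MeasurableSet[jointSigma S p s] B) {ξ : Path S p → ℝ} (hξ : Measurable ξ) {C : ℝ}
    (hC : ∀ ω, |ξ ω| ≤ C) :
    ∫ ω in B, ξ (shift s ω) ∂(M.lawFrom ρ) =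
      ∫ ω in B, (∫ ω', ξ ω' ∂(M.law (Z s ω))) ∂(M.lawFrom ρ) := by
  have h : ((M.lawFrom ρ).restrict B).map (shift s) =
      (((M.lawFrom ρ).restrict B).map (Z s)).bind M.law := by
    refine Measure.ext fun A hA => ?_
    rw [Measure.map_apply (measurable_shift s) hA, Measure.restrict_apply (measurable_shift s hA),
      Measure.bind_apply hA (Kernel.aemeasurable _),
      lintegral_map (Kernel.measurable_coe _ hA) (measurable_Z s), Set.inter_comm,
      M.lawFrom_inter_preimage_shift s hB hA]
  rw [← integral_map (measurable_shift s).aemeasurable hξ.aestronglyMeasurable, h,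
    integral_bind_kernel hξ hC, integral_map (measurable_Z s).aemeasurable]
  exact (hξ.stronglyMeasurable.integral_kernel (κ := M.law)).aestronglyMeasurable

end Markov

/-! ### The completed laws and the augmented observation filtration. -/

section Completion

lemma le_complete (m : MeasurableSpace (Path S p)) : m ≤ M.complete m :=
  le_iInf fun _ => le_eventuallyMeasurableSpace

lemma le_fullSigma : (inferInstance : MeasurableSpace (Path S p)) ≤ M.fullSigma :=
  M.le_complete _

variable (ρ : ProbabilityMeasure (S × Obs p))

lemma lawBar_apply {A : Set (Path S p)} (hA : MeasurableSet[M.fullSigma] A) :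
    M.lawBar ρ A = M.lawFrom (ρ : Measure (S × Obs p)) A :=
  @toMeasure_apply _ M.fullSigma _ _ _ hA

lemma lawBar_trim : (M.lawBar ρ).trim M.le_fullSigma = M.lawFrom (ρ : Measure (S × Obs p)) :=
  Measure.ext fun A hA => by
    rw [trim_measurableSet_eq M.le_fullSigma hA, M.lawBar_apply ρ (M.le_fullSigma A hA)]

/-- The extension to the completed σ-algebra creates no new null sets, so almost sure statements
move freely between the two measures. -/
lemma ae_lawBar_iff {q : Path S p → Prop} :
    (∀ᵐ ω ∂(M.lawBar ρ), q ω) ↔ ∀ᵐ ω ∂(M.lawFrom (ρ : Measure (S × Obs p))), q ω := by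
  constructor
  · intro h
    exact measure_mono_null le_rfl (le_antisymm ((@le_toMeasure_apply _ M.fullSigma _
      (M.fullSigma_le_caratheodory ρ) _).trans_eq h) zero_le)
  · intro h
    rw [← M.lawBar_trim ρ] at h
    exact ae_of_ae_trim M.le_fullSigma h

lemma ae_lawBar_initLaw (μ : Measure S) [IsProbabilityMeasure μ] :
    ae (M.lawBar (initLaw p μ)) = ae (M.P μ) :=
  Filter.ext fun _ => M.ae_lawBar_iff (initLaw p μ)

instance : IsProbabilityMeasure (M.lawBar ρ) :=
  ⟨by rw [M.lawBar_apply ρ .univ]; exact measure_univ⟩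

lemma exists_ae_eq_of_measurableSet_complete {m : MeasurableSpace (Path S p)} {A : Set (Path S p)}
    (hA : MeasurableSet[M.complete m] A) :
    ∃ B, MeasurableSet[m] B ∧ A =ᵐ[M.lawBar ρ] B := by
  obtain ⟨B, hB, hAB⟩ := iInf_le (fun ρ : ProbabilityMeasure (S × Obs p) =>
    eventuallyMeasurableSpace m (ae (M.lawFrom (ρ : Measure (S × Obs p))))) ρ A hA
  exact ⟨B, hB, (M.ae_lawBar_iff ρ).2 hAB⟩

lemma setIntegral_lawBar {B : Set (Path S p)} (hB : MeasurableSet B) {ξ : Path S p → ℝ}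
    (hξ : Measurable ξ) :
    ∫ ω in B, ξ ω ∂(M.lawBar ρ) = ∫ ω in B, ξ ω ∂(M.lawFrom (ρ : Measure (S × Obs p))) := by
  rw [setIntegral_trim M.le_fullSigma hξ.stronglyMeasurable hB, M.lawBar_trim]

lemma measurableSet_complete_of_obsFiltration {s t : ℝ≥0} (hst : t < s) {A : Set (Path S p)}
    (hA : MeasurableSet[M.obsFiltration t] A) : MeasurableSet[M.complete (obsSigma S p s)] A :=
  iInf₂_le (f := fun s (_ : s > t) => M.complete (obsSigma S p s)) s hst A hA

lemma obsFiltration_rightCont (t : ℝ≥0) :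
    ⨅ s > t, (M.obsFiltration s : MeasurableSpace (Path S p)) ≤ M.obsFiltration t := by
  refine le_iInf₂ fun s (hs : t < s) => ?_
  obtain ⟨r, hr, hrs⟩ := exists_between hs
  exact (iInf₂_le r hr).trans (iInf₂_le s hrs)

lemma obsSigma_le_obsFiltration (t : ℝ≥0) : obsSigma S p t ≤ M.obsFiltration t :=
  le_iInf₂ fun s (hs : t < s) => le_trans (iSup₂_le fun r hr =>
    le_iSup₂_of_le r (hr.trans hs.le) le_rfl) (M.le_complete (obsSigma S p s))

/-- A bound on integrals over the observed events just after time `t` passes, by right continuity,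
to the augmented filtration. -/
lemma abs_setIntegral_lawBar_le {W : ℝ≥0 → Path S p → ℝ} (hW : ∀ t, Measurable (W t)) {C : ℝ}
    (hC : ∀ t ω, |W t ω| ≤ C)
    (hright : ∀ ω t, ContinuousWithinAt (fun t => W t ω) (Set.Ioi t) t) {δ : ℝ}
    (h : ∀ s B, MeasurableSet[obsSigma S p s] B →
      |∫ ω in B, W s ω ∂(M.lawFrom (ρ : Measure (S × Obs p)))| ≤
        δ * (M.lawFrom (ρ : Measure (S × Obs p))).real B)
    (t : ℝ≥0) {A : Set (Path S p)} (hA : MeasurableSet[M.obsFiltration t] A) :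
    |∫ ω in A, W t ω ∂(M.lawBar ρ)| ≤ δ * (M.lawBar ρ).real A := by
  -- At any later time `s`, the event `A` agrees up to a null set with an event of the raw σ-algebra
  -- `obsSigma S p s`, where `h` applies. Then `s` decreases to `t`.
  have hs : ∀ s, t < s → |∫ ω in A, W s ω ∂(M.lawBar ρ)| ≤ δ * (M.lawBar ρ).real A := by
    intro s hts
    obtain ⟨B, hB, hAB⟩ := M.exists_ae_eq_of_measurableSet_complete ρ
      (M.measurableSet_complete_of_obsFiltration hts hA)
    have hB0 := obsSigma_le s B hB
    have hreal : (M.lawBar ρ).real A = (M.lawFrom (ρ : Measure (S × Obs p))).real B := by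
      rw [measureReal_def, measure_congr hAB, M.lawBar_apply ρ (M.le_fullSigma B hB0)]
      rfl
    rw [setIntegral_congr_set hAB, M.setIntegral_lawBar ρ hB0 (hW s), hreal]
    exact h s B hB
  have hlim : Tendsto (fun n : ℕ => t + 1 / ((n : ℝ≥0) + 1)) atTop (𝓝[>] t) := by
    refine tendsto_nhdsWithin_iff.2 ⟨?_, .of_forall fun n => lt_add_of_pos_right t (by positivity)⟩
    simpa using (tendsto_one_div_add_atTop_nhds_zero_nat (𝕜 := ℝ≥0)).const_add t
  have hint : Tendsto (fun n : ℕ => ∫ ω in A, W (t + 1 / ((n : ℝ≥0) + 1)) ω ∂(M.lawBar ρ)) atTop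
      (𝓝 (∫ ω in A, W t ω ∂(M.lawBar ρ))) :=
    tendsto_integral_of_dominated_convergence (fun _ => C)
      (fun n => ((hW _).mono M.le_fullSigma le_rfl).aestronglyMeasurable) (integrable_const _)
      (fun n => ae_of_all _ fun ω => hC _ ω)
      (ae_of_all _ fun ω => (hright ω t).tendsto.comp hlim)
  exact le_of_tendsto hint.abs (.of_forall fun n => hs _ (lt_add_of_pos_right t (by positivity)))

end Completion

/-! ### Domination and absolute continuity of the path laws. -/

section Domination

lemma lawBar_le_smul {μ ν : Measure S} [IsProbabilityMeasure μ] [IsProbabilityMeasure ν] {c : ℝ≥0}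
    (h : μ ≤ c • ν) : M.lawBar (initLaw p μ) ≤ c • M.lawBar (initLaw p ν) := by
  have h1 : μ.prod (Measure.dirac (0 : Obs p)) ≤ c • ν.prod (Measure.dirac 0) := by
    rw [← Measure.prod_smul_left]
    exact Measure.prod_mono h le_rfl
  refine Measure.le_iff.2 fun A hA => ?_
  rw [Measure.smul_apply, M.lawBar_apply _ hA, M.lawBar_apply _ hA]
  have h2 : M.P μ ≤ c • M.P ν := by
    refine Measure.le_iff.2 fun A hA => ?_
    rw [Measure.smul_apply, P, P, lawFrom, lawFrom, Measure.bind_apply hA (Kernel.aemeasurable _),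
      Measure.bind_apply hA (Kernel.aemeasurable _), ← lintegral_smul_measure]
    exact lintegral_mono' h1 le_rfl
  exact h2 A

lemma P_absolutelyContinuous {μ ν : Measure S} [IsProbabilityMeasure μ] [IsProbabilityMeasure ν]
    (h : μ ≪ ν) : M.P μ ≪ M.P ν := by
  have h1 : μ.prod (Measure.dirac (0 : Obs p)) ≪ ν.prod (Measure.dirac 0) := h.prod .rfl
  refine Measure.AbsolutelyContinuous.mk fun A hA h0 => ?_
  rw [P, lawFrom, Measure.bind_apply hA (Kernel.aemeasurable _),
    lintegral_eq_zero_iff (Kernel.measurable_coe _ hA)] at h0 ⊢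
  exact h1.ae_le h0

-- Both comparisons of initial laws have passed through the common mixing kernel `law`.
end Domination

end Model

/-! ### Test functions on the product state space. -/

section Tensor

variable {S : Type*} [TopologicalSpace S] [CompactSpace S] {p : ℕ}

/-- The function `(x, y) ↦ f x * v y`, for `f` continuous on a compact space and `v` vanishing at
infinity. -/
def tensorC0 (f : S →ᵇ ℝ) (v : C₀(Obs p, ℝ)) : C₀(S × Obs p, ℝ) where
  toFun z := f z.1 * v z.2
  continuous_toFun := (f.continuous.comp continuous_fst).mul (v.continuous.comp continuous_snd)
  zero_at_infty' := by
    have h1 : Tendsto (Prod.snd : S × Obs p → Obs p) (cocompact (S × Obs p)) (cocompact (Obs p)) :=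
      (isProperMap_iff_tendsto_cocompact.1 isProperMap_snd_of_compactSpace).2
    have h2 : Tendsto (fun z : S × Obs p => ‖f‖ * |v z.2|) (cocompact (S × Obs p)) (𝓝 0) := by
      simpa using ((v.zero_at_infty'.comp h1).abs).const_mul ‖f‖
    refine squeeze_zero_norm (fun z => ?_) h2
    rw [norm_mul]
    exact mul_le_mul_of_nonneg_right (f.norm_coe_le_norm z.1) (norm_nonneg _)

@[simp] lemma tensorC0_apply (f : S →ᵇ ℝ) (v : C₀(Obs p, ℝ)) (z : S × Obs p) :
    tensorC0 f v z = f z.1 * v z.2 := rfl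

/-- Functions of the signal alone need not vanish at infinity on `S × ℝᵖ`. Multiplying by such a `u`
brings them within reach of the Feller property. -/
lemma exists_cutoff (p : ℕ) : ∃ u : C₀(Obs p, ℝ), u 0 = 1 ∧ ∀ y, 0 ≤ u y ∧ u y ≤ 1 := by
  refine ⟨⟨⟨fun y => max 0 (1 - ‖y‖), by fun_prop⟩, ?_⟩, ?_, fun y => ⟨le_max_left _ _, ?_⟩⟩
  · refine tendsto_const_nhds.congr' ?_
    filter_upwards [(tendsto_norm_cocompact_atTop (E := Obs p)).eventually_ge_atTop 1] with y hy
    exact (max_eq_left (by linarith)).symm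
  · show max 0 (1 - ‖(0 : Obs p)‖) = 1
    simp
  · show max 0 (1 - ‖y‖) ≤ 1
    exact max_le zero_le_one (by linarith [norm_nonneg y])

end Tensor

lemma measurable_bcf {S : Type*} [TopologicalSpace S] [MeasurableSpace S] [OpensMeasurableSpace S]
    (f : S →ᵇ ℝ) : Measurable f := f.continuous.measurable

/-! ### Continuity of the signal semigroup and existence of càdlàg filters. -/

namespace Model

section Transition

variable {S : Type*} [TopologicalSpace S] [MeasurableSpace S] {p : ℕ} (M : Model S p)

lemma law_map_Z (z : S × Obs p) (r : ℝ≥0) : (M.law z).map (Z r) = M.trans r z := by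
  refine Measure.ext fun A hA => ?_
  have h1 := M.measure_inter_preimage_Z z 0 r (B := Set.univ) .univ hA
  rw [Set.univ_inter, zero_add, setLIntegral_univ,
    M.lintegral_comp_Z_zero z (Kernel.measurable_coe _ hA)] at h1
  rw [Measure.map_apply (measurable_Z r) hA, h1]

lemma integral_comp_X (f : S → ℝ) (hf : Measurable f) (z : S × Obs p) (r : ℝ≥0) :
    ∫ ω, f (X r ω) ∂(M.law z) = ∫ w, f w.1 ∂(M.trans r z) := by
  have hm : Measurable fun w : S × Obs p => f w.1 := hf.comp measurable_fst
  rw [← M.law_map_Z z r, integral_map (measurable_Z r).aemeasurable hm.aestronglyMeasurable]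
  rfl

lemma integral_comp_X_eq (f : S → ℝ) (hf : Measurable f) {C : ℝ} (hC : ∀ x, |f x| ≤ C) (r : ℝ≥0)
    (x : S) (y y' : Obs p) :
    ∫ ω, f (X r ω) ∂(M.law (x, y)) = ∫ ω, f (X r ω) ∂(M.law (x, y')) := by
  refine M.cond_indep_increments _ (hf.comp ?_) ⟨C, fun ω => hC _⟩ x y y'
  exact (comap_measurable (X r : Path S p → S)).mono
    ((le_iSup (fun t => MeasurableSpace.comap (X t : Path S p → S) inferInstance) r).trans
      le_sup_left) le_rfl

end Transition

variable {S : Type*} [TopologicalSpace S] [CompactSpace S] [MeasurableSpace S] [BorelSpace S]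
  {p : ℕ} (M : Model S p)

/-- The semigroup of the signal is uniformly strongly continuous at time zero. -/
lemma exists_forall_abs_integral_comp_X_sub_le (f : S →ᵇ ℝ) {δ : ℝ} (hδ : 0 < δ) :
    ∃ ε : ℝ≥0, 0 < ε ∧ ∀ r ≤ ε, ∀ z : S × Obs p,
      |∫ ω, f (X r ω) ∂(M.law z) - f z.1| ≤ δ := by
  obtain ⟨u, hu0, hu⟩ := exists_cutoff p
  have hf0 : 0 ≤ ‖f‖ := norm_nonneg f
  set δ' : ℝ := δ / (‖f‖ + 1) with hδ'
  have hδ'0 : 0 < δ' := by positivity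
  -- Strong continuity is used for `f ⊗ u` and for `1 ⊗ u`, at `y = 0` where `u = 1`. The second
  -- shows that replacing `f` by `f ⊗ u` costs at most `‖f‖ * δ'`, for a total error `(‖f‖ + 1) * δ'
  -- = δ`.
  have h1 := Metric.tendstoUniformly_iff.1 (M.feller.continuous_zero (tensorC0 f u)) δ' hδ'0
  have h2 := Metric.tendstoUniformly_iff.1
    (M.feller.continuous_zero (tensorC0 (BoundedContinuousFunction.const S 1) u)) δ' hδ'0
  obtain ⟨ε, hε, hball⟩ := Metric.eventually_nhds_iff.1 (h1.and h2)
  refine ⟨(ε / 2).toNNReal, Real.toNNReal_pos.2 (by positivity), fun r hr => ?_⟩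
  have hr' : dist r 0 < ε := by
    have h3 : (r : ℝ) ≤ ε / 2 := by
      have := NNReal.coe_le_coe.2 hr
      rwa [Real.coe_toNNReal _ (by positivity)] at this
    rw [NNReal.dist_eq, NNReal.coe_zero, sub_zero, abs_of_nonneg r.coe_nonneg]
    linarith
  obtain ⟨h3, h4⟩ := hball hr'
  have key : ∀ x : S, |∫ ω, f (X r ω) ∂(M.law (x, 0)) - f x| ≤ δ := by
    intro x
    have h5 := h3 (x, 0)
    have h6 := h4 (x, 0)
    simp only [tensorC0_apply, hu0, mul_one, BoundedContinuousFunction.const_apply, one_mul,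
      Real.dist_eq] at h5 h6
    rw [M.integral_comp_X f (measurable_bcf f)]
    set κ := M.trans r (x, (0 : Obs p)) with hκ
    have hum : Measurable fun w : S × Obs p => u w.2 := u.continuous.measurable.comp measurable_snd
    have hfm : Measurable fun w : S × Obs p => f w.1 := (measurable_bcf f).comp measurable_fst
    have hui : Integrable (fun w : S × Obs p => u w.2) κ :=
      integrable_of_forall_abs_le hum (C := 1) fun w => by
        rw [abs_of_nonneg (hu _).1]; exact (hu _).2
    have hfi : Integrable (fun w : S × Obs p => f w.1) κ :=
      integrable_of_forall_abs_le hfm fun w => f.norm_coe_le_norm w.1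
    have hfui : Integrable (fun w : S × Obs p => f w.1 * u w.2) κ :=
      integrable_of_forall_abs_le (hfm.mul hum) (C := ‖f‖) fun w => by
        rw [abs_mul, abs_of_nonneg (hu _).1]
        exact (mul_le_of_le_one_right (abs_nonneg _) (hu _).2).trans (f.norm_coe_le_norm w.1)
    have h7 : |∫ w, (f w.1 - f w.1 * u w.2) ∂κ| ≤ ‖f‖ * ∫ w, (1 - u w.2) ∂κ := by
      rw [← integral_const_mul]
      refine (abs_integral_le_integral_abs).trans (integral_mono_of_nonneg
        (ae_of_all _ fun w => abs_nonneg _) (((integrable_const _).sub hui).const_mul _)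
        (ae_of_all _ fun w => ?_))
      have h8 : f w.1 - f w.1 * u w.2 = f w.1 * (1 - u w.2) := by ring
      simp only
      rw [h8, abs_mul, abs_of_nonneg (sub_nonneg.2 (hu w.2).2)]
      exact mul_le_mul_of_nonneg_right (f.norm_coe_le_norm w.1) (sub_nonneg.2 (hu w.2).2)
    rw [integral_sub hfi hfui, integral_sub (integrable_const _) hui] at h7
    simp only [integral_const, probReal_univ, smul_eq_mul, one_mul] at h7
    have h9 : ‖f‖ * (1 - ∫ w, u w.2 ∂κ) ≤ ‖f‖ * δ' :=
      mul_le_mul_of_nonneg_left ((le_abs_self _).trans h6.le) hf0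
    have h10 : ‖f‖ * δ' + δ' = δ := by rw [hδ']; field_simp
    have h11 := abs_le.1 (h7.trans h9)
    have h12 := abs_lt.1 h5
    rw [abs_le]
    constructor <;> linarith [h11.1, h11.2, h12.1, h12.2]
  rintro ⟨x, y⟩
  -- The law of the signal does not depend on the starting observation, so the estimate at `y = 0`
  -- is uniform in `y`.
  rw [M.integral_comp_X_eq f (measurable_bcf f) (fun x => f.norm_coe_le_norm x) r x y 0]
  exact key x

/-- The filter of a continuous function of the signal has a càdlàg version. -/
theorem exists_isFilter (μ : Measure S) [IsProbabilityMeasure μ] (f : S →ᵇ ℝ) :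
    ∃ π, M.IsFilter μ f π := by
  have hfX : ∀ t, Measurable fun ω : Path S p => f (X t ω) := fun t =>
    (measurable_bcf f).comp (measurable_X t)
  have hfC : ∀ t (ω : Path S p), |f (X t ω)| ≤ ‖f‖ := fun t ω => f.norm_coe_le_norm _
  have hright : ∀ (r : ℝ≥0) (ω : Path S p) t,
      ContinuousWithinAt (fun t => f (X (t + r) ω)) (Set.Ioi t) t := fun r ω t => by
    have h1 := ((ω.1.2.shift r) t).1.mono Set.Ioi_subset_Ici_self
    have h2 := f.continuous.continuousAt.comp_continuousWithinAt h1
    simp only [Function.comp_def, add_comm r] at h2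
    exact h2
  -- On raw observed events the Markov property turns the increment over time `r` into the semigroup
  -- error at `Z s`. Right continuity transfers the bound to the augmented filtration.
  have hslow : ∀ δ > 0, ∃ ε : ℝ≥0, 0 < ε ∧ ∀ t A, MeasurableSet[M.obsFiltration t] A → ∀ r ≤ ε,
      |∫ ω in A, f (X (t + r) ω) ∂(M.lawBar (initLaw p μ)) -
        ∫ ω in A, f (X t ω) ∂(M.lawBar (initLaw p μ))| ≤ δ * (M.lawBar (initLaw p μ)).real A := by
    intro δ hδ
    obtain ⟨ε, hε, h⟩ := M.exists_forall_abs_integral_comp_X_sub_le f hδ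
    refine ⟨ε, hε, fun t A hA r hr => ?_⟩
    have hint : ∀ t, Integrable (fun ω : Path S p => f (X t ω)) (M.lawBar (initLaw p μ)) := fun t =>
      integrable_of_forall_abs_le ((hfX t).mono M.le_fullSigma le_rfl) (hfC t)
    rw [← integral_sub (hint _).integrableOn (hint _).integrableOn]
    refine M.abs_setIntegral_lawBar_le (initLaw p μ) (W := fun t ω => f (X (t + r) ω) - f (X t ω))
      (fun t => (hfX _).sub (hfX _)) (C := ‖f‖ + ‖f‖)
      (fun t ω => (abs_sub _ _).trans (add_le_add (hfC _ _) (hfC _ _)))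
      (fun ω t => (hright r ω t).sub (by simpa using hright 0 ω t)) (fun s B hB => ?_) t hA
    set ρ : Measure (S × Obs p) := ↑(initLaw p μ) with hρ
    have hi : ∀ t, Integrable (fun ω : Path S p => f (X t ω)) (M.lawFrom ρ) := fun t =>
      integrable_of_forall_abs_le (hfX t) (hfC t)
    have hm : StronglyMeasurable fun ω : Path S p => ∫ ω', f (X r ω') ∂(M.law (Z s ω)) :=
      ((hfX r).stronglyMeasurable.integral_kernel (κ := M.law)).comp_measurable (measurable_Z s)
    have hi2 : Integrable (fun ω : Path S p => ∫ ω', f (X r ω') ∂(M.law (Z s ω))) (M.lawFrom ρ) := by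
      refine integrable_of_forall_abs_le hm.measurable (C := ‖f‖) fun ω => ?_
      have := norm_integral_le_of_norm_le_const (μ := M.law (Z s ω))
        (f := fun ω' : Path S p => f (X r ω')) (ae_of_all _ fun ω' => hfC r ω')
      simpa using this
    have hmk : ∫ ω in B, f (X (s + r) ω) ∂(M.lawFrom ρ) =
        ∫ ω in B, (∫ ω', f (X r ω') ∂(M.law (Z s ω))) ∂(M.lawFrom ρ) :=
      M.setIntegral_comp_shift s (obsSigma_le_jointSigma s B hB) (hfX r) (hfC r)
    rw [integral_sub (hi _).integrableOn (hi _).integrableOn, hmk,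
      ← integral_sub hi2.integrableOn (hi _).integrableOn]
    have := norm_setIntegral_le_of_norm_le_const (μ := M.lawFrom ρ) (s := B) (C := δ)
      (f := fun ω => (∫ ω', f (X r ω') ∂(M.law (Z s ω))) - f (X s ω)) (measure_lt_top _ _)
      fun ω _ => h r hr (Z s ω)
    exact this
  obtain ⟨π, h1, h2⟩ := exists_cadlag_condExp_of_small_increments (P := M.lawBar (initLaw p μ))
    (G := M.obsFiltration) (Z := fun t ω => f (X t ω)) M.obsFiltration_rightCont
    (fun t => (hfX t).mono M.le_fullSigma le_rfl) hfC
    (fun ω t => by simpa using hright 0 ω t) hslow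
  rw [ae_lawBar_initLaw] at h1
  simp only [ae_lawBar_initLaw] at h2
  exact ⟨π, h1, h2⟩

end Model

/-! ### Functionals of the observation increments. -/

section Increments

variable {S : Type*} [TopologicalSpace S] {p : ℕ}

/-- Products of functions of the increments `Y_t - Y_0` of the observations. -/
def incrProd (I : Finset ℝ≥0) (v : ℝ≥0 → C₀(Obs p, ℝ)) (ω : Path S p) : ℝ :=
  ∏ t ∈ I, v t (Y t ω - Y 0 ω)

lemma abs_prod_le (I : Finset ℝ≥0) (v : ℝ≥0 → C₀(Obs p, ℝ)) (y : ℝ≥0 → Obs p) :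
    |∏ t ∈ I, v t (y t)| ≤ ∏ t ∈ I, ‖(v t).toBCF‖ := by
  rw [Finset.abs_prod]
  exact Finset.prod_le_prod (fun _ _ => abs_nonneg _) fun t _ => (v t).toBCF.norm_coe_le_norm _

lemma measurable_incrProd_incrSigmaTop (I : Finset ℝ≥0) (v : ℝ≥0 → C₀(Obs p, ℝ)) :
    Measurable[incrSigmaTop S p] (incrProd I v : Path S p → ℝ) := by
  refine Finset.measurable_fun_prod I fun t _ => (v t).continuous.measurable.comp ?_
  exact (comap_measurable (fun ω : Path S p => Y t ω - Y 0 ω)).mono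
    (le_iSup (fun t => MeasurableSpace.comap (fun ω : Path S p => Y t ω - Y 0 ω) inferInstance) t)
    le_rfl

lemma continuousWithinAt_incrProd_shift (I : Finset ℝ≥0) (v : ℝ≥0 → C₀(Obs p, ℝ)) (ω : Path S p)
    (t : ℝ≥0) : ContinuousWithinAt (fun t => incrProd I v (shift t ω)) (Set.Ioi t) t := by
  have hY : ∀ r : ℝ≥0, ContinuousWithinAt (fun t => Y (t + r) ω) (Set.Ioi t) t := fun r => by
    have h := ((ω.2.2.shift r) t).1.mono Set.Ioi_subset_Ici_self
    simp only [add_comm r] at h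
    exact h
  refine tendsto_finsetProd I fun r _ => ?_
  exact (v r).continuous.continuousAt.comp_continuousWithinAt ((hY r).sub (hY 0))

variable [MeasurableSpace S]

lemma measurable_incrProd (I : Finset ℝ≥0) (v : ℝ≥0 → C₀(Obs p, ℝ)) :
    Measurable (incrProd I v : Path S p → ℝ) := by
  refine Finset.measurable_fun_prod I fun t _ => (v t).continuous.measurable.comp ?_
  exact (measurable_Y t).sub (measurable_Y 0)

end Increments

/-! ### Test functions: prediction and merging. -/

namespace Model

section

variable {S : Type*} [TopologicalSpace S] [MeasurableSpace S] {p : ℕ} (M : Model S p)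

lemma measurable_incrProd_shift (I : Finset ℝ≥0) (v : ℝ≥0 → C₀(Obs p, ℝ)) (t : ℝ≥0) :
    Measurable[⨆ t, M.obsFiltration t] fun ω : Path S p => incrProd I v (shift t ω) := by
  have hY : ∀ s, Measurable[⨆ t, M.obsFiltration t] (Y s : Path S p → Obs p) := fun s =>
    (measurable_Y_obsSigma le_rfl).mono ((M.obsSigma_le_obsFiltration s).trans
      (le_iSup (fun t => (M.obsFiltration t : MeasurableSpace (Path S p))) s)) le_rfl
  refine Finset.measurable_fun_prod I fun r _ => (v r).continuous.measurable.comp ?_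
  exact (hY (t + r)).sub (hY (t + 0))

lemma ae_Y_zero (x : S) : ∀ᵐ ω ∂(M.law (x, 0)), Y 0 ω = 0 := by
  have h : ∀ᵐ w ∂((M.law (x, 0)).map (Z 0)), w.2 = 0 := by
    rw [M.law_init]
    exact (ae_dirac_iff (p := fun w : S × Obs p => w.2 = 0)
      (measurable_snd (measurableSet_singleton 0))).2 rfl
  exact ae_of_ae_map (measurable_Z 0).aemeasurable h

lemma integral_incrProd_eq (I : Finset ℝ≥0) (v : ℝ≥0 → C₀(Obs p, ℝ)) (x : S) :
    ∫ ω, incrProd I v ω ∂(M.law (x, 0)) = ∫ ω, ∏ t ∈ I, v t (Y t ω) ∂(M.law (x, 0)) := by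
  refine integral_congr_ae ?_
  filter_upwards [M.ae_Y_zero x] with ω hω
  simp only [incrProd, hω, sub_zero]

variable [BorelSpace S]

/-- Predicting an observable functional of the signal amounts to predicting the increments of the
observations. -/
lemma condExp_comp_X_ae_eq {h : S →ᵇ ℝ} {I : Finset ℝ≥0} {v : ℝ≥0 → C₀(Obs p, ℝ)}
    (hh : ∀ x y, ∫ ω, incrProd I v ω ∂(M.law (x, y)) = h x) (ρ : ProbabilityMeasure (S × Obs p))
    (t : ℝ≥0) :
    (M.lawBar ρ)[fun ω => h (X t ω) | M.obsFiltration t] =ᵐ[M.lawBar ρ]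
      (M.lawBar ρ)[fun ω => incrProd I v (shift t ω) | M.obsFiltration t] := by
  set C := ∏ t ∈ I, ‖(v t).toBCF‖ with hC
  have hm : ∀ t, Measurable fun ω : Path S p => incrProd I v (shift t ω) := fun t =>
    (measurable_incrProd I v).comp (measurable_shift t)
  have hb : ∀ ω : Path S p, |incrProd I v ω| ≤ C := fun ω =>
    abs_prod_le I v fun t => Y t ω - Y 0 ω
  have hhm : ∀ t, Measurable fun ω : Path S p => h (X t ω) := fun t =>
    (measurable_bcf h).comp (measurable_X t)
  have hhb : ∀ t (ω : Path S p), |h (X t ω)| ≤ ‖h‖ := fun t ω => h.norm_coe_le_norm _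
  have hi1 : Integrable (fun ω => h (X t ω)) (M.lawBar ρ) :=
    integrable_of_forall_abs_le ((hhm t).mono M.le_fullSigma le_rfl) (hhb t)
  have hi2 : Integrable (fun ω => incrProd I v (shift t ω)) (M.lawBar ρ) :=
    integrable_of_forall_abs_le ((hm t).mono M.le_fullSigma le_rfl) fun ω => hb _
  -- Equality of conditional expectations is obtained as the case `δ = 0` of the transfer bound.
  have hset : ∀ A, MeasurableSet[M.obsFiltration t] A →
      |∫ ω in A, (h (X t ω) - incrProd I v (shift t ω)) ∂(M.lawBar ρ)| ≤
        0 * (M.lawBar ρ).real A := by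
    intro A hA
    refine M.abs_setIntegral_lawBar_le ρ
      (W := fun t ω => h (X t ω) - incrProd I v (shift t ω)) (fun t => (hhm t).sub (hm t))
      (C := ‖h‖ + C) (fun t ω => (abs_sub _ _).trans (add_le_add (hhb _ _) (hb _)))
      (fun ω t => ?_) (fun s B hB => ?_) t hA
    · refine ContinuousWithinAt.sub ?_ (continuousWithinAt_incrProd_shift I v ω t)
      exact h.continuous.continuousAt.comp_continuousWithinAt
        ((ω.1.2 t).1.mono Set.Ioi_subset_Ici_self)
    · have h1 := M.setIntegral_comp_shift (ρ := (ρ : Measure (S × Obs p))) s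
        (obsSigma_le_jointSigma s B hB) (measurable_incrProd I v) hb
      have h2 : ∀ ω : Path S p, ∫ ω', incrProd I v ω' ∂(M.law (Z s ω)) = h (X s ω) :=
        fun ω => hh _ _
      simp only [h2] at h1
      rw [integral_sub (integrable_of_forall_abs_le (hhm s) (hhb s)).integrableOn
        (integrable_of_forall_abs_le (hm s) fun ω => hb _).integrableOn, h1, sub_self, abs_zero,
        zero_mul]
  have hzero := ae_abs_condExp_le_of_forall_setIntegral (M.obsFiltration.le t) (hi1.sub hi2) hset
  filter_upwards [hzero, condExp_sub hi1 hi2 (M.obsFiltration t)] with ω h1 h2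
  rw [h2, Pi.sub_apply] at h1
  exact sub_eq_zero.1 (abs_nonpos_iff.1 h1)

end

variable {S : Type*} [TopologicalSpace S] [MeasurableSpace S] [BorelSpace S]
  {p : ℕ} (M : Model S p)

/-- Functions of the form `x ↦ E_x[∏ v_t(Y_t - Y_0)]`, for nonnegative functions `v_t` vanishing at
infinity. -/
def IsTestFunction (h : S →ᵇ ℝ) : Prop :=
  ∃ (I : Finset ℝ≥0) (v : ℝ≥0 → C₀(Obs p, ℝ)), (∀ t y, 0 ≤ v t y) ∧
    ∀ x y, ∫ ω, incrProd I v ω ∂(M.law (x, y)) = h x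

/-- Cylindrical functionals of the observation increments have continuous expectations. -/
lemma exists_integral_incrProd_eq [CompactSpace S] (I : Finset ℝ≥0) {v : ℝ≥0 → C₀(Obs p, ℝ)}
    (hv : ∀ t y, 0 ≤ v t y) :
    ∃ h : S →ᵇ ℝ, ∀ x y, ∫ ω, incrProd I v ω ∂(M.law (x, y)) = h x := by
  have hy : ∀ x (y : Obs p), ∫ ω, incrProd I v ω ∂(M.law (x, y)) =
      ∫ ω, incrProd I v ω ∂(M.law (x, 0)) := fun x y =>
    M.cond_indep_increments _ ((measurable_incrProd_incrSigmaTop I v).mono le_sup_right le_rfl)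
      ⟨_, fun ω => abs_prod_le I v fun t => Y t ω - Y 0 ω⟩ x y 0
  rcases I.eq_empty_or_nonempty with rfl | hI
  · exact ⟨BoundedContinuousFunction.const S 1, fun x y => by simp [incrProd]⟩
  -- Started from `y = 0`, increments coincide with the observations themselves, so the continuous
  -- function of `(x, y)` given by the Feller property is needed only on the slice `y = 0`.
  obtain ⟨u, hu, hφ⟩ := M.isNonnegC0_lintegral_prod
    (φ := fun t z => ENNReal.ofReal (v t z.2))
    (fun t => ⟨tensorC0 (BoundedContinuousFunction.const S 1) (v t), fun z => by simp [hv],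
      fun z => by simp⟩) hI
  refine ⟨BoundedContinuousFunction.mkOfCompact ⟨fun x => u (x, 0), by fun_prop⟩, fun x y => ?_⟩
  rw [hy, M.integral_incrProd_eq, BoundedContinuousFunction.mkOfCompact_apply,
    ContinuousMap.coe_mk, ← ENNReal.toReal_ofReal (hu (x, 0)), ← hφ,
    integral_eq_lintegral_of_nonneg_ae (ae_of_all _ fun ω => Finset.prod_nonneg fun t _ => hv t _)]
  · refine congrArg ENNReal.toReal (lintegral_congr fun ω => ?_)
    exact ENNReal.ofReal_prod_of_nonneg fun t _ => hv t _
  · refine (Finset.measurable_fun_prod I fun t _ => ?_).aestronglyMeasurable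
    exact (v t).continuous.measurable.comp (measurable_Y t)

lemma IsTestFunction.ae_tendsto_of_le {h : S →ᵇ ℝ} (hh : M.IsTestFunction h) {μ ν : Measure S}
    [IsProbabilityMeasure μ] [IsProbabilityMeasure ν] {c : ℝ≥0} (hμν : μ ≤ c • ν) {D : Set ℝ≥0}
    (hD : D.Countable) :
    ∀ᵐ ω ∂(M.lawBar (initLaw p μ)), Tendsto (fun q =>
      (M.lawBar (initLaw p μ))[fun ω => h (X q ω) | M.obsFiltration q] ω -
      (M.lawBar (initLaw p ν))[fun ω => h (X q ω) | M.obsFiltration q] ω)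
      (atTop ⊓ 𝓟 D) (𝓝 0) := by
  obtain ⟨I, v, -, hv⟩ := hh
  have hle := M.lawBar_le_smul hμν
  have hac : M.lawBar (initLaw p μ) ≪ M.lawBar (initLaw p ν) :=
    (Measure.absolutelyContinuous_of_le hle).trans Measure.smul_absolutelyContinuous
  have h1 := ae_tendsto_condExp_sub_condExp (G := M.obsFiltration) hle hD
    (ξ := fun t ω => incrProd I v (shift t ω)) (M.measurable_incrProd_shift I v)
    (fun t ω => abs_prod_le I v fun r => Y r (shift t ω) - Y 0 (shift t ω))
  have h2 := (ae_ball_iff hD).2 fun q _ => M.condExp_comp_X_ae_eq hv (initLaw p μ) q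
  have h3 := hac.ae_le ((ae_ball_iff hD).2 fun q _ => M.condExp_comp_X_ae_eq hv (initLaw p ν) q)
  filter_upwards [h1, h2, h3] with ω h1 h2 h3
  refine h1.congr' ?_
  filter_upwards [mem_inf_of_right (mem_principal_self D)] with q hq
  rw [h2 q hq, h3 q hq]

/-- The density of `μ` with respect to `ν` may be unbounded, but both are at most twice their
midpoint `κ`. The filters for `μ` and `ν` each merge with that for `κ`, and `P^μ ≪ P^ν` lets both
statements hold `P^μ`-almost surely. -/
lemma IsTestFunction.ae_tendsto {h : S →ᵇ ℝ} (hh : M.IsTestFunction h) {μ ν : Measure S}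
    [IsProbabilityMeasure μ] [IsProbabilityMeasure ν] (hμν : μ ≪ ν) {D : Set ℝ≥0}
    (hD : D.Countable) :
    ∀ᵐ ω ∂(M.P μ), Tendsto (fun q =>
      (M.lawBar (initLaw p μ))[fun ω => h (X q ω) | M.obsFiltration q] ω -
      (M.lawBar (initLaw p ν))[fun ω => h (X q ω) | M.obsFiltration q] ω)
      (atTop ⊓ 𝓟 D) (𝓝 0) := by
  set κ : Measure S := (2 : ℝ≥0)⁻¹ • (μ + ν) with hκ
  have : IsProbabilityMeasure κ := ⟨by
    rw [hκ, Measure.smul_apply, Measure.add_apply, measure_univ, measure_univ, ENNReal.smul_def,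
      smul_eq_mul, one_add_one_eq_two, ENNReal.coe_inv two_ne_zero, ENNReal.coe_ofNat]
    exact ENNReal.inv_mul_cancel two_ne_zero ENNReal.ofNat_ne_top⟩
  have h2 : (2 : ℝ≥0) • κ = μ + ν := by rw [hκ, smul_smul, mul_inv_cancel₀ two_ne_zero, one_smul]
  have h3 := hh.ae_tendsto_of_le M (h2 ▸ Measure.le_add_right le_rfl : μ ≤ (2 : ℝ≥0) • κ) hD
  have h4 := hh.ae_tendsto_of_le M (h2 ▸ Measure.le_add_left le_rfl : ν ≤ (2 : ℝ≥0) • κ) hD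
  rw [ae_lawBar_initLaw] at h3 h4
  filter_upwards [h3, (M.P_absolutelyContinuous hμν).ae_le h4] with ω h5 h6
  have h7 := h5.sub h6
  rw [sub_zero] at h7
  exact h7.congr fun q => by ring

/-- The filters of the uniform limits of linear combinations of test functions merge along every
countable set of times. -/
theorem ae_tendsto_of_mem_closure_span {f : S →ᵇ ℝ}
    (hf : f ∈ (Submodule.span ℝ {h | M.IsTestFunction h}).topologicalClosure) {μ ν : Measure S}
    [IsProbabilityMeasure μ] [IsProbabilityMeasure ν] (hμν : μ ≪ ν) {D : Set ℝ≥0}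
    (hD : D.Countable) :
    ∀ᵐ ω ∂(M.P μ), Tendsto (fun q =>
      (M.lawBar (initLaw p μ))[fun ω => f (X q ω) | M.obsFiltration q] ω -
      (M.lawBar (initLaw p ν))[fun ω => f (X q ω) | M.obsFiltration q] ω)
      (atTop ⊓ 𝓟 D) (𝓝 0) := by
  have hint : ∀ (f : S →ᵇ ℝ) (ρ : ProbabilityMeasure (S × Obs p)) (t : ℝ≥0),
      Integrable (fun ω => f (X t ω)) (M.lawBar ρ) := fun f ρ t =>
    integrable_of_forall_abs_le (((measurable_bcf f).comp (measurable_X t)).mono M.le_fullSigma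
      le_rfl) fun ω => f.norm_coe_le_norm _
  have hac := M.P_absolutelyContinuous hμν
  have hspan : ∀ g ∈ Submodule.span ℝ {h | M.IsTestFunction h}, ∀ᵐ ω ∂(M.P μ),
      Tendsto (fun q =>
        (M.lawBar (initLaw p μ))[fun ω => g (X q ω) | M.obsFiltration q] ω -
        (M.lawBar (initLaw p ν))[fun ω => g (X q ω) | M.obsFiltration q] ω)
        (atTop ⊓ 𝓟 D) (𝓝 0) := by
    intro g hg
    induction hg using Submodule.span_induction with
    | mem h hh => exact IsTestFunction.ae_tendsto M hh hμν hD
    | zero =>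
      refine ae_of_all _ fun ω => ?_
      simp only [BoundedContinuousFunction.coe_zero, Pi.zero_apply]
      have : ∀ (ρ : ProbabilityMeasure (S × Obs p)) (q : ℝ≥0),
          (M.lawBar ρ)[fun _ => (0 : ℝ) | M.obsFiltration q] = 0 := fun ρ q => condExp_zero
      simpa [this] using tendsto_const_nhds
    | add g₁ g₂ _ _ h₁ h₂ =>
      have hadd : ∀ (ρ : Measure S) [IsProbabilityMeasure ρ], ∀ᵐ ω ∂(M.P ρ), ∀ q ∈ D,
          (M.lawBar (initLaw p ρ))[fun ω => (g₁ + g₂) (X q ω) | M.obsFiltration q] ω =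
          (M.lawBar (initLaw p ρ))[fun ω => g₁ (X q ω) | M.obsFiltration q] ω +
          (M.lawBar (initLaw p ρ))[fun ω => g₂ (X q ω) | M.obsFiltration q] ω := fun ρ _ => by
        rw [← ae_lawBar_initLaw]
        exact (ae_ball_iff hD).2 fun q _ => condExp_add (hint g₁ _ q) (hint g₂ _ q) _
      filter_upwards [h₁, h₂, hadd μ, hac.ae_le (hadd ν)] with ω h1 h2 h3 h4
      have h5 := h1.add h2
      rw [add_zero] at h5
      refine h5.congr' ?_
      filter_upwards [mem_inf_of_right (mem_principal_self D)] with q hq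
      rw [h3 q hq, h4 q hq]
      ring
    | smul a g _ h =>
      have hsmul : ∀ (ρ : Measure S) [IsProbabilityMeasure ρ], ∀ᵐ ω ∂(M.P ρ), ∀ q ∈ D,
          (M.lawBar (initLaw p ρ))[fun ω => (a • g) (X q ω) | M.obsFiltration q] ω =
          a * (M.lawBar (initLaw p ρ))[fun ω => g (X q ω) | M.obsFiltration q] ω := fun ρ _ => by
        rw [← ae_lawBar_initLaw]
        exact (ae_ball_iff hD).2 fun q _ => condExp_smul a (fun ω => g (X q ω)) _
      filter_upwards [h, hsmul μ, hac.ae_le (hsmul ν)] with ω h1 h3 h4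
      have h5 := h1.const_mul a
      rw [mul_zero] at h5
      refine h5.congr' ?_
      filter_upwards [mem_inf_of_right (mem_principal_self D)] with q hq
      rw [h3 q hq, h4 q hq]
      ring
  have happrox : ∀ n : ℕ, ∃ g ∈ Submodule.span ℝ {h | M.IsTestFunction h},
      ‖f - g‖ < 1 / ((n : ℝ) + 1) := fun n => by
    obtain ⟨g, hg, hfg⟩ := Metric.mem_closure_iff.1 hf (1 / ((n : ℝ) + 1)) (by positivity)
    exact ⟨g, hg, by rwa [← dist_eq_norm]⟩
  choose g hg hfg using happrox
  -- Conditional expectation contracts the uniform norm, so the error is uniform in time and the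
  -- same under both laws.
  have hdiff : ∀ (ρ : Measure S) [IsProbabilityMeasure ρ], ∀ᵐ ω ∂(M.P ρ), ∀ n : ℕ, ∀ q ∈ D,
      |(M.lawBar (initLaw p ρ))[fun ω => f (X q ω) | M.obsFiltration q] ω -
      (M.lawBar (initLaw p ρ))[fun ω => g n (X q ω) | M.obsFiltration q] ω| ≤
        1 / ((n : ℝ) + 1) := fun ρ _ => by
    rw [← ae_lawBar_initLaw]
    refine ae_all_iff.2 fun n => (ae_ball_iff hD).2 fun q _ => ?_
    have h1 := ae_abs_condExp_le (P := M.lawBar (initLaw p ρ)) (m := M.obsFiltration q)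
      (ξ := (fun ω => f (X q ω)) - fun ω => g n (X q ω)) (C := 1 / ((n : ℝ) + 1))
      (ae_of_all _ fun ω => ((f - g n).norm_coe_le_norm (X q ω)).trans (hfg n).le)
    filter_upwards [h1, condExp_sub (hint f (initLaw p ρ) q) (hint (g n) (initLaw p ρ) q)
      (M.obsFiltration q)] with ω h2 h3
    rwa [h3] at h2
  filter_upwards [ae_all_iff.2 fun n => hspan (g n) (hg n), hdiff μ, hac.ae_le (hdiff ν)]
    with ω h1 h2 h3
  rw [Metric.tendsto_nhds]
  intro ε hε
  obtain ⟨n, hn⟩ := ((tendsto_one_div_add_atTop_nhds_zero_nat (𝕜 := ℝ)).eventually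
    (gt_mem_nhds (show 0 < ε / 3 by positivity))).exists
  filter_upwards [Metric.tendsto_nhds.1 (h1 n) (ε / 3) (by positivity),
    mem_inf_of_right (mem_principal_self D)] with q hq hqD
  rw [Real.dist_eq, sub_zero, abs_lt] at hq ⊢
  have h4 := abs_le.1 (h2 n q hqD)
  have h5 := abs_le.1 (h3 n q hqD)
  constructor <;> linarith [hq.1, hq.2, h4.1, h4.2, h5.1, h5.2]

end Model

/-! ### Functionals on continuous functions. -/

section Duality

lemma exists_dual_eq_zero_of_notMem {E : Type*} [NormedAddCommGroup E] [NormedSpace ℝ E]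
    {K : Submodule ℝ E} (hK : IsClosed (K : Set E)) {x : E} (hx : x ∉ K) :
    ∃ φ : E →L[ℝ] ℝ, (∀ y ∈ K, φ y = 0) ∧ φ x ≠ 0 := by
  obtain ⟨φ, u, h1, h2⟩ := geometric_hahn_banach_closed_point K.convex hK hx
  have h0 : 0 < u := by simpa using h1 0 K.zero_mem
  refine ⟨φ, fun y hy => ?_, (h0.trans h2).ne'⟩
  by_contra hne
  -- A functional strictly below `u` on a subspace must vanish there: this multiple of `y` would
  -- take exactly the value `u`.
  have := h1 ((u / φ y) • y) (K.smul_mem _ hy)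
  rw [map_smul, smul_eq_mul, div_mul_cancel₀ _ hne] at this
  exact lt_irrefl _ this

variable {S : Type*} [TopologicalSpace S]

/-- Every bounded functional on bounded continuous functions is a difference of positive ones. -/
lemma exists_positive_decomposition [Nonempty S] (φ : (S →ᵇ ℝ) →L[ℝ] ℝ) :
    ∃ ψ₁ ψ₂ : (S →ᵇ ℝ) →ₗ[ℝ] ℝ, (∀ g, (∀ x, 0 ≤ g x) → 0 ≤ ψ₁ g) ∧
      (∀ g, (∀ x, 0 ≤ g x) → 0 ≤ ψ₂ g) ∧ ∀ g, φ g = ψ₁ g - ψ₂ g := by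
  obtain ⟨x₀⟩ := ‹Nonempty S›
  have hφ : 0 ≤ ‖φ‖ := φ.opNorm_nonneg
  -- The two positive parts are obtained together, by Hahn-Banach on pairs with the maximum norm. On
  -- pairs with constant sum, `Φ₀` is prescribed so that it equals `‖φ‖` at `(1, 1)` and `φ g` at
  -- `(g, -g)`. The parts are the restrictions of the extension to the two coordinates.
  let W : Submodule ℝ ((S →ᵇ ℝ) × (S →ᵇ ℝ)) :=
    { carrier := {w | ∀ x, w.1 x + w.2 x = w.1 x₀ + w.2 x₀}
      add_mem' := fun {u w} hu hw x => by
        have h1 := Set.mem_ofPred.1 hu x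
        have h2 := Set.mem_ofPred.1 hw x
        simp only [Prod.fst_add, Prod.snd_add, BoundedContinuousFunction.coe_add, Pi.add_apply]
        linarith
      zero_mem' := fun x => by simp
      smul_mem' := fun c w hw x => by
        have h1 := Set.mem_ofPred.1 hw x
        simp only [Prod.smul_fst, Prod.smul_snd, BoundedContinuousFunction.coe_smul, smul_eq_mul]
        rw [← mul_add, h1, mul_add] }
  let Φ₀ : (S →ᵇ ℝ) × (S →ᵇ ℝ) →ₗ[ℝ] ℝ :=
    { toFun := fun w => (w.1 x₀ + w.2 x₀) / 2 * ‖φ‖ + φ ((1 / 2 : ℝ) • (w.1 - w.2))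
      map_add' := fun u w => by
        have : (1 / 2 : ℝ) • ((u + w).1 - (u + w).2) =
            (1 / 2 : ℝ) • (u.1 - u.2) + (1 / 2 : ℝ) • (w.1 - w.2) := by
          rw [Prod.fst_add, Prod.snd_add]; module
        rw [this, map_add]
        simp only [Prod.fst_add, Prod.snd_add, BoundedContinuousFunction.coe_add, Pi.add_apply]
        ring
      map_smul' := fun c w => by
        have : (1 / 2 : ℝ) • ((c • w).1 - (c • w).2) = c • ((1 / 2 : ℝ) • (w.1 - w.2)) := by
          rw [Prod.smul_fst, Prod.smul_snd]; module
        rw [this, map_smul]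
        simp only [Prod.smul_fst, Prod.smul_snd, BoundedContinuousFunction.coe_smul, smul_eq_mul,
          RingHom.id_apply]
        ring }
  have hΦ₀ : ∀ w : (S →ᵇ ℝ) × (S →ᵇ ℝ), Φ₀ w = (w.1 x₀ + w.2 x₀) / 2 * ‖φ‖ + φ ((1 / 2 : ℝ) • (w.1 - w.2)) :=
    fun w => rfl
  have hbound : ∀ w : W, ‖(Φ₀ ∘ₗ W.subtype) w‖ ≤ ‖φ‖ * ‖w‖ := by
    rintro ⟨w, hw⟩
    have hw' : ∀ x, w.1 x + w.2 x = w.1 x₀ + w.2 x₀ := hw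
    set a := (w.1 x₀ + w.2 x₀) / 2 with ha
    have h1 : ∀ x, |w.1 x| ≤ ‖w‖ := fun x => (w.1.norm_coe_le_norm x).trans (norm_fst_le w)
    have h2 : ∀ x, |w.2 x| ≤ ‖w‖ := fun x => (w.2.norm_coe_le_norm x).trans (norm_snd_le w)
    -- With `d = (w.1 x - w.2 x) / 2` the two coordinates are `a + d` and `a - d`, and `|a| + |d|`
    -- is the larger of their absolute values.
    have h3 : ∀ x, |(w.1 x - w.2 x) / 2| ≤ ‖w‖ - |a| := by
      intro x
      have h4 := hw' x
      have h5 := abs_le.1 (h1 x)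
      have h6 := abs_le.1 (h2 x)
      rcases abs_cases a with ⟨h7, -⟩ | ⟨h7, -⟩ <;> rw [h7, abs_le] <;>
        constructor <;> linarith [h5.1, h5.2, h6.1, h6.2]
    have h8 : ‖(1 / 2 : ℝ) • (w.1 - w.2)‖ ≤ ‖w‖ - |a| := by
      refine (BoundedContinuousFunction.norm_le ((abs_nonneg _).trans (h3 x₀))).2 fun x => ?_
      have : ((1 / 2 : ℝ) • (w.1 - w.2)) x = (w.1 x - w.2 x) / 2 := by
        simp only [BoundedContinuousFunction.coe_smul, BoundedContinuousFunction.coe_sub,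
          Pi.sub_apply, smul_eq_mul]
        ring
      rw [this]
      exact h3 x
    have h9 : ‖φ ((1 / 2 : ℝ) • (w.1 - w.2))‖ ≤ ‖φ‖ * (‖w‖ - |a|) :=
      (φ.le_opNorm _).trans (mul_le_mul_of_nonneg_left h8 (norm_nonneg _))
    have h10 : ‖a * ‖φ‖‖ = |a| * ‖φ‖ := by
      rw [norm_mul, Real.norm_eq_abs, Real.norm_of_nonneg hφ]
    calc ‖a * ‖φ‖ + φ ((1 / 2 : ℝ) • (w.1 - w.2))‖ ≤ |a| * ‖φ‖ + ‖φ‖ * (‖w‖ - |a|) :=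
          (norm_add_le _ _).trans (add_le_add h10.le h9)
      _ = ‖φ‖ * ‖w‖ := by ring
  obtain ⟨Φ, hΦW, hΦn⟩ := exists_extension_norm_eq (𝕜 := ℝ) W
    ((Φ₀ ∘ₗ W.subtype).mkContinuous ‖φ‖ hbound)
  have hΦle : ‖Φ‖ ≤ ‖φ‖ := hΦn.trans_le (LinearMap.mkContinuous_norm_le _ hφ _)
  have hΦeq : ∀ w ∈ W, Φ w = Φ₀ w := fun w hw => hΦW ⟨w, hw⟩
  set e : S →ᵇ ℝ := BoundedContinuousFunction.const S 1 with he
  have hone : Φ (e, e) = ‖φ‖ := by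
    rw [hΦeq (e, e) (fun x => rfl), hΦ₀]
    simp [he]
  have hanti : ∀ g : S →ᵇ ℝ, Φ (g, -g) = φ g := fun g => by
    rw [hΦeq (g, -g) (fun x => by simp), hΦ₀]
    have : (1 / 2 : ℝ) • (g - -g) = g := by module
    simp only [this]
    simp
  -- A functional whose norm is attained at the order unit is positive: a nonnegative pair of norm
  -- `R` lies within `R` of `R • (e, e)`.
  have hpos : ∀ u w : S →ᵇ ℝ, (∀ x, 0 ≤ u x) → (∀ x, 0 ≤ w x) → 0 ≤ Φ (u, w) := by
    intro u w hu hw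
    set R := ‖((u, w) : (S →ᵇ ℝ) × (S →ᵇ ℝ))‖ with hR
    have hle : ∀ g : S →ᵇ ℝ, (∀ x, 0 ≤ g x) → ‖g‖ ≤ R → ‖R • e - g‖ ≤ R := fun g hg hgR => by
      refine (BoundedContinuousFunction.norm_le (norm_nonneg _)).2 fun x => ?_
      have h1 := (abs_le.1 ((g.norm_coe_le_norm x).trans hgR)).2
      have h2 : (R • e - g) x = R - g x := by simp [he]
      rw [h2, Real.norm_eq_abs, abs_le]
      constructor <;> linarith [hg x]
    have h3 : ‖R • ((e, e) : (S →ᵇ ℝ) × (S →ᵇ ℝ)) - (u, w)‖ ≤ R := by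
      rw [Prod.norm_def]
      exact max_le (hle u hu (norm_fst_le ((u, w) : (S →ᵇ ℝ) × (S →ᵇ ℝ))))
        (hle w hw (norm_snd_le ((u, w) : (S →ᵇ ℝ) × (S →ᵇ ℝ))))
    have h4 : Φ (R • ((e, e) : (S →ᵇ ℝ) × (S →ᵇ ℝ)) - (u, w)) ≤ ‖φ‖ * R :=
      (le_abs_self _).trans ((Φ.le_opNorm _).trans (mul_le_mul hΦle h3 (norm_nonneg _) hφ))
    rw [map_sub, map_smul, hone, smul_eq_mul] at h4
    linarith
  refine ⟨Φ.toLinearMap ∘ₗ LinearMap.inl ℝ (S →ᵇ ℝ) (S →ᵇ ℝ), Φ.toLinearMap ∘ₗ LinearMap.inr ℝ (S →ᵇ ℝ) (S →ᵇ ℝ),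
    fun g hg => hpos g 0 hg fun _ => le_rfl, fun g hg => hpos 0 g (fun _ => le_rfl) hg,
    fun g => ?_⟩
  rw [← hanti g]
  have : ((g, -g) : (S →ᵇ ℝ) × (S →ᵇ ℝ)) = LinearMap.inl ℝ (S →ᵇ ℝ) (S →ᵇ ℝ) g - LinearMap.inr ℝ (S →ᵇ ℝ) (S →ᵇ ℝ) g := by simp
  rw [this, map_sub]
  rfl

/-- The Riesz representation of a positive functional on continuous functions on a compact space. -/
lemma exists_measure_of_positive [CompactSpace S] [T2Space S] [MeasurableSpace S] [BorelSpace S]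
    (ψ : (S →ᵇ ℝ) →ₗ[ℝ] ℝ) (hψ : ∀ g, (∀ x, 0 ≤ g x) → 0 ≤ ψ g) :
    ∃ μ : Measure S, IsFiniteMeasure μ ∧ ∀ g : S →ᵇ ℝ, ∫ x, g x ∂μ = ψ g := by
  let ι : CompactlySupportedContinuousMap S ℝ →ₗ[ℝ] (S →ᵇ ℝ) :=
    { toFun := fun g => BoundedContinuousFunction.mkOfCompact g.toContinuousMap
      map_add' := fun _ _ => rfl
      map_smul' := fun _ _ => rfl }
  let Λ : CompactlySupportedContinuousMap S ℝ →ₚ[ℝ] ℝ := PositiveLinearMap.mk₀ (ψ ∘ₗ ι) fun g hg => hψ _ fun x => hg x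
  refine ⟨RealRMK.rieszMeasure Λ, inferInstance, fun g => ?_⟩
  exact RealRMK.integral_rieszMeasure Λ
    (⟨g.toContinuousMap, HasCompactSupport.of_compactSpace _⟩ : CompactlySupportedContinuousMap S ℝ)

end Duality

/-! ### Approximation of closed cylinders. -/

section Separation

/-- The standard continuous approximations of `F` are multiplied by cutoffs of radius `n + 1`, which
gives decay at infinity and tends to 1 pointwise. -/
lemma exists_tendsto_indicator_of_isClosed {p : ℕ} {F : Set (Obs p)} (hF : IsClosed F) :
    ∃ v : ℕ → C₀(Obs p, ℝ), (∀ n y, 0 ≤ v n y ∧ v n y ≤ 1) ∧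
      ∀ y, Tendsto (fun n => v n y) atTop (𝓝 (F.indicator 1 y)) := by
  have h1 : ∀ n y, (0 : ℝ) ≤ hF.apprSeq n y ∧ (hF.apprSeq n y : ℝ) ≤ 1 := fun n y =>
    ⟨NNReal.coe_nonneg _, by exact_mod_cast HasOuterApproxClosed.apprSeq_apply_le_one hF n y⟩
  have h2 : ∀ (n : ℕ) (y : Obs p), 0 ≤ max 0 (1 - ‖y‖ / (n + 1)) ∧
      max 0 (1 - ‖y‖ / (n + 1)) ≤ 1 := fun n y =>
    ⟨le_max_left _ _, max_le zero_le_one (by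
      have : 0 ≤ ‖y‖ / ((n : ℝ) + 1) := by positivity
      linarith)⟩
  refine ⟨fun n => ⟨⟨fun y => hF.apprSeq n y * max 0 (1 - ‖y‖ / (n + 1)), ?_⟩, ?_⟩,
    fun n y => ⟨mul_nonneg (h1 n y).1 (h2 n y).1,
      mul_le_one₀ (h1 n y).2 (h2 n y).1 (h2 n y).2⟩, fun y => ?_⟩
  · have := (hF.apprSeq n).continuous
    fun_prop
  · refine tendsto_const_nhds.congr' ?_
    filter_upwards [(tendsto_norm_cocompact_atTop (E := Obs p)).eventually_ge_atTop
      ((n : ℝ) + 1)] with y hy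
    have h3 : (1 : ℝ) ≤ ‖y‖ / (n + 1) := (one_le_div (by positivity)).2 hy
    show 0 = (hF.apprSeq n y : ℝ) * max 0 (1 - ‖y‖ / (n + 1))
    rw [max_eq_left (by linarith), mul_zero]
  · have h3 : Tendsto (fun n => (hF.apprSeq n y : ℝ)) atTop (𝓝 (F.indicator 1 y)) := by
      have h4 := (NNReal.continuous_coe.tendsto _).comp
        (tendsto_pi_nhds.1 (HasOuterApproxClosed.tendsto_apprSeq hF) y)
      have h5 : F.indicator 1 y = ((F.indicator (fun _ => (1 : ℝ≥0)) y : ℝ≥0) : ℝ) := by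
        by_cases hy : y ∈ F
        · rw [Set.indicator_of_mem hy, Set.indicator_of_mem hy]
          rfl
        · rw [Set.indicator_of_notMem hy, Set.indicator_of_notMem hy]
          rfl
      rw [h5]
      exact h4
    have h4 : Tendsto (fun n : ℕ => max 0 (1 - ‖y‖ / ((n : ℝ) + 1))) atTop (𝓝 1) := by
      have h5 : Tendsto (fun n : ℕ => ‖y‖ / ((n : ℝ) + 1)) atTop (𝓝 0) :=
        tendsto_const_nhds.div_atTop
          (tendsto_atTop_add_const_right _ _ tendsto_natCast_atTop_atTop)
      have h6 := (tendsto_const_nhds (x := (0 : ℝ))).max ((tendsto_const_nhds (x := (1 : ℝ))).sub h5)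
      simpa using h6
    have h5 := h3.mul h4
    rw [mul_one] at h5
    exact h5

/-- The observation σ-algebra is generated by the closed cylinders. -/
lemma obsSigmaTop_le_generateFrom {S : Type*} [TopologicalSpace S] {p : ℕ} :
    obsSigmaTop S p ≤ MeasurableSpace.generateFrom
      (piiUnionInter (fun t : ℝ≥0 => {A : Set (Path S p) | ∃ F, IsClosed F ∧ Y t ⁻¹' F = A})
        Set.univ) := by
  refine iSup_le fun t => iSup₂_le fun s _ => ?_
  have h1 : (inferInstance : MeasurableSpace (Obs p)) =
      MeasurableSpace.generateFrom {F | IsClosed F} := by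
    rw [← borel_eq_generateFrom_isClosed]
    exact BorelSpace.measurable_eq
  rw [h1, MeasurableSpace.comap_generateFrom]
  refine MeasurableSpace.generateFrom_mono ?_
  rintro A ⟨F, hF, rfl⟩
  exact subset_piiUnionInter (Set.mem_univ s) ⟨F, hF, rfl⟩

end Separation

/-! ### Observable functions lie in the closed span of test functions. -/

namespace Model

variable {S : Type*} [TopologicalSpace S] [MeasurableSpace S] {p : ℕ} (M : Model S p)

lemma integral_prod_Y_eq (ν : Measure S) [IsProbabilityMeasure ν] {I : Finset ℝ≥0}
    {v : ℝ≥0 → C₀(Obs p, ℝ)} {h : S → ℝ}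
    (hv : ∀ x y, ∫ ω, incrProd I v ω ∂(M.law (x, y)) = h x) :
    ∫ ω, ∏ t ∈ I, v t (Y t ω) ∂(M.P ν) = ∫ x, h x ∂ν := by
  have hm : Measurable fun ω : Path S p => ∏ t ∈ I, v t (Y t ω) :=
    Finset.measurable_fun_prod I fun t _ => (v t).continuous.measurable.comp (measurable_Y t)
  have h1 := integral_bind_kernel (μ := ν.prod (Measure.dirac (0 : Obs p))) (κ := M.law) hm
    (fun ω => abs_prod_le I v fun t => Y t ω)
  have hm2 : Measurable fun z => ∫ ω, ∏ t ∈ I, v t (Y t ω) ∂(M.law z) :=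
    hm.stronglyMeasurable.integral_kernel.measurable
  rw [P, lawFrom, h1, Measure.prod_dirac,
    integral_map (by fun_prop) hm2.aestronglyMeasurable]
  exact integral_congr_ae (ae_of_all _ fun x => by
    simpa only [← M.integral_incrProd_eq I v x] using hv x 0)

/-- Probabilities of closed cylinders are limits of expectations of products of functions vanishing
at infinity, and these expectations are integrals of test functions. Closed cylinders form a
π-system generating the observations. -/
lemma obsEquiv_of_forall_integral_eq [CompactSpace S] [BorelSpace S] {ν₁ ν₂ : Measure S}
    [IsProbabilityMeasure ν₁] [IsProbabilityMeasure ν₂]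
    (h : ∀ g, M.IsTestFunction g → ∫ x, g x ∂ν₁ = ∫ x, g x ∂ν₂) : M.ObsEquiv ν₁ ν₂ := by
  have hcyl : ∀ (I : Finset ℝ≥0) (F : ℝ≥0 → Set (Obs p)), (∀ t, IsClosed (F t)) →
      (M.P ν₁) (⋂ t ∈ I, Y t ⁻¹' F t) = (M.P ν₂) (⋂ t ∈ I, Y t ⁻¹' F t) := by
    intro I F hF
    choose v hv01 hvlim using fun t => exists_tendsto_indicator_of_isClosed (hF t)
    have hms : MeasurableSet (⋂ t ∈ I, (Y t : Path S p → Obs p) ⁻¹' F t) :=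
      Finset.measurableSet_biInter I fun t _ => measurable_Y t (hF t).measurableSet
    have hlim : ∀ (ν : Measure S) [IsProbabilityMeasure ν],
        Tendsto (fun n => ∫ ω, ∏ t ∈ I, v t n (Y t ω) ∂(M.P ν)) atTop
          (𝓝 ((M.P ν).real (⋂ t ∈ I, Y t ⁻¹' F t))) := by
      intro ν _
      rw [← integral_indicator_one hms]
      refine tendsto_integral_of_dominated_convergence (fun _ => (1 : ℝ)) (fun n => ?_)
        (integrable_const _) (fun n => ae_of_all _ fun ω => ?_) (ae_of_all _ fun ω => ?_)
      · exact (Finset.measurable_fun_prod I fun t _ =>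
          (v t n).continuous.measurable.comp (measurable_Y t)).aestronglyMeasurable
      · rw [Real.norm_of_nonneg (Finset.prod_nonneg fun t _ => (hv01 t n _).1)]
        exact Finset.prod_le_one (fun t _ => (hv01 t n _).1) fun t _ => (hv01 t n _).2
      · have h1 : (⋂ t ∈ I, (Y t : Path S p → Obs p) ⁻¹' F t).indicator 1 ω =
            ∏ t ∈ I, (F t).indicator (1 : Obs p → ℝ) (Y t ω) := by
          by_cases hω : ω ∈ ⋂ t ∈ I, (Y t : Path S p → Obs p) ⁻¹' F t
          · rw [Set.indicator_of_mem hω, Finset.prod_eq_one fun t ht =>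
              Set.indicator_of_mem (s := F t) (Set.mem_iInter₂.1 hω t ht) _]
            rfl
          · rw [Set.indicator_of_notMem hω]
            rw [Set.mem_iInter₂] at hω
            push Not at hω
            obtain ⟨t, ht, htF⟩ := hω
            exact (Finset.prod_eq_zero ht (Set.indicator_of_notMem (s := F t) htF _)).symm
        rw [h1]
        exact tendsto_finsetProd I fun t _ => hvlim t _
    have heq : ∀ n, ∫ ω, ∏ t ∈ I, v t n (Y t ω) ∂(M.P ν₁) =
        ∫ ω, ∏ t ∈ I, v t n (Y t ω) ∂(M.P ν₂) := fun n => by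
      obtain ⟨g, hg⟩ := M.exists_integral_incrProd_eq I (v := fun t => v t n)
        fun t y => (hv01 t n y).1
      rw [M.integral_prod_Y_eq ν₁ hg,
        M.integral_prod_Y_eq ν₂ hg]
      exact h g ⟨I, fun t => v t n, fun t y => (hv01 t n y).1, hg⟩
    have h2 := tendsto_nhds_unique (hlim ν₁) ((hlim ν₂).congr fun n => (heq n).symm)
    exact (measureReal_eq_measureReal_iff).1 h2
  set C := piiUnionInter (fun t : ℝ≥0 => {A : Set (Path S p) | ∃ F, IsClosed F ∧ Y t ⁻¹' F = A})
    Set.univ with hC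
  have hpi : IsPiSystem C := by
    refine isPiSystem_piiUnionInter _ (fun t => ?_) _
    rintro _ ⟨F, hF, rfl⟩ _ ⟨G, hG, rfl⟩ -
    exact ⟨F ∩ G, hF.inter hG, rfl⟩
  have hle : MeasurableSpace.generateFrom C ≤ (inferInstance : MeasurableSpace (Path S p)) := by
    refine MeasurableSpace.generateFrom_le ?_
    rintro _ ⟨I, -, A, hA, rfl⟩
    refine Finset.measurableSet_biInter I fun t ht => ?_
    obtain ⟨F, hF, hFA⟩ := hA t ht
    exact hFA ▸ measurable_Y t hF.measurableSet
  have hext : (M.P ν₁).trim hle = (M.P ν₂).trim hle := by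
    refine ext_of_generate_finite C rfl hpi (fun A hA => ?_) ?_
    · rw [trim_measurableSet_eq hle (MeasurableSpace.measurableSet_generateFrom hA),
        trim_measurableSet_eq hle (MeasurableSpace.measurableSet_generateFrom hA)]
      obtain ⟨I, -, B, hB, rfl⟩ := hA
      choose! F hF hFB using hB
      classical
      have h3 : (⋂ t ∈ I, B t) = ⋂ t ∈ I, Y t ⁻¹' (if t ∈ I then F t else ∅) :=
        Set.iInter₂_congr fun t ht => by rw [if_pos ht, hFB t ht]
      rw [h3]
      refine hcyl I _ fun t => ?_
      split_ifs with ht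
      exacts [hF t ht, isClosed_empty]
    · rw [trim_measurableSet_eq hle MeasurableSet.univ, trim_measurableSet_eq hle MeasurableSet.univ,
        measure_univ, measure_univ]
  intro A hA
  have hA' : MeasurableSet[MeasurableSpace.generateFrom C] A := obsSigmaTop_le_generateFrom A hA
  rw [← trim_measurableSet_eq hle hA', ← trim_measurableSet_eq hle hA', hext]

/-- This is what forces the two measures in the duality argument to have equal mass. -/
lemma isTestFunction_one : M.IsTestFunction (BoundedContinuousFunction.const S 1) :=
  ⟨∅, fun _ => 0, fun _ _ => le_rfl, fun x y => by simp [incrProd]⟩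

/-- A separating functional is a difference of two finite measures that agree on test functions.
Normalized, they are observationally equivalent initial laws, on which an observable `f` has equal
integrals, contradicting separation. -/
theorem mem_closure_span_of_mem_observableFunctions [CompactSpace S] [T2Space S] [BorelSpace S]
    {f : S →ᵇ ℝ} (hf : f ∈ M.observableFunctions) :
    f ∈ (Submodule.span ℝ {h | M.IsTestFunction h}).topologicalClosure := by
  rcases isEmpty_or_nonempty S with hS | hS
  · rw [show f = 0 from BoundedContinuousFunction.ext fun x => hS.elim x]
    exact Submodule.zero_mem _
  by_contra hnot
  obtain ⟨φ, hφ0, hφf⟩ := exists_dual_eq_zero_of_notMem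
    (Submodule.isClosed_topologicalClosure _) hnot
  obtain ⟨ψ₁, ψ₂, hψ₁, hψ₂, hφ⟩ := exists_positive_decomposition φ
  obtain ⟨μ₁, _, hμ₁⟩ := exists_measure_of_positive ψ₁ hψ₁
  obtain ⟨μ₂, _, hμ₂⟩ := exists_measure_of_positive ψ₂ hψ₂
  have hφμ : ∀ g : S →ᵇ ℝ, φ g = ∫ x, g x ∂μ₁ - ∫ x, g x ∂μ₂ := fun g => by
    rw [hφ, hμ₁, hμ₂]
  have htest : ∀ g, M.IsTestFunction g → ∫ x, g x ∂μ₁ = ∫ x, g x ∂μ₂ := fun g hg => by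
    have := hφ0 g (Submodule.le_topologicalClosure _ (Submodule.subset_span hg))
    rw [hφμ] at this
    exact sub_eq_zero.1 this
  have hmass : μ₁ Set.univ = μ₂ Set.univ := by
    have := htest _ M.isTestFunction_one
    simp only [BoundedContinuousFunction.const_apply, integral_const, smul_eq_mul, mul_one] at this
    exact (measureReal_eq_measureReal_iff).1 this
  refine hφf ?_
  rw [hφμ]
  -- Measures of zero mass cannot be normalized, but then both vanish and so does the functional.
  rcases eq_or_ne (μ₁ Set.univ) 0 with h0 | h0
  · have h1 : μ₁ = 0 := Measure.measure_univ_eq_zero.1 h0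
    have h2 : μ₂ = 0 := Measure.measure_univ_eq_zero.1 (hmass ▸ h0)
    rw [h1, h2, sub_self]
  have : NeZero μ₁ := ⟨fun h => h0 (by simp [h])⟩
  have : NeZero μ₂ := ⟨fun h => h0 (by simp [hmass, h])⟩
  have hc : (μ₁ Set.univ)⁻¹.toReal ≠ 0 :=
    (ENNReal.toReal_pos (ENNReal.inv_ne_zero.2 (measure_ne_top _ _)) (ENNReal.inv_ne_top.2 h0)).ne'
  have hobs := hf ((μ₁ Set.univ)⁻¹ • μ₁) ((μ₂ Set.univ)⁻¹ • μ₂) inferInstance inferInstance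
    (M.obsEquiv_of_forall_integral_eq fun g hg => by
      rw [integral_smul_measure, integral_smul_measure, hmass, htest g hg])
  rw [integral_smul_measure, integral_smul_measure, ← hmass] at hobs
  exact sub_eq_zero.2 (smul_right_injective ℝ hc hobs)

end Model

/-- A bound on the difference at all late times of `D` passes to every late time by taking right
limits along `D`. -/
lemma tendsto_sub_of_tendsto_dense {D : Set ℝ≥0} (hD : Dense D) {x y : ℝ≥0 → ℝ}
    (hx : IsCadlag x) (hy : IsCadlag y)
    (h : Tendsto (fun q => x q - y q) (atTop ⊓ 𝓟 D) (𝓝 0)) :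
    Tendsto (fun t => |x t - y t|) atTop (𝓝 0) := by
  refine Metric.tendsto_atTop.2 fun ε hε => ?_
  have h1 := (Metric.tendsto_nhds.1 h) (ε / 2) (half_pos hε)
  rw [eventually_inf_principal] at h1
  obtain ⟨T, hT⟩ := eventually_atTop.1 h1
  refine ⟨T, fun t ht => ?_⟩
  have := nhdsWithin_dense_Ioi_neBot hD t
  have h2 : Tendsto (fun s => |x s - y s|) (𝓝[D ∩ Set.Ioi t] t) (𝓝 |x t - y t|) :=
    (((hx t).1.sub (hy t).1).abs).tendsto.mono_left
      (nhdsWithin_mono _ fun s hs => (show t ≤ s from le_of_lt hs.2))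
  have h3 : |x t - y t| ≤ ε / 2 := le_of_tendsto h2 (by
    filter_upwards [self_mem_nhdsWithin] with s hs
    have h4 := hT s (ht.trans (le_of_lt hs.2)) hs.1
    rw [Real.dist_eq, sub_zero] at h4
    exact h4.le)
  rw [Real.dist_eq, sub_zero, abs_abs]
  linarith

end HiddenMarkov

/-! ### Existence and merging of the filters. -/

theorem mainTheorem1 {S : Type*} [TopologicalSpace S] [CompactSpace S] [PolishSpace S]
    [MeasurableSpace S] [BorelSpace S] {p : ℕ} (M : HiddenMarkov.Model S p)
    (μ ν : Measure S) [IsProbabilityMeasure μ] [IsProbabilityMeasure ν] (hμν : μ ≪ ν)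
    (f : S →ᵇ ℝ) (hf : f ∈ M.observableFunctions) :
    (∃ π, M.IsFilter μ f π) ∧ (∃ π, M.IsFilter ν f π) ∧
      ∀ πμ πν : ℝ≥0 → HiddenMarkov.Path S p → ℝ, M.IsFilter μ f πμ → M.IsFilter ν f πν →
        ∀ᵐ ω ∂(M.P μ), Tendsto (fun t : ℝ≥0 => |πμ t ω - πν t ω|) atTop (𝓝 0) := by
  refine ⟨M.exists_isFilter μ f, M.exists_isFilter ν f, fun πμ πν hπμ hπν => ?_⟩
  obtain ⟨D, hDc, hD⟩ := TopologicalSpace.exists_countable_dense ℝ≥0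
  have hac := M.P_absolutelyContinuous hμν
  -- Each version agrees with the conditional expectation only almost surely at each fixed time;
  -- restricting to the countable set `D` leaves one null set. Statements under `P^ν` are moved to
  -- `P^μ` by absolute continuity.
  filter_upwards [hπμ.1, hac.ae_le hπν.1, (ae_ball_iff hDc).2 fun q _ => hπμ.2 q,
    hac.ae_le ((ae_ball_iff hDc).2 fun q _ => hπν.2 q),
    M.ae_tendsto_of_mem_closure_span (M.mem_closure_span_of_mem_observableFunctions hf) hμν hDc]
    with ω h1 h2 h3 h4 h5
  refine HiddenMarkov.tendsto_sub_of_tendsto_dense hD h1 h2 (h5.congr' ?_)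
  filter_upwards [mem_inf_of_right (mem_principal_self D)] with q hq
  rw [h3 q hq, h4 q hq]
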